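/- Let $K\subset\mathbb{C}$ be a finite abelian extension of $\mathbb{Q}$ with ring of integers $\mathbb{Z}_K$ and group of roots of unity $\mu(K)$, let $V$ be a finite-dimensional $K$-vector space, and let $W\subset \mathrm{GL}(V)$ be a finite group generated by pseudo-reflections and acting irreducibly on $V$. Let $\mathcal{A}$ be the set of reflecting hyperplanes of $W$; for $\mathcal{C}\in\mathcal{A}/W$ let $e_{\mathcal{C}}$ be the order of the pointwise stabilizer $W_H$ of any $H\in\mathcal{C}$, and put $\zeta_{e}=\exp(2\pi i/e)$. Let $V^{\mathrm{reg}}$ be the complement in $\mathbb{C}\otimes_K V$ of the (complexified) reflecting hyperplanes, let $x_0\in V^{\mathrm{reg}}$ and let $B=\pi_1(V^{\mathrm{reg}}/W,x_0)$ be the braid group, with its natural homomorphism $B\to W$ and the element $\boldsymbol{\pi}\in B$ given by the loop $t\mapsto e^{2\pi i t}x_0$. Let $\mathbf{u}=(u_{\mathcal{C},j})_{\mathcal{C}\in\mathcal{A}/W,\,0\le j<e_{\mathcal{C}}}$ be indeterminates. The generic Hecke algebra $\mathcal{H}(W)$ is the quotient of $\mathbb{Z}[\mathbf{u},\mathbf{u}^{-1}]B$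 by the ideal generated by the elements $(\mathbf{s}-u_{\mathcal{C},0})\cdots(\mathbf{s}-u_{\mathcal{C},e_{\mathcal{C}}-1})$, for all $\mathcal{C}$ and all monodromy generators $\mathbf{s}$ around the images in $V^{\mathrm{reg}}/W$ of the hyperplanes of $\mathcal{C}$. Assume that $\mathcal{H}(W)$ is a free $\mathbb{Z}[\mathbf{u},\mathbf{u}^{-1}]$-module of rank $|W|$, with a canonical symmetrizing form $t:\mathcal{H}(W)\to\mathbb{Z}[\mathbf{u},\mathbf{u}^{-1}]$: $t(hh')=t(h'h)$; $h\mapsto t(h\,\cdot)$ is an isomorphism of $\mathcal{H}(W)$ onto its dual; under $u_{\mathcal{C},j}\mapsto\zeta_{e_{\mathcal{C}}}^j$ the form $t$ becomes the canonical form $w\mapsto\delta_{w,1}$ of the group algebra of $W$; and $t(b^{-1})^*=t(b\boldsymbol{\pi})/t(\boldsymbol{\pi})$ for all $b\in B$, where $^*$ inverts all the indeterminates. Let $y$ be an indeterminate and $q=y^{|\mu(K)|}$. For a family $\mathbf{m}=(m_{\mathcal{C},j})$ of integers let $\varphi_{\mathbf{m}}:u_{\mathcal{C},j}\mapsto\zeta_{e_{\mathcal{C}}}^jq^{m_{\mathcal{C},j}}$,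 let $\mathcal{H}_{\mathbf{m}}$ be the specialization of $\mathcal{H}(W)$ along $\varphi_{\mathbf{m}}$, with scalars in $\mathbb{Z}_K[y,y^{-1}]$, and let $t_{\mathbf{m}}$ be the specialization of $t$. Let $\Lambda$ be an indexing set of $\mathrm{Irr}(W)$, the set of isomorphism classes of simple $KW$-modules, and let $V_{\mathbf{m}}^{\lambda}$ $(\lambda\in\Lambda)$ be the simple $K(y)\mathcal{H}_{\mathbf{m}}$-modules, labelled so that the character of $V^\lambda_{\mathbf{m}}$ specializes at $y=1$ to the character $\lambda$ of $W$ (Tits' deformation theorem). Let $s_\lambda^{\mathbf{m}}$ be the Schur elements, $t_{\mathbf{m}}=\sum_{\lambda}\chi_{V^\lambda_{\mathbf{m}}}/s^{\mathbf{m}}_\lambda$, and $a^{\mathbf{m}}_\lambda=-\mathrm{val}_y(s^{\mathbf{m}}_\lambda)/|\mu(K)|$. Let $\theta:\mathbb{Z}_K[y,y^{-1}]\to k$ be a ring homomorphism to a field $k$ which is the field of fractions of the image of $\theta$; write $k\mathcal{H}_{\mathbf{m}}=k\otimes_{\theta}\mathcal{H}_{\mathbf{m}}$, and $[V^\lambda_{\mathbf{m}}:M]$,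 for $M$ a simple $k\mathcal{H}_{\mathbf{m}}$-module, for the decomposition numbers associated with $\theta$: for every $h\in\mathcal{H}_{\mathbf{m}}$ the image under $\theta$ of the characteristic polynomial of $h$ on $V^\lambda_{\mathbf{m}}$ is $\prod_M\mathrm{charpoly}(h\,|\,M)^{[V^\lambda_{\mathbf{m}}:M]}$. A subset $\mathcal{B}\subset\Lambda$ is a basic set of $k\mathcal{H}_{\mathbf{m}}$ with respect to $\theta$ if there is a bijection $M\mapsto\lambda_M$ from $\mathrm{Irr}(k\mathcal{H}_{\mathbf{m}})$ onto $\mathcal{B}$ such that, for all $M$, $[V_{\mathbf{m}}^{\lambda_M}:M]=1$, and $a^{\mathbf{m}}_\mu>a^{\mathbf{m}}_{\lambda_M}$ for all $\mu\ne\lambda_M$ with $[V_{\mathbf{m}}^{\mu}:M]\neq0$. Assume that $k\mathcal{H}_{\mathbf{m}}$ is split and has a basic set $\mathcal{B}(\varphi_{\mathbf{m}})\subset\Lambda$ with respect to $\theta$. Let $\mathbf{n}=(n_{\mathcal{C},j})$ be a family of integers with $n_{\mathcal{C},0}=n_{\mathcal{C},1}=\cdots=n_{\mathcal{C},e_{\mathcal{C}}-1}$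 for all $\mathcal{C}\in\mathcal{A}/W$. Then $k\mathcal{H}_{\mathbf{m}+\mathbf{n}}$ has one and only one basic set $\mathcal{B}(\varphi_{\mathbf{m}+\mathbf{n}})\subset\Lambda$ with respect to $\theta$, and $\mathcal{B}(\varphi_{\mathbf{m}+\mathbf{n}})=\mathcal{B}(\varphi_{\mathbf{m}})$. -/

import Mathlib

open scoped TensorProduct NumberField LaurentPolynomial LaurentSeries

noncomputable section

namespace CyclotomicHecke

/-! ### Simple modules over an algebra -/

section Irr

/-- Two maximal left ideals are equivalent when the simple modules they define are isomorphic. -/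
def irrSetoid (A : Type*) [Ring A] : Setoid {I : Submodule A A // IsCoatom I} where
  r I J := Nonempty ((A ⧸ I.1) ≃ₗ[A] (A ⧸ J.1))
  iseqv := ⟨fun _ => ⟨LinearEquiv.refl _ _⟩, fun ⟨e⟩ => ⟨e.symm⟩, fun ⟨e⟩ ⟨f⟩ => ⟨e.trans f⟩⟩

/-- `Irr A` is the set of isomorphism classes of simple left `A`-modules (every simple module is
isomorphic to `A ⧸ I` for some maximal left ideal `I`). -/
def Irr (A : Type*) [Ring A] : Type _ := Quotient (irrSetoid A)

/-- A simple module in the class `x`. -/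
abbrev Irr.Mod {A : Type*} [Ring A] (x : Irr A) : Type _ := A ⧸ (Quotient.out x).1

variable (F : Type*) [Field F] {A : Type*} [Ring A] [Algebra F A]

/-- The character of the simple module in the class `x`. -/
def character (x : Irr A) (a : A) : F :=
  LinearMap.trace F x.Mod (Algebra.lsmul F F x.Mod a)

open Classical in
/-- The characteristic polynomial of `a` acting on a simple module in the class `x`
(all simple modules of a finite-dimensional algebra are finite-dimensional). -/
def charpolyOn (x : Irr A) (a : A) : Polynomial F :=
  if _h : Module.Finite F x.Mod then LinearMap.charpoly (Algebra.lsmul F F x.Mod a) else 0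

variable (A) in
/-- The `F`-algebra `A` is split: every endomorphism of a simple `A`-module is a scalar. -/
def IsSplit : Prop :=
  ∀ (x : Irr A) (f : Module.End A x.Mod), ∃ c : F, ∀ v, f v = c • v

end Irr

/-! ### Specialization of algebras along a ring homomorphism -/

section Specialization

variable {R S : Type*} [CommRing R] [CommRing S] (f : R →+* S) (H : Type*) [Ring H] [Algebra R H]

/-- The ring `S`, considered as an `R`-algebra through `f`. -/
def Via (_f : R →+* S) : Type _ := S

instance : CommRing (Via f) := inferInstanceAs (CommRing S)
instance : Algebra R (Via f) := f.toAlgebra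
instance : Algebra S (Via f) := Algebra.id S

/-- `S ⊗[R] H`, where `S` is an `R`-algebra through `f`. -/
def Specialization : Type _ := Via f ⊗[R] H

instance : Ring (Specialization f H) := inferInstanceAs (Ring (Via f ⊗[R] H))
instance : Algebra S (Specialization f H) := inferInstanceAs (Algebra S (Via f ⊗[R] H))

variable {H}

/-- The map `h ↦ 1 ⊗ h`. -/
def specialize : H →+* Specialization f H :=
  (Algebra.TensorProduct.includeRight : H →ₐ[R] Via f ⊗[R] H).toRingHom

/-- The specialization of a linear form: `s ⊗ h ↦ s * f (t h)`. -/
def specializeForm (t : H →ₗ[R] R) : Specialization f H →ₗ[S] S where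
  toFun := (TensorProduct.AlgebraTensorModule.rid R (Via f) (Via f)).toLinearMap ∘ₗ
    t.baseChange (Via f)
  map_add' := map_add _
  map_smul' c := map_smul ((TensorProduct.AlgebraTensorModule.rid R (Via f) (Via f)).toLinearMap ∘ₗ
    t.baseChange (Via f)) (c : Via f)

end Specialization

/-! ### Laurent polynomials in several indeterminates over `ℤ` -/

section Laurent

/-- The ring `ℤ[u, u⁻¹]` in the indeterminates `u i`, `i : I`. -/
abbrev MvLaurent (I : Type*) : Type _ := AddMonoidAlgebra ℤ (I →₀ ℤ)

variable {I : Type*}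

/-- The indeterminate `u i`. -/
def indet (i : I) : MvLaurent I := AddMonoidAlgebra.single (Finsupp.single i 1) 1

/-- The ring homomorphism sending each `u i` to the unit `x i`. -/
def evalUnits {S : Type*} [CommRing S] (x : I → Sˣ) : MvLaurent I →+* S :=
  (AddMonoidAlgebra.lift ℤ S (I →₀ ℤ) ((Units.coeHom S).comp
    (AddMonoidHom.toMultiplicativeLeft
      (Finsupp.liftAddHom fun i => (zmultiplesHom (Additive Sˣ)) (Additive.ofMul (x i)))))).toRingHom

/-- Simultaneous inversion `u i ↦ (u i)⁻¹` of the indeterminates. -/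
def invertIndets : MvLaurent I →+* MvLaurent I :=
  AddMonoidAlgebra.mapDomainRingHom ℤ (negAddMonoidHom : (I →₀ ℤ) →+ (I →₀ ℤ))

end Laurent

/-! ### Reflection groups -/

section Reflection

variable {K : Type*} [Field K] {V : Type*} [AddCommGroup V] [Module K V]

/-- The space of vectors fixed by `w`. -/
def fixedSpace (w : V ≃ₗ[K] V) : Submodule K V := LinearMap.ker (w.toLinearMap - LinearMap.id)

/-- `w` is a pseudo-reflection: its fixed space is a hyperplane. -/
def IsPseudoReflection (w : V ≃ₗ[K] V) : Prop := IsCoatom (fixedSpace w)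

variable (W : Subgroup (V ≃ₗ[K] V))

/-- `W` is generated by pseudo-reflections. -/
def IsGeneratedByReflections : Prop := Subgroup.closure {w | w ∈ W ∧ IsPseudoReflection w} = W

/-- The tautological representation of `W` on `V`. -/
def tautRep : Representation K W V :=
  (LinearEquiv.automorphismGroup.toLinearMapMonoidHom).comp W.subtype

/-- The set `𝒜` of reflecting hyperplanes of `W`. -/
def Hyperplane : Type _ :=
  {H : Submodule K V // ∃ w ∈ W, IsPseudoReflection w ∧ fixedSpace w = H}

/-- Two hyperplanes are equivalent when they are conjugate under `W`. -/
def hyperplaneSetoid : Setoid (Hyperplane W) where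
  r H H' := ∃ w ∈ W, H.1.map (w : V ≃ₗ[K] V).toLinearMap = H'.1
  iseqv := by
    refine ⟨fun H => ⟨1, W.one_mem, ?_⟩, ?_, ?_⟩
    · exact Submodule.map_id _
    · rintro H H' ⟨w, hw, h⟩
      refine ⟨w⁻¹, W.inv_mem hw, ?_⟩
      rw [← h, ← Submodule.map_comp]
      convert Submodule.map_id H.1
      ext v
      exact w.symm_apply_apply v
    · rintro H H' H'' ⟨w, hw, h⟩ ⟨w', hw', h'⟩
      refine ⟨w' * w, W.mul_mem hw' hw, ?_⟩
      rw [← h', ← h, ← Submodule.map_comp]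
      rfl

/-- The set `𝒜 / W` of orbits of hyperplanes. -/
def HOrbit : Type _ := Quotient (hyperplaneSetoid W)

/-- The pointwise stabilizer `W_H` of a hyperplane. -/
def pointwiseStabilizer (H : Hyperplane W) : Subgroup (V ≃ₗ[K] V) :=
  W ⊓ fixingSubgroup (V ≃ₗ[K] V) (H.1 : Set V)

/-- `e_C`, the common order of the groups `W_H` for `H` in the orbit `C`. -/
def ordC (C : HOrbit W) : ℕ := Nat.card (pointwiseStabilizer W (Quotient.out C))

/-- The index set of the parameters: pairs `(C, j)` with `0 ≤ j < e_C`. -/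
abbrev ParamIndex : Type _ := Σ C : HOrbit W, Fin (ordC W C)

/-- The set `ℳ` of families of integers `m_{C,j}`. -/
abbrev Params : Type _ := (C : HOrbit W) → Fin (ordC W C) → ℤ

/-! ### The braid group -/

variable [Algebra K ℂ]

variable (K V) in
/-- The complex vector space `V_ℂ = ℂ ⊗ V`. -/
def Complexification : Type _ := ℂ ⊗[K] V

instance : AddCommGroup (Complexification K V) := inferInstanceAs (AddCommGroup (ℂ ⊗[K] V))
instance : Module ℂ (Complexification K V) := inferInstanceAs (Module ℂ (ℂ ⊗[K] V))

/-- The usual topology of a finite-dimensional complex vector space. -/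
instance : TopologicalSpace (Complexification K V) := moduleTopology ℂ (Complexification K V)
instance : IsModuleTopology ℂ (Complexification K V) := ⟨rfl⟩

/-- The hyperplane `ℂ ⊗ H` of `V_ℂ`. -/
def complexHyperplane (H : Submodule K V) : Submodule ℂ (Complexification K V) := H.baseChange ℂ

/-- The action of a linear automorphism of `V` on `V_ℂ`. -/
def act (w : V ≃ₗ[K] V) : Complexification K V →ₗ[ℂ] Complexification K V :=
  w.toLinearMap.baseChange ℂ

/-- `V^reg`, the complement of the reflecting hyperplanes. -/
def VReg : Type _ :=
  {x : Complexification K V // ∀ H : Hyperplane W, x ∉ complexHyperplane H.1}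

instance : TopologicalSpace (VReg W) := inferInstanceAs (TopologicalSpace (Subtype _))

lemma act_one (x : Complexification K V) : act (1 : V ≃ₗ[K] V) x = x := by
  have : act (1 : V ≃ₗ[K] V) = LinearMap.id := LinearMap.baseChange_id
  rw [this]; rfl

lemma act_mul (w w' : V ≃ₗ[K] V) (x : Complexification K V) :
    act (w * w') x = act w (act w' x) := by
  have : act (w * w') = act w ∘ₗ act w' :=
    LinearMap.baseChange_comp (A := ℂ) w'.toLinearMap w.toLinearMap
  rw [this]; rfl

/-- Two points of `V^reg` are equivalent when they are in the same `W`-orbit. -/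
def regSetoid : Setoid (VReg W) where
  r x y := ∃ w ∈ W, act w x.1 = y.1
  iseqv := by
    refine ⟨fun x => ⟨1, W.one_mem, act_one _⟩, ?_, ?_⟩
    · rintro x y ⟨w, hw, h⟩
      refine ⟨w⁻¹, W.inv_mem hw, ?_⟩
      rw [← h, ← act_mul, inv_mul_cancel, act_one]
    · rintro x y z ⟨w, hw, h⟩ ⟨w', hw', h'⟩
      refine ⟨w' * w, W.mul_mem hw' hw, ?_⟩
      rw [act_mul, h, h']

/-- The quotient space `V^reg / W`. -/
def VRegQuot : Type _ := Quotient (regSetoid W)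

instance : TopologicalSpace (VRegQuot W) := inferInstanceAs (TopologicalSpace (Quotient _))

variable {W}

/-- The projection `V^reg → V^reg / W`. -/
def proj (x : VReg W) : VRegQuot W := Quotient.mk (regSetoid W) x

lemma continuous_proj : Continuous (proj (W := W)) := continuous_quotient_mk'

/-- The braid group `B = π₁(V^reg / W, x₀)`. Products are concatenations of loops
(first factor first), whence the opposite of Mathlib's fundamental group. -/
abbrev Braid (x₀ : VReg W) : Type _ := (FundamentalGroup (VRegQuot W) (proj x₀))ᵐᵒᵖ

/-- The class of a loop in the braid group. -/
def Braid.ofLoop {x₀ : VReg W} (γ : Path (proj x₀) (proj x₀)) : Braid x₀ :=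
  MulOpposite.op (FundamentalGroup.fromPath (Path.Homotopic.Quotient.mk γ))

/-- `b` maps to `w` under the natural homomorphism `B → W`: some loop in the class `b` lifts to a
path in `V^reg` from `x₀` to `w x₀`. -/
def Braid.MapsTo {x₀ : VReg W} (b : Braid x₀) (w : W) : Prop :=
  ∃ (x₁ : VReg W) (h : proj x₀ = proj x₁) (γ : Path x₀ x₁),
    x₁.1 = act w.1 x₀.1 ∧ b = Braid.ofLoop ((γ.map continuous_proj).cast rfl h)

/-- `b` is a monodromy generator around the image of `H` in `V^reg / W`: one goes from `x₀` to a
point `p + l` near `H`, where `p ∈ H` and `l` is in the complementary line stable under `W_H`,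
turns around `H` by the angle `2π / e_H` in the positive direction, which leads to `s (p + l)`
where `s ∈ W_H` is the reflection of determinant `exp (2πi / e_H)`, and goes back.
The point is near `H` in the sense that the disc of centre `p` and radius `l` meets
no other hyperplane. -/
def IsMonodromyGenerator {x₀ : VReg W} (H : Hyperplane W) (b : Braid x₀) : Prop :=
  ∃ (s : V ≃ₗ[K] V) (p l : Complexification K V) (x₁ x₂ : VReg W) (γ : Path x₀ x₁)
    (δ : Path x₁ x₂) (h : proj x₁ = proj x₂),
    s ∈ pointwiseStabilizer W H ∧
    p ∈ complexHyperplane H.1 ∧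
    act s l =
      Complex.exp (2 * Real.pi * Complex.I / (Nat.card (pointwiseStabilizer W H) : ℂ)) • l ∧
    (∀ (z : ℂ) (H' : Hyperplane W), ‖z‖ ≤ 1 → p + z • l ∈ complexHyperplane H'.1 → H' = H) ∧
    (∀ r : unitInterval, (δ r).1 = p +
      Complex.exp (2 * Real.pi * Complex.I * ((r : ℝ) : ℂ) /
        (Nat.card (pointwiseStabilizer W H) : ℂ)) • l) ∧
    b = Braid.ofLoop (((γ.map continuous_proj).trans
      ((δ.map continuous_proj).cast rfl h)).trans (γ.map continuous_proj).symm)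

lemma smul_mem_VReg (x : VReg W) (c : ℂ) (hc : c ≠ 0) (H : Hyperplane W) :
    c • x.1 ∉ complexHyperplane H.1 := fun h =>
  x.2 H (((complexHyperplane H.1).smul_mem_iff hc).1 h)

/-- The loop `r ↦ exp (2πi r) x₀` in `V^reg`. -/
def fullTwistLoop (x₀ : VReg W) : Path x₀ x₀ where
  toFun r := ⟨Complex.exp (2 * Real.pi * Complex.I * ((r : ℝ) : ℂ)) • x₀.1,
    smul_mem_VReg x₀ _ (Complex.exp_ne_zero _)⟩
  continuous_toFun := by
    have : ContinuousSMul ℂ (Complexification K V) :=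
      IsModuleTopology.toContinuousSMul ℂ (Complexification K V)
    exact Continuous.subtype_mk (by fun_prop) _
  source' := Subtype.ext (by simp)
  target' := Subtype.ext (by simp [Complex.exp_two_pi_mul_I])

/-- The central element `π` of the braid group. -/
def fullTwist (x₀ : VReg W) : Braid x₀ := Braid.ofLoop ((fullTwistLoop x₀).map continuous_proj)

/-! ### The generic Hecke algebra -/

/-- The relations `(s - u_{C,0}) ⋯ (s - u_{C,e_C-1}) = 0` in the group algebra `ℤ[u, u⁻¹] B`,
for `s` a monodromy generator around (the image of) a hyperplane in the orbit `C`. -/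
inductive HeckeRel (x₀ : VReg W) :
    MonoidAlgebra (MvLaurent (ParamIndex W)) (Braid x₀) →
    MonoidAlgebra (MvLaurent (ParamIndex W)) (Braid x₀) → Prop
  | mk (C : HOrbit W) (H : Hyperplane W) (hH : Quotient.mk (hyperplaneSetoid W) H = C)
      (s : Braid x₀) (hs : IsMonodromyGenerator H s) :
      HeckeRel x₀
        (List.ofFn fun j : Fin (ordC W C) =>
          (MonoidAlgebra.single s 1 - MonoidAlgebra.single 1 (indet ⟨C, j⟩) :
            MonoidAlgebra (MvLaurent (ParamIndex W)) (Braid x₀))).prod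
        0

/-- The generic Hecke algebra `ℋ(W)` over `ℤ[u, u⁻¹]`. -/
abbrev GenericHecke (x₀ : VReg W) : Type _ := RingQuot (HeckeRel x₀)

/-- The image of a braid in `ℋ(W)`. -/
def braidElt {x₀ : VReg W} (b : Braid x₀) : GenericHecke x₀ :=
  RingQuot.mkRingHom (HeckeRel x₀) (MonoidAlgebra.single b 1)

variable [NumberField K]

/-- `ζ C` is the element `exp (2πi / e_C)` of `K` for every orbit `C`. -/
def IsRootFamily (ζ : HOrbit W → (𝓞 K)ˣ) : Prop :=
  ∀ C, algebraMap K ℂ ((ζ C : 𝓞 K) : K) = Complex.exp (2 * Real.pi * Complex.I / (ordC W C : ℂ))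

/-- The canonical symmetrizing form on the generic Hecke algebra. -/
structure IsCanonicalForm {x₀ : VReg W} (ζ : HOrbit W → (𝓞 K)ˣ)
    (t : GenericHecke x₀ →ₗ[MvLaurent (ParamIndex W)] MvLaurent (ParamIndex W)) : Prop where
  /-- `t` is a trace form. -/
  symm : ∀ h h', t (h * h') = t (h' * h)
  /-- The bilinear form `(h, h') ↦ t (h h')` is non-degenerate, i.e. identifies `ℋ(W)` with
  its dual. -/
  nondegenerate : Function.Bijective fun h => t ∘ₗ LinearMap.mulLeft (MvLaurent (ParamIndex W)) h
  /-- Under `u_{C,j} ↦ ζ_{e_C}^j`, the form `t` becomes the canonical form of the group algebra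
  of `W`. -/
  specialization : ∀ (b : Braid x₀) (w : W), b.MapsTo w →
    (w = 1 → evalUnits (fun i : ParamIndex W => ζ i.1 ^ (i.2 : ℕ)) (t (braidElt b)) = 1) ∧
    (w ≠ 1 → evalUnits (fun i : ParamIndex W => ζ i.1 ^ (i.2 : ℕ)) (t (braidElt b)) = 0)
  /-- `t(b⁻¹)^* = t(b π) / t(π)`, where `^*` is the inversion of all the indeterminates. -/
  inversion : ∀ b : Braid x₀, invertIndets (t (braidElt b⁻¹)) * t (braidElt (fullTwist x₀)) =
    t (braidElt (b * fullTwist x₀))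

/-! ### Cyclotomic Hecke algebras -/

/-- The unit `y ^ n` of the ring `ℤ_K[y, y⁻¹]`. -/
def yPow (R : Type*) [CommRing R] (n : ℤ) : R[T;T⁻¹]ˣ where
  val := LaurentPolynomial.T n
  inv := LaurentPolynomial.T (-n)
  val_inv := by rw [← LaurentPolynomial.T_add, add_neg_cancel, LaurentPolynomial.T_zero]
  inv_val := by rw [← LaurentPolynomial.T_add, neg_add_cancel, LaurentPolynomial.T_zero]

/-- The cyclotomic specialization `φ_m : u_{C,j} ↦ ζ_{e_C}^j q^{m_{C,j}}`,
where `q = y ^ |μ(K)|`. -/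
def cycSpec (ζ : HOrbit W → (𝓞 K)ˣ) (m : Params W) :
    MvLaurent (ParamIndex W) →+* (𝓞 K)[T;T⁻¹] :=
  evalUnits fun i : ParamIndex W =>
    Units.map (LaurentPolynomial.C : 𝓞 K →+* (𝓞 K)[T;T⁻¹]).toMonoidHom (ζ i.1 ^ (i.2 : ℕ)) *
      yPow (𝓞 K) (NumberField.Units.torsionOrder K * m i.1 i.2)

/-- The cyclotomic Hecke algebra `ℋ_m`, with scalars in `ℤ_K[y, y⁻¹]`. -/
abbrev CycHecke (x₀ : VReg W) (ζ : HOrbit W → (𝓞 K)ˣ) (m : Params W) : Type _ :=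
  Specialization (cycSpec ζ m) (GenericHecke x₀)

variable (K) in
/-- The inclusion `ℤ_K[y, y⁻¹] → K(y)`. -/
def toRatFunc : (𝓞 K)[T;T⁻¹] →+* RatFunc K :=
  LaurentPolynomial.eval₂ ((algebraMap K (RatFunc K)).comp (algebraMap (𝓞 K) K))
    (Units.mk0 RatFunc.X RatFunc.X_ne_zero)

variable (K) in
/-- Evaluation `ℤ_K[y, y⁻¹] → K` at `y = 1`. -/
def evalOne : (𝓞 K)[T;T⁻¹] →+* K := LaurentPolynomial.eval₂ (algebraMap (𝓞 K) K) 1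

/-- The algebra `K(y) ℋ_m`. -/
abbrev KyHecke (x₀ : VReg W) (ζ : HOrbit W → (𝓞 K)ˣ) (m : Params W) : Type _ :=
  Specialization (toRatFunc K) (CycHecke x₀ ζ m)

/-- The algebra `k ℋ_m`, where `k` is a `ℤ_K[y, y⁻¹]`-module through `θ`. -/
abbrev kHecke {k : Type*} [Field k] (θ : (𝓞 K)[T;T⁻¹] →+* k) (x₀ : VReg W)
    (ζ : HOrbit W → (𝓞 K)ˣ) (m : Params W) : Type _ :=
  Specialization θ (CycHecke x₀ ζ m)

section BasicSet

variable {Λ : Type*} [Fintype Λ] (irr : Λ ≃ Irr (MonoidAlgebra K W)) (x₀ : VReg W)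
  (ζ : HOrbit W → (𝓞 K)ˣ) (m : Params W)

/-- `E` is the bijection `λ ↦ V_φ^λ` from `Irr(W)` to `Irr(K(y) ℋ_φ)`, `φ = φ_m`, induced by the
specialization `y ↦ 1` (Tits' deformation theorem): the characters of `K(y) ℋ_φ` specialize to the
characters of `W`. -/
def IsTitsBijection (E : Λ ≃ Irr (KyHecke x₀ ζ m)) : Prop :=
  ∀ (l : Λ) (b : Braid x₀) (w : W), b.MapsTo w →
    ∃ p : (𝓞 K)[T;T⁻¹],
      toRatFunc K p = character (RatFunc K) (E l)
        (specialize (toRatFunc K) (specialize (cycSpec ζ m) (braidElt b))) ∧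
      evalOne K p = character K (irr l) (MonoidAlgebra.single w 1)

/-- `s l` is the Schur element of `V_φ^l` with respect to the form `t_φ`:
`t_φ = ∑ (1 / s_χ) χ`. -/
def IsSchurFamily (t : GenericHecke x₀ →ₗ[MvLaurent (ParamIndex W)] MvLaurent (ParamIndex W))
    (E : Λ ≃ Irr (KyHecke x₀ ζ m)) (s : Λ → RatFunc K) : Prop :=
  (∀ l, s l ≠ 0) ∧ ∀ h : KyHecke x₀ ζ m,
    specializeForm (toRatFunc K) (specializeForm (cycSpec ζ m) t) h =
      ∑ l, (s l)⁻¹ * character (RatFunc K) (E l) h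

/-- `a = - val_q (s) = - val_y (s) / |μ(K)|`. -/
def aValue (s : RatFunc K) : ℚ :=
  -(((s : K⸨X⸩).order : ℤ) : ℚ) / (NumberField.Units.torsionOrder K : ℚ)

/-- `d` is the decomposition map associated with `θ`, `d l M = [V_φ^l : M]`. The class
`∑ M, d l M [M]` is the reduction of `V_φ^l` along `θ`: for every `h` in `ℋ_φ` the characteristic
polynomial of `h` on `V_φ^l`, which has coefficients in `ℤ_K[y, y⁻¹]`, specializes under `θ` to the
characteristic polynomial of `h` on `⨁ M, d l M • M`. This property characterizes `d`. -/
def IsDecompositionMap {k : Type*} [Field k] (θ : (𝓞 K)[T;T⁻¹] →+* k)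
    (E : Λ ≃ Irr (KyHecke x₀ ζ m)) (d : Λ → (Irr (kHecke θ x₀ ζ m) →₀ ℕ)) : Prop :=
  ∀ (l : Λ) (h : CycHecke x₀ ζ m), ∃ p : Polynomial (𝓞 K)[T;T⁻¹],
    p.map (toRatFunc K) = charpolyOn (RatFunc K) (E l) (specialize (toRatFunc K) h) ∧
    p.map θ = (d l).prod fun M n => charpolyOn k M (specialize θ h) ^ n

/-- `𝓑 ⊆ Λ` is a basic set for `ℋ_m` with respect to `θ`: writing `V_φ^l = E l`, `s l` for the Schur
elements and `d` for the decomposition map, there is a bijection `M ↦ L M` from the simple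
`k ℋ_m`-modules to `𝓑` with `[V_φ^{L M} : M] = 1` and `a_μ > a_{L M}` for all `μ ≠ L M` with
`[V_φ^μ : M] ≠ 0`. -/
def IsBasicSet (t : GenericHecke x₀ →ₗ[MvLaurent (ParamIndex W)] MvLaurent (ParamIndex W))
    {k : Type*} [Field k] (θ : (𝓞 K)[T;T⁻¹] →+* k) (𝓑 : Set Λ) : Prop :=
  ∃ (E : Λ ≃ Irr (KyHecke x₀ ζ m)) (s : Λ → RatFunc K)
    (d : Λ → (Irr (kHecke θ x₀ ζ m) →₀ ℕ)),
    IsTitsBijection irr x₀ ζ m E ∧ IsSchurFamily x₀ ζ m t E s ∧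
    IsDecompositionMap x₀ ζ m θ E d ∧
    ∃ L : Irr (kHecke θ x₀ ζ m) → Λ, Set.BijOn L Set.univ 𝓑 ∧
      ∀ M, d (L M) M = 1 ∧ ∀ μ, μ ≠ L M → d μ M ≠ 0 → aValue (s (L M)) < aValue (s μ)

end BasicSet

end Reflection

end CyclotomicHecke

end

/-! Let `ν C` be the common value of the `n C j`. Adding `n` to `m` multiplies all the
`φ_m(u_{C,j})` with the same `C` by the same factor `q ^ ν C`, so the relation for a monodromy
generator `s` around `C` survives if `s` is rescaled by that factor. Doing this consistently for all
braids needs a homomorphism `ℓ : B → ℤ` with value `ν C` on those generators. It is the winding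
number of the discriminant `∏ α_H ^ (e_H ν C)`, a `W`-invariant nowhere zero function on `V^reg`
(`braidLength_monodromyGenerator`). Then `b ↦ q ^ ℓ(b) b` is an isomorphism `ℋ_{m+n} ≃ ℋ_m`
(`cycEquiv`). It transports simple modules and decomposition numbers, and it preserves the labelling
by `Λ` because `q = 1` at `y = 1`.

The a-values are preserved once the isomorphism is known to match the two specialized forms, that
is, once `t(b)` is homogeneous of degree `ℓ(b)` when `u_{C,j}` has degree `ν C`
(`IsCanonicalForm.isHomog`). This is the hard point. Split `t` into its homogeneous components
`t_d`; nondegeneracy gives central elements `z_d` with `t_d = t(z_d ·)` and `∑ z_d = 1`. The center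
is reduced, and over a reduced commutative ring the identities `(∑ z_i T^i) · α(z_j) = z_j T^j`,
with `α` the grading, force the `z_d` to be orthogonal idempotents. Since `t 1 = 1` has degree `0`,
`t(z_d) = 0` for `d ≠ 0`. After specialization to the group algebra the regular trace is `|W| t`, so
an idempotent killed by `t` has rank zero; hence `z_d = 0` for `d ≠ 0` (`isHomog_of_symmetrizing`).
Comparison with the regular trace also yields the reducedness of the center.

For uniqueness, the labelling, the Schur elements and the decomposition numbers are each determined
by the algebra and its form, since simple modules are separated by elements of the algebra. The
strict inequalities between a-values then leave only one choice of `M ↦ λ_M` (`IsBasicSet.unique`).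
-/

open scoped TensorProduct NumberField LaurentPolynomial LaurentSeries

noncomputable section

namespace CyclotomicHecke

/-! ### Variation of the logarithm along paths -/

section LogChange

variable {X : Type*} [TopologicalSpace X] (D : C(X, {z : ℂ // z ≠ 0}))

/-- The total variation along `γ` of a continuous logarithm of `D`. -/
def logChange {x y : X} (γ : Path x y) : ℂ :=
  Complex.isCoveringMap_exp.liftPath (D.comp γ.toContinuousMap) (Complex.log (D x))
    (by ext; simp [Complex.exp_log (D x).2]) 1 - Complex.log (D x)

/-- By uniqueness of lifts through the covering `exp`, two continuous logarithms along a path differ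
by a constant. Any convenient logarithm may therefore replace the chosen lift. -/
lemma logChange_eq {x y : X} (γ : Path x y) (Γ : unitInterval → ℂ) (hΓ : Continuous Γ)
    (h : ∀ r, Complex.exp (Γ r) = D (γ r)) : logChange D γ = Γ 1 - Γ 0 := by
  have h0 : Complex.exp (Complex.log (D x) - Γ 0) = 1 := by
    rw [Complex.exp_sub, Complex.exp_log (D x).2, h, γ.source, div_self (D x).2]
  have := (Complex.isCoveringMap_exp.eq_liftPath_iff (γ := D.comp γ.toContinuousMap)
    (e := Complex.log (D x)) (Γ := fun r => Γ r + (Complex.log (D x) - Γ 0))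
    (by ext; simp [Complex.exp_log (D x).2])).2 ⟨by fun_prop, by
      ext r; simp [Complex.exp_add, h0, h], by simp⟩
  rw [logChange, ← this]
  ring

lemma exists_log_path {x y : X} (γ : Path x y) :
    ∃ Γ : C(unitInterval, ℂ), ∀ r, Complex.exp (Γ r) = D (γ r) := by
  obtain ⟨Γ, hΓ, -⟩ := Complex.isCoveringMap_exp.exists_path_lifts (D.comp γ.toContinuousMap)
    (Complex.log (D x)) (by ext; simp [Complex.exp_log (D x).2])
  exact ⟨Γ, fun r => congrArg Subtype.val (congrFun hΓ r)⟩

lemma logChange_refl (x : X) : logChange D (Path.refl x) = 0 := by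
  rw [logChange_eq D _ (fun _ => Complex.log (D x)) (by fun_prop)
    (fun r => by simp [Complex.exp_log (D x).2]), sub_self]

lemma logChange_symm {x y : X} (γ : Path x y) : logChange D γ.symm = -logChange D γ := by
  obtain ⟨Γ, hΓ⟩ := exists_log_path D γ
  rw [logChange_eq D γ Γ Γ.continuous hΓ, logChange_eq D γ.symm (fun r => Γ (unitInterval.symm r))
    (by fun_prop) fun r => by rw [hΓ]; rfl]
  simp

lemma logChange_trans {x y z : X} (γ : Path x y) (γ' : Path y z) :
    logChange D (γ.trans γ') = logChange D γ + logChange D γ' := by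
  obtain ⟨Γ, hΓ⟩ := exists_log_path D γ
  obtain ⟨Γ', hΓ'⟩ := exists_log_path D γ'
  have hexp : Complex.exp (Γ 1 - Γ' 0) = 1 := by
    rw [Complex.exp_sub, hΓ, hΓ', γ.target, γ'.source, div_self (D y).2]
  let p : Path (Γ 0) (Γ 1) := ⟨Γ, rfl, rfl⟩
  -- The second logarithm is translated so as to start where the first one ends; by `hexp` the
  -- translation does not change its exponential.
  let p' : Path (Γ 1) (Γ' 1 + (Γ 1 - Γ' 0)) :=
    ⟨⟨fun r => Γ' r + (Γ 1 - Γ' 0), by fun_prop⟩, by simp, by simp⟩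
  rw [logChange_eq D γ Γ Γ.continuous hΓ, logChange_eq D γ' Γ' Γ'.continuous hΓ',
    logChange_eq D (γ.trans γ') (p.trans p') (p.trans p').continuous fun r => ?_]
  · simp only [Path.source, Path.target]; ring
  · simp only [Path.trans_apply]
    split_ifs
    · exact hΓ _
    · change Complex.exp (Γ' _ + (Γ 1 - Γ' 0)) = _
      rw [Complex.exp_add, hexp, mul_one, hΓ']

lemma logChange_congr {x y : X} {γ γ' : Path x y} (h : γ.Homotopic γ') :
    logChange D γ = logChange D γ' := by
  rw [logChange, logChange, sub_left_inj]
  apply Complex.isCoveringMap_exp.liftPath_apply_one_eq_of_homotopicRel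
  exact h.map D

lemma exists_logChange_eq {x : X} (γ : Path x x) :
    ∃ n : ℤ, logChange D γ = n * (2 * Real.pi * Complex.I) := by
  obtain ⟨Γ, hΓ⟩ := exists_log_path D γ
  rw [logChange_eq D γ Γ Γ.continuous hΓ]
  apply Complex.exp_eq_one_iff.1
  rw [Complex.exp_sub, hΓ, hΓ, γ.target, γ.source, div_self (D x).2]

/-- The winding number of `D` along a loop. -/
def winding {x : X} (γ : Path x x) : ℤ := (exists_logChange_eq D γ).choose

lemma winding_eq_iff {x : X} (γ : Path x x) (n : ℤ) :
    winding D γ = n ↔ logChange D γ = n * (2 * Real.pi * Complex.I) := by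
  rw [(exists_logChange_eq D γ).choose_spec, mul_left_inj' Complex.two_pi_I_ne_zero, Int.cast_inj]
  rfl

lemma logChange_eq_winding {x : X} (γ : Path x x) :
    logChange D γ = winding D γ * (2 * Real.pi * Complex.I) := (winding_eq_iff D γ _).1 rfl

/-- The homomorphism `π₁(X, x) → ℤ` given by the winding number of `D`. -/
def windingHom (x : X) : (FundamentalGroup X x)ᵐᵒᵖ →* Multiplicative ℤ where
  toFun b := Multiplicative.ofAdd (Quotient.lift (fun γ : Path x x => winding D γ)
    (fun γ γ' h => (winding_eq_iff D γ _).2 <| by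
      rw [logChange_congr D h, logChange_eq_winding]) (FundamentalGroup.toPath b.unop))
  map_one' := by
    refine congrArg Multiplicative.ofAdd ((winding_eq_iff D (Path.refl x) 0).2 ?_)
    rw [logChange_refl]; simp
  map_mul' := by
    rintro ⟨⟨γ⟩⟩ ⟨⟨γ'⟩⟩
    refine congrArg Multiplicative.ofAdd ((winding_eq_iff D (γ.trans γ') _).2 ?_)
    rw [logChange_trans, logChange_eq_winding, logChange_eq_winding, ← add_mul, ← Int.cast_add]
    rfl

end LogChange

/-! ### Linear forms defining the reflecting hyperplanes -/

section Forms

variable {K : Type*} [Field K] {V : Type*} [AddCommGroup V] [Module K V]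

lemma exists_smul_eq_of_ker_eq {f g : V →ₗ[K] K} (hg : g ≠ 0)
    (h : LinearMap.ker f = LinearMap.ker g) : ∃ c : K, c ≠ 0 ∧ ∀ v, f v = c * g v := by
  obtain ⟨v₀, hv₀⟩ : ∃ v, g v ≠ 0 := by
    by_contra! hc
    exact hg (LinearMap.ext hc)
  have hf₀ : f v₀ ≠ 0 := fun hc => hv₀ (LinearMap.mem_ker.1 (h ▸ LinearMap.mem_ker.2 hc))
  refine ⟨f v₀ / g v₀, div_ne_zero hf₀ hv₀, fun v => ?_⟩
  have hker : v - (g v / g v₀) • v₀ ∈ LinearMap.ker f := by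
    rw [h, LinearMap.mem_ker, map_sub, map_smul, smul_eq_mul, div_mul_cancel₀ _ hv₀, sub_self]
  rw [LinearMap.mem_ker, map_sub, map_smul, smul_eq_mul, sub_eq_zero] at hker
  rw [hker]
  field_simp

lemma exists_ker_eq_of_isCoatom {H : Submodule K V} (hH : IsCoatom H) :
    ∃ f : V →ₗ[K] K, f ≠ 0 ∧ LinearMap.ker f = H := by
  obtain ⟨f, hf, hle⟩ := Submodule.exists_le_ker_of_lt_top H hH.lt_top
  refine ⟨f, hf, (eq_or_lt_of_le hle).elim Eq.symm fun hlt => ?_⟩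
  exact absurd (LinearMap.ker_eq_top.1 (hH.2 _ hlt)) hf

variable {W : Subgroup (V ≃ₗ[K] V)}

lemma Hyperplane.isCoatom (H : Hyperplane W) : IsCoatom H.1 := by
  obtain ⟨w, -, hw, h⟩ := H.2
  exact h ▸ hw

/-- A linear form with kernel `H`. -/
def Hyperplane.form (H : Hyperplane W) : V →ₗ[K] K :=
  (exists_ker_eq_of_isCoatom H.isCoatom).choose

lemma Hyperplane.form_ne_zero (H : Hyperplane W) : H.form ≠ 0 :=
  (exists_ker_eq_of_isCoatom H.isCoatom).choose_spec.1

lemma Hyperplane.ker_form (H : Hyperplane W) : LinearMap.ker H.form = H.1 :=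
  (exists_ker_eq_of_isCoatom H.isCoatom).choose_spec.2

lemma Hyperplane.form_eq_zero_iff (H : Hyperplane W) (v : V) : H.form v = 0 ↔ v ∈ H.1 := by
  rw [← LinearMap.mem_ker, H.ker_form]

instance [Finite W] : Finite (Hyperplane W) := by
  refine Finite.of_injective (β := W) (fun H => ⟨H.2.choose, H.2.choose_spec.1⟩) fun H H' h => ?_
  apply Subtype.ext
  rw [← H.2.choose_spec.2.2, ← H'.2.choose_spec.2.2]
  exact congrArg (fun w : W => fixedSpace w.1) h

lemma mem_fixedSpace {w : V ≃ₗ[K] V} {v : V} : v ∈ fixedSpace w ↔ w v = v := by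
  simp [fixedSpace, sub_eq_zero]

lemma fixedSpace_conj (w s : V ≃ₗ[K] V) :
    fixedSpace (w * s * w⁻¹) = (fixedSpace s).map w.toLinearMap := by
  ext v
  rw [mem_fixedSpace, Submodule.mem_map_equiv, mem_fixedSpace]
  change w (s (w.symm v)) = v ↔ _
  rw [← LinearEquiv.eq_symm_apply]

lemma map_mul_hyperplane (w w' : V ≃ₗ[K] V) (H : Submodule K V) :
    H.map (w * w').toLinearMap = (H.map w'.toLinearMap).map w.toLinearMap :=
  Submodule.map_comp _ _ _

instance : MulAction W (Hyperplane W) where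
  smul w H := ⟨H.1.map w.1.toLinearMap, by
    obtain ⟨s, hs, hr, h⟩ := H.2
    refine ⟨w.1 * s * w.1⁻¹, W.mul_mem (W.mul_mem w.2 hs) (W.inv_mem w.2), ?_, ?_⟩
    · rw [IsPseudoReflection, fixedSpace_conj]
      exact (OrderIso.isCoatom_iff (Submodule.orderIsoMapComap w.1) _).2 hr
    · rw [fixedSpace_conj, h]⟩
  one_smul H := Subtype.ext (Submodule.map_id _)
  mul_smul w w' H := Subtype.ext (map_mul_hyperplane w.1 w'.1 H.1)

lemma Hyperplane.coe_smul (w : W) (H : Hyperplane W) : (w • H).1 = H.1.map w.1.toLinearMap := rfl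

lemma Hyperplane.mk_smul (w : W) (H : Hyperplane W) :
    Quotient.mk (hyperplaneSetoid W) (w • H) = Quotient.mk (hyperplaneSetoid W) H :=
  (Quotient.sound ⟨w.1, w.2, rfl⟩ :
    Quotient.mk (hyperplaneSetoid W) H = Quotient.mk (hyperplaneSetoid W) (w • H)).symm

lemma exists_form_smul (w : W) (H : Hyperplane W) :
    ∃ c : K, c ≠ 0 ∧ ∀ v, (w • H).form (w.1 v) = c * H.form v := by
  refine exists_smul_eq_of_ker_eq (f := (w • H).form ∘ₗ w.1.toLinearMap) H.form_ne_zero ?_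
  ext v
  rw [LinearMap.mem_ker, LinearMap.comp_apply, Hyperplane.form_eq_zero_iff, H.ker_form,
    Hyperplane.coe_smul]
  exact (Submodule.mem_map_equiv (e := w.1) H.1).trans (by simp)

/-- The factor by which `w` changes the linear form defining `H`. -/
def formFactor (w : W) (H : Hyperplane W) : K := (exists_form_smul w H).choose

lemma formFactor_ne_zero (w : W) (H : Hyperplane W) : formFactor w H ≠ 0 :=
  (exists_form_smul w H).choose_spec.1

lemma form_smul (w : W) (H : Hyperplane W) (v : V) :
    (w • H).form (w.1 v) = formFactor w H * H.form v :=
  (exists_form_smul w H).choose_spec.2 v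

lemma card_pointwiseStabilizer_smul (w : W) (H : Hyperplane W) :
    Nat.card (pointwiseStabilizer W (w • H)) = Nat.card (pointwiseStabilizer W H) := by
  have key (w : W) (H : Hyperplane W) (g : V ≃ₗ[K] V) (hg : g ∈ pointwiseStabilizer W H) :
      w.1 * g * w.1⁻¹ ∈ pointwiseStabilizer W (w • H) := by
    refine ⟨W.mul_mem (W.mul_mem w.2 hg.1) (W.inv_mem w.2), (mem_fixingSubgroup_iff _).2 ?_⟩
    rintro _ ⟨v, hv, rfl⟩
    have h2 := (mem_fixingSubgroup_iff _).1 hg.2 v hv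
    change w.1 (g (w.1.symm (w.1 v))) = w.1 v
    rw [LinearEquiv.symm_apply_apply]
    exact congrArg w.1 h2
  refine Nat.card_congr ⟨fun g => ⟨w.1⁻¹ * g.1 * w.1, ?_⟩,
    fun g => ⟨w.1 * g.1 * w.1⁻¹, key w H g.1 g.2⟩, fun g => ?_, fun g => ?_⟩
  · have := key w⁻¹ (w • H) g.1 g.2
    rwa [inv_smul_smul, Subgroup.coe_inv, inv_inv] at this
  · apply Subtype.ext; simp only; group
  · apply Subtype.ext; simp only; group

/-- A vector space over an infinite field is not a finite union of proper subspaces; the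
intersections `H ∩ H₀` are proper in `H₀` because hyperplanes are maximal. -/
lemma exists_mem_forall_notMem [Infinite K] [Finite W] (H₀ : Hyperplane W) :
    ∃ v ∈ H₀.1, ∀ H : Hyperplane W, H ≠ H₀ → v ∉ H.1 := by
  classical
  have := Fintype.ofFinite (Hyperplane W)
  have hne := Subspace.biUnion_ne_univ_of_top_notMem (k := K) (E := H₀.1)
    (s := (Finset.univ.erase H₀).image fun H => H.1.comap H₀.1.subtype) (by
      rw [Finset.mem_image]
      rintro ⟨H, hH, hc⟩
      have hle : H₀.1 ≤ H.1 := by rwa [Submodule.comap_subtype_eq_top] at hc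
      refine (Finset.mem_erase.1 hH).1 (Subtype.ext ?_)
      exact (eq_or_lt_of_le hle).elim Eq.symm fun h => absurd (H₀.isCoatom.2 _ h) H.isCoatom.1)
  obtain ⟨v, hv⟩ := (Set.ne_univ_iff_exists_notMem _).1 hne
  refine ⟨v.1, v.2, fun H hH hmem => hv ?_⟩
  simp only [Set.mem_iUnion]
  exact ⟨_, Finset.mem_image_of_mem _ (Finset.mem_erase.2 ⟨hH, Finset.mem_univ _⟩), hmem⟩

/-- Invariance of the discriminant under a reflection `s` with hyperplane `H₀`. The factor at `H₀`
is a root of unity of order dividing `|W_{H₀}|`, which divides the exponent. The remaining factors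
multiply to `1`, as is seen at a vector of `H₀` lying on no other hyperplane: `s` fixes it and
permutes the other linear forms up to these factors. -/
lemma prod_formFactor_zpow_eq_one [Infinite K] [Finite W] [Fintype (Hyperplane W)]
    (a : Hyperplane W → ℤ) (ha : ∀ (w : W) H, a (w • H) = a H)
    (hdvd : ∀ H, (Nat.card (pointwiseStabilizer W H) : ℤ) ∣ a H)
    (s : W) (hs : IsPseudoReflection s.1) : ∏ H, formFactor s H ^ a H = 1 := by
  classical
  let H₀ : Hyperplane W := ⟨fixedSpace s.1, s.1, s.2, hs, rfl⟩
  have hfix (v : V) (hv : v ∈ H₀.1) : s.1 v = v := mem_fixedSpace.1 hv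
  have hH₀ : s • H₀ = H₀ := by
    apply Subtype.ext
    rw [Hyperplane.coe_smul]
    refine le_antisymm ?_ fun v hv => ⟨v, hv, hfix v hv⟩
    rintro _ ⟨v, hv, rfl⟩
    change s.1 v ∈ H₀.1
    rwa [hfix v hv]
  have hmem : s.1 ∈ pointwiseStabilizer W H₀ :=
    ⟨s.2, (mem_fixingSubgroup_iff _).2 fun v hv => hfix v hv⟩
  have h₀ : formFactor s H₀ ^ a H₀ = 1 := by
    have hpow (j : ℕ) (v : V) : H₀.form ((s.1 ^ j) v) = formFactor s H₀ ^ j * H₀.form v := by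
      induction j with
      | zero => simp
      | succ j ih =>
        rw [pow_succ', pow_succ', mul_assoc, ← ih]
        have := form_smul s H₀ ((s.1 ^ j) v)
        rwa [hH₀] at this
    have hone : s.1 ^ Nat.card (pointwiseStabilizer W H₀) = 1 :=
      congrArg Subtype.val (pow_card_eq_one' (x := (⟨s.1, hmem⟩ : pointwiseStabilizer W H₀)))
    obtain ⟨v, hv⟩ : ∃ v, H₀.form v ≠ 0 := by
      by_contra! hc
      exact H₀.form_ne_zero (LinearMap.ext hc)
    have h1 := hpow (Nat.card (pointwiseStabilizer W H₀)) v
    rw [hone] at h1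
    have h2 : formFactor s H₀ ^ Nat.card (pointwiseStabilizer W H₀) = 1 :=
      mul_right_cancel₀ hv (by rw [← h1, one_mul]; rfl)
    obtain ⟨c, hc⟩ := hdvd H₀
    rw [hc, zpow_mul, zpow_natCast, h2, one_zpow]
  obtain ⟨v, hv, hgen⟩ := exists_mem_forall_notMem H₀
  have hsne (H : Hyperplane W) : H ∈ Finset.univ.erase H₀ ↔ s • H ∈ Finset.univ.erase H₀ := by
    simp only [Finset.mem_erase, Finset.mem_univ, and_true, ne_eq]
    rw [← smul_left_cancel_iff s (x := H) (y := H₀), hH₀]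
  have hre : ∏ H ∈ Finset.univ.erase H₀, (s • H).form (s.1 v) ^ a (s • H) =
      ∏ H ∈ Finset.univ.erase H₀, H.form v ^ a H := by
    refine Finset.prod_equiv (MulAction.toPerm s) hsne fun H _ => ?_
    rw [hfix v hv]; rfl
  have hnz : ∏ H ∈ Finset.univ.erase H₀, H.form v ^ a H ≠ 0 := by
    refine Finset.prod_ne_zero_iff.2 fun H hH => zpow_ne_zero _ ?_
    rw [ne_eq, H.form_eq_zero_iff]
    exact hgen H (Finset.mem_erase.1 hH).1
  simp only [form_smul, ha, mul_zpow, Finset.prod_mul_distrib] at hre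
  rw [← Finset.mul_prod_erase _ _ (Finset.mem_univ H₀), h₀, one_mul]
  exact mul_right_cancel₀ hnz (by rw [hre, one_mul])

end Forms

/-! ### The space of regular vectors -/

section Regular

variable {K : Type*} [Field K] {V : Type*} [AddCommGroup V] [Module K V] [Algebra K ℂ]

/-- The complexification of a linear form. -/
def cform (f : V →ₗ[K] K) : Complexification K V →ₗ[ℂ] ℂ :=
  (TensorProduct.AlgebraTensorModule.rid K ℂ ℂ).toLinearMap ∘ₗ (f.baseChange ℂ)

/-- The element `z ⊗ v` of the complexification. -/
def ctmul (z : ℂ) (v : V) : Complexification K V := z ⊗ₜ[K] v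

lemma complexification_induction {p : Complexification K V → Prop} (x : Complexification K V)
    (zero : p 0) (tmul : ∀ z v, p (ctmul z v)) (add : ∀ x y, p x → p y → p (x + y)) : p x :=
  TensorProduct.induction_on (motive := p) x zero tmul add

lemma cform_ctmul (f : V →ₗ[K] K) (z : ℂ) (v : V) :
    cform f (ctmul z v) = z * algebraMap K ℂ (f v) := by
  rw [mul_comm, ← Algebra.smul_def]
  rfl

lemma act_ctmul (w : V ≃ₗ[K] V) (z : ℂ) (v : V) : act w (ctmul z v) = ctmul z (w v) := rfl

lemma ctmul_mem {H : Submodule K V} {v : V} (hv : v ∈ H) (z : ℂ) :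
    ctmul z v ∈ complexHyperplane H := Submodule.tmul_mem_baseChange_of_mem z hv

lemma ctmul_add (z : ℂ) (v v' : V) : ctmul (K := K) z (v + v') = ctmul z v + ctmul z v' :=
  TensorProduct.tmul_add z v v'

lemma ctmul_smul (z : ℂ) (c : K) (v : V) :
    ctmul z (c • v) = ctmul (K := K) (algebraMap K ℂ c * z) v := by
  rw [← Algebra.smul_def]
  exact (TensorProduct.smul_tmul c z v).symm

lemma smul_ctmul (a z : ℂ) (v : V) : a • ctmul (K := K) z v = ctmul (a * z) v := rfl

lemma mem_complexHyperplane_ker_iff {f : V →ₗ[K] K} (hf : f ≠ 0) (x : Complexification K V) :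
    x ∈ complexHyperplane (LinearMap.ker f) ↔ cform f x = 0 := by
  constructor
  · intro hx
    have hle : complexHyperplane (LinearMap.ker f) ≤ LinearMap.ker (cform f) := by
      refine (Submodule.baseChange_eq_span ℂ _).le.trans (Submodule.span_le.2 ?_)
      rintro _ ⟨v, hv, rfl⟩
      refine (cform_ctmul f 1 v).trans ?_
      rw [LinearMap.mem_ker.1 hv, map_zero, mul_zero]
    exact hle hx
  · intro hx
    obtain ⟨v₀, hv₀⟩ : ∃ v, f v ≠ 0 := by
      by_contra! hc
      exact hf (LinearMap.ext hc)
    -- Removing the component along `v₀` projects every vector into the complexified kernel; it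
    -- suffices to check this on pure tensors.
    have key : x - cform f x • ctmul ((algebraMap K ℂ (f v₀))⁻¹) v₀ ∈
        complexHyperplane (LinearMap.ker f) := by
      clear hx
      induction x using complexification_induction with
      | zero => rw [map_zero, zero_smul, sub_zero]; exact Submodule.zero_mem _
      | tmul z v =>
        have hv : v = (v - (f v / f v₀) • v₀) + (f v / f v₀) • v₀ := by abel
        have hker : v - (f v / f v₀) • v₀ ∈ LinearMap.ker f := by
          rw [LinearMap.mem_ker, map_sub, map_smul, smul_eq_mul, div_mul_cancel₀ _ hv₀, sub_self]
        rw [cform_ctmul, smul_ctmul]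
        nth_rewrite 1 [hv]
        have hz : algebraMap K ℂ (f v / f v₀) * z =
            z * algebraMap K ℂ (f v) * (algebraMap K ℂ (f v₀))⁻¹ := by
          rw [map_div₀, div_eq_mul_inv]; ring
        rw [ctmul_add, ctmul_smul, hz, add_sub_cancel_right]
        exact ctmul_mem hker z
      | add x y hx hy =>
        rw [map_add, add_smul, add_sub_add_comm]
        exact Submodule.add_mem _ hx hy
    rwa [hx, zero_smul, sub_zero] at key

lemma continuous_linearMap {E : Type*} [AddCommGroup E] [Module ℂ E] [TopologicalSpace E]
    [ContinuousAdd E] [ContinuousSMul ℂ E] (f : Complexification K V →ₗ[ℂ] E) : Continuous f :=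
  IsModuleTopology.continuous_of_linearMap f

instance : ContinuousSMul ℂ (Complexification K V) :=
  IsModuleTopology.toContinuousSMul ℂ (Complexification K V)

instance : IsTopologicalAddGroup (Complexification K V) :=
  IsModuleTopology.topologicalAddGroup ℂ (Complexification K V)

instance : T2Space (Complexification K V) := by
  refine ⟨fun x y hxy => ?_⟩
  obtain ⟨f, hf⟩ : ∃ f : Complexification K V →ₗ[ℂ] ℂ, f (x - y) ≠ 0 := by
    by_contra! hc
    exact hxy (sub_eq_zero.1 ((Module.forall_dual_apply_eq_zero_iff ℂ (x - y)).1 hc))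
  exact separated_by_continuous (continuous_linearMap f)
    fun h => hf (by rw [map_sub, h, sub_self])

variable {W : Subgroup (V ≃ₗ[K] V)}

/-- The value at `x` of the complexified linear form defining `H`. -/
abbrev Hyperplane.cform (H : Hyperplane W) : Complexification K V →ₗ[ℂ] ℂ :=
  CyclotomicHecke.cform H.form

lemma Hyperplane.mem_complex_iff (H : Hyperplane W) (x : Complexification K V) :
    x ∈ complexHyperplane H.1 ↔ H.cform x = 0 := by
  rw [← mem_complexHyperplane_ker_iff H.form_ne_zero, H.ker_form]

lemma VReg.cform_ne_zero (x : VReg W) (H : Hyperplane W) : H.cform x.1 ≠ 0 := fun h =>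
  x.2 H ((H.mem_complex_iff _).2 h)

lemma cform_smul_act (w : W) (H : Hyperplane W) (x : Complexification K V) :
    (w • H).cform (act w.1 x) = algebraMap K ℂ (formFactor w H) * H.cform x := by
  induction x using complexification_induction with
  | zero => simp
  | tmul z v => rw [act_ctmul, cform_ctmul, cform_ctmul, form_smul, map_mul]; ring
  | add x y hx hy => rw [map_add, map_add, hx, hy, map_add, mul_add]

instance : MulAction W (VReg W) where
  smul w x := ⟨act w.1 x.1, fun H h => by
    rw [H.mem_complex_iff, ← smul_inv_smul w H, cform_smul_act] at h
    exact mul_ne_zero ((map_ne_zero _).2 (formFactor_ne_zero _ _)) (x.cform_ne_zero _) h⟩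
  one_smul x := Subtype.ext (act_one x.1)
  mul_smul w w' x := Subtype.ext (act_mul w.1 w'.1 x.1)

lemma VReg.coe_smul (w : W) (x : VReg W) : (w • x).1 = act w.1 x.1 := rfl

lemma continuous_act (w : V ≃ₗ[K] V) : Continuous (act w : Complexification K V → _) :=
  continuous_linearMap (act w)

instance : ContinuousConstSMul W (VReg W) where
  continuous_const_smul w := ((continuous_act w.1).comp continuous_subtype_val).subtype_mk _

instance : T2Space (VReg W) := inferInstanceAs (T2Space (Subtype _))

lemma proj_eq_iff {x y : VReg W} : proj x = proj y ↔ ∃ w : W, w • x = y := by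
  constructor
  · intro h
    obtain ⟨w, hw, h⟩ := Quotient.exact h
    exact ⟨⟨w, hw⟩, Subtype.ext h⟩
  · rintro ⟨w, rfl⟩
    exact Quotient.sound ⟨w.1, w.2, rfl⟩

lemma proj_smul (w : W) (x : VReg W) : proj (w • x) = proj x := (proj_eq_iff.2 ⟨w, rfl⟩).symm

/-- The complex line through `x` and `y` meets each hyperplane in at most one point, and the
complement of a countable set in `ℂ` is path-connected. -/
lemma joined_VReg [Finite W] (x y : VReg W) : Joined x y := by
  let f : ℂ → Complexification K V := fun z => x.1 + z • (y.1 - x.1)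
  let S : Set ℂ := ⋃ H : Hyperplane W, {z | H.cform (f z) = 0}
  have hS : S.Countable := by
    refine (Set.finite_iUnion fun H => Set.Subsingleton.finite fun z hz z' hz' => ?_).countable
    simp only [f, map_add, map_smul, smul_eq_mul, Set.mem_ofPred_eq] at hz hz'
    have hne : H.cform (y.1 - x.1) ≠ 0 := fun h0 => by
      rw [h0, mul_zero, add_zero] at hz
      exact x.cform_ne_zero H hz
    exact mul_right_cancel₀ hne (add_left_cancel (hz.trans hz'.symm))
  have hpc : IsPathConnected Sᶜ := hS.isPathConnected_compl_of_one_lt_rank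
    (by rw [Complex.rank_real_complex]; norm_num)
  have h0 : (0 : ℂ) ∈ Sᶜ := by
    simp only [S, Set.mem_compl_iff, Set.mem_iUnion, not_exists, Set.mem_ofPred_eq, f]
    intro H
    rw [zero_smul, add_zero]
    exact x.cform_ne_zero H
  have h1 : (1 : ℂ) ∈ Sᶜ := by
    simp only [S, Set.mem_compl_iff, Set.mem_iUnion, not_exists, Set.mem_ofPred_eq, f]
    intro H
    rw [one_smul, add_sub_cancel]
    exact y.cform_ne_zero H
  obtain ⟨γ, hγ⟩ := hpc.joinedIn 0 h0 1 h1
  have hf : Continuous f := by fun_prop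
  refine ⟨⟨⟨fun r => ⟨f (γ r), fun H hH => hγ r ?_⟩, (hf.comp γ.continuous).subtype_mk _⟩, ?_, ?_⟩⟩
  · exact Set.mem_iUnion.2 ⟨H, (H.mem_complex_iff _).1 hH⟩
  · exact Subtype.ext (by simp [f])
  · exact Subtype.ext (by simp [f])

end Regular

/-! ### The discriminant and the length function of the braid group -/

section Length

variable {K : Type*} [Field K] {V : Type*} [AddCommGroup V] [Module K V]
  {W : Subgroup (V ≃ₗ[K] V)}

/-- The exponent of the linear form of `H` in the discriminant weighted by `ν`. -/
def weight (ν : HOrbit W → ℤ) (H : Hyperplane W) : ℤ :=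
  Nat.card (pointwiseStabilizer W H) * ν (Quotient.mk (hyperplaneSetoid W) H)

lemma weight_smul (ν : HOrbit W → ℤ) (w : W) (H : Hyperplane W) :
    weight ν (w • H) = weight ν H := by
  rw [weight, card_pointwiseStabilizer_smul, Hyperplane.mk_smul, weight]

lemma smul_eq_self_of_mem_pointwiseStabilizer {H : Hyperplane W} {s : W}
    (hs : s.1 ∈ pointwiseStabilizer W H) : s • H = H := by
  have hfix (v : V) (hv : v ∈ H.1) : s.1 v = v := (mem_fixingSubgroup_iff _).1 hs.2 v hv
  apply Subtype.ext
  rw [Hyperplane.coe_smul]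
  refine le_antisymm ?_ fun v hv => ⟨v, hv, hfix v hv⟩
  rintro _ ⟨v, hv, rfl⟩
  change s.1 v ∈ H.1
  rwa [hfix v hv]

variable [Algebra K ℂ]

lemma act_eq_self_of_mem_pointwiseStabilizer {H : Hyperplane W} {s : V ≃ₗ[K] V}
    (hs : s ∈ pointwiseStabilizer W H) {p : Complexification K V}
    (hp : p ∈ complexHyperplane H.1) : act s p = p := by
  have hle : complexHyperplane H.1 ≤ LinearMap.ker (act s - LinearMap.id) := by
    refine (Submodule.baseChange_eq_span ℂ _).le.trans (Submodule.span_le.2 ?_)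
    rintro _ ⟨v, hv, rfl⟩
    have hv' : act s (ctmul 1 v) - ctmul 1 v = 0 := by
      rw [act_ctmul, sub_eq_zero]
      exact congrArg (ctmul (K := K) 1) ((mem_fixingSubgroup_iff _).1 hs.2 v hv)
    exact hv'
  exact sub_eq_zero.1 (hle hp)

variable [Finite W]

instance : Fintype (Hyperplane W) := Fintype.ofFinite _

instance (H : Hyperplane W) : Finite (pointwiseStabilizer W H) :=
  Finite.of_injective (fun g => (⟨g.1, g.2.1⟩ : W)) fun _ _ h =>
    Subtype.ext (congrArg (fun w : W => w.1) h)

/-- The discriminant weighted by `ν`. -/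
def discr (ν : HOrbit W → ℤ) (x : VReg W) : ℂ := ∏ H, H.cform x.1 ^ weight ν H

lemma discr_ne_zero (ν : HOrbit W → ℤ) (x : VReg W) : discr ν x ≠ 0 :=
  Finset.prod_ne_zero_iff.2 fun H _ => zpow_ne_zero _ (x.cform_ne_zero H)

lemma continuous_discr (ν : HOrbit W → ℤ) : Continuous (discr ν : VReg W → ℂ) := by
  refine continuous_finsetProd _ fun H _ => Continuous.zpow₀ ?_ _ fun x => .inl (x.cform_ne_zero H)
  exact (continuous_linearMap H.cform).comp continuous_subtype_val

/-- The group permutes the linear forms up to the scalars `formFactor`. For a reflection their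
weighted product is `1`, which is where divisibility of the weights by `e_H` enters; reflections
generate. -/
lemma discr_smul [Infinite K] (hW : IsGeneratedByReflections W) (ν : HOrbit W → ℤ) (w : W)
    (x : VReg W) : discr ν (w • x) = discr ν x := by
  have hrefl (s : W) (hs : IsPseudoReflection s.1) (x : VReg W) :
      discr ν (s • x) = discr ν x := by
    have hre : discr ν (s • x) = ∏ H : Hyperplane W, (s • H).cform (s • x).1 ^ weight ν (s • H) :=
      (Equiv.prod_comp (MulAction.toPerm s)
        fun H : Hyperplane W => H.cform (s • x).1 ^ weight ν H).symm
    rw [hre]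
    simp only [VReg.coe_smul, cform_smul_act, weight_smul, mul_zpow, Finset.prod_mul_distrib]
    have h1 := prod_formFactor_zpow_eq_one (weight ν) (weight_smul ν) (fun H => ⟨_, rfl⟩) s hs
    have h2 := congrArg (algebraMap K ℂ) h1
    simp only [map_prod, map_zpow₀, map_one] at h2
    rw [h2, one_mul]
    rfl
  obtain ⟨w, hw⟩ := w
  have hcl : w ∈ Subgroup.closure {w | w ∈ W ∧ IsPseudoReflection w} := hW.symm ▸ hw
  induction hcl using Subgroup.closure_induction generalizing x with
  | mem s hs => exact hrefl ⟨s, hw⟩ hs.2 x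
  | one => exact congrArg _ (one_smul W x)
  | mul g g' hg hg' ih ih' =>
    have hgW : g ∈ W := hW ▸ hg
    have hgW' : g' ∈ W := hW ▸ hg'
    have : (⟨g * g', hw⟩ : W) • x = (⟨g, hgW⟩ : W) • (⟨g', hgW'⟩ : W) • x :=
      mul_smul (⟨g, hgW⟩ : W) ⟨g', hgW'⟩ x
    rw [this, ih, ih']
  | inv g hg ih =>
    have hgW : g ∈ W := hW ▸ hg
    have := ih ((⟨g, hgW⟩ : W)⁻¹ • x) hgW
    rw [smul_inv_smul] at this
    exact this.symm

variable [Infinite K]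

/-- The discriminant as a function on `V^reg / W`. -/
def discrMap (hW : IsGeneratedByReflections W) (ν : HOrbit W → ℤ) :
    C(VRegQuot W, {z : ℂ // z ≠ 0}) where
  toFun := Quotient.lift (fun x => ⟨discr ν x, discr_ne_zero ν x⟩) fun x y h => by
    obtain ⟨w, hw, h⟩ := h
    have : (⟨w, hw⟩ : W) • x = y := Subtype.ext h
    exact Subtype.ext (by simp only [← this, discr_smul hW])
  continuous_toFun := ((continuous_discr ν).subtype_mk _).quotient_lift _

/-- The homomorphism `B → ℤ` with value `ν C` at the monodromy generators around the hyperplanes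
in the orbit `C`. -/
def braidLength (hW : IsGeneratedByReflections W) (ν : HOrbit W → ℤ) (x₀ : VReg W) :
    Braid x₀ →* Multiplicative ℤ := windingHom (discrMap hW ν) (proj x₀)

lemma braidLength_ofLoop (hW : IsGeneratedByReflections W) (ν : HOrbit W → ℤ) {x₀ : VReg W}
    (γ : Path (proj x₀) (proj x₀)) :
    braidLength hW ν x₀ (Braid.ofLoop γ) = Multiplicative.ofAdd (winding (discrMap hW ν) γ) := rfl

/-- The contributions of the approach path and of its reverse cancel, so only the arc of angle `2π /
e_H` counts. There the form of `H` turns by that angle and carries the exponent `e_H ν C`, giving `ν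
C` full turns. The other forms contribute nothing in total, because the reflection permutes their
contributions at the two ends of the arc. -/
lemma braidLength_monodromyGenerator (hW : IsGeneratedByReflections W) (ν : HOrbit W → ℤ)
    {x₀ : VReg W} {H : Hyperplane W} {b : Braid x₀} (hb : IsMonodromyGenerator H b) :
    braidLength hW ν x₀ b =
      Multiplicative.ofAdd (ν (Quotient.mk (hyperplaneSetoid W) H)) := by
  classical
  obtain ⟨s, p, l, x₁, x₂, γ, δ, h, hs, hp, hsl, hdisc, hδ, rfl⟩ := hb
  set e : ℕ := Nat.card (pointwiseStabilizer W H) with he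
  have he0 : (e : ℂ) ≠ 0 := Nat.cast_ne_zero.2 Nat.card_pos.ne'
  set ζ : ℂ := Complex.exp (2 * Real.pi * Complex.I / e) with hζ
  rw [braidLength_ofLoop, Multiplicative.ofAdd.injective.eq_iff, winding_eq_iff,
    logChange_trans, logChange_trans, logChange_symm, add_neg_cancel_comm]
  have hpH : H.cform p = 0 := (H.mem_complex_iff p).1 hp
  have hpH' (H' : Hyperplane W) (hne : H' ≠ H) : H'.cform p ≠ 0 := fun h0 => by
    refine hne (hdisc 0 H' (by simp) ?_)
    rwa [zero_smul, add_zero, H'.mem_complex_iff]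
  have hlH : H.cform l ≠ 0 := fun h0 => by
    have h1 := x₁.cform_ne_zero H
    rw [← δ.source, hδ, map_add, map_smul, h0, hpH] at h1
    simp at h1
  let c : Hyperplane W → ℂ := fun H' => H'.cform l / H'.cform p
  have hc (H' : Hyperplane W) (hne : H' ≠ H) : ‖c H'‖ < 1 := by
    by_contra! hle
    have hc0 : c H' ≠ 0 := by
      rintro h0
      rw [h0, norm_zero] at hle
      linarith
    -- The form of `H'` vanishes at `p - (c H')⁻¹ • l`, which would lie in the closed disc around
    -- `p` if `‖c H'‖ ≥ 1`.
    refine hne (hdisc (-(c H')⁻¹) H' ?_ ?_)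
    · rw [norm_neg, norm_inv]
      exact inv_le_one_of_one_le₀ hle
    · have hl0 : H'.cform l ≠ 0 := fun h0 => hc0 (by simp only [c, h0, zero_div])
      rw [H'.mem_complex_iff, map_add, map_smul, smul_eq_mul]
      simp only [c]
      field_simp [hpH' H' hne, hl0]
      ring
  let z : unitInterval → ℂ := fun r => Complex.exp (2 * Real.pi * Complex.I * ((r : ℝ) : ℂ) / e)
  have hz1 (r : unitInterval) : ‖z r‖ = 1 := by
    have : 2 * Real.pi * Complex.I * ((r : ℝ) : ℂ) / e =
      ((2 * Real.pi * (r : ℝ) / e : ℝ) : ℂ) * Complex.I := by push_cast; ring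
    simp only [z, this, Complex.norm_exp_ofReal_mul_I]
  have hslit (H' : Hyperplane W) (hne : H' ≠ H) (r : unitInterval) :
      1 + z r * c H' ∈ Complex.slitPlane :=
    Complex.mem_slitPlane_of_norm_lt_one (by rw [norm_mul, hz1, one_mul]; exact hc H' hne)
  let C₀ : ℂ := H.cform l ^ weight ν H * ∏ H' ∈ Finset.univ.erase H, H'.cform p ^ weight ν H'
  have hC₀ : C₀ ≠ 0 := mul_ne_zero (zpow_ne_zero _ hlH)
    (Finset.prod_ne_zero_iff.2 fun H' hH' => zpow_ne_zero _ (hpH' H' (Finset.mem_erase.1 hH').1))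
  -- An explicit logarithm of the discriminant along the arc. The form of `H'` equals `H'.cform p *
  -- (1 + z r * c H')`, and since `‖c H'‖ < 1` the principal branch is continuous on the second
  -- factor.
  let Γ : unitInterval → ℂ := fun r => Complex.log C₀ +
    weight ν H * (2 * Real.pi * Complex.I * ((r : ℝ) : ℂ) / e) +
    ∑ H' ∈ Finset.univ.erase H, weight ν H' * Complex.log (1 + z r * c H')
  have hΓ : Continuous Γ := by
    refine .add (by fun_prop) (continuous_finsetSum _ fun H' hH' => ?_)
    exact continuous_const.mul (Continuous.clog (by fun_prop)
      fun r => hslit H' (Finset.mem_erase.1 hH').1 r)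
  have hexp (r : unitInterval) : Complex.exp (Γ r) = discr ν (δ r) := by
    simp only [Γ, Complex.exp_add, Complex.exp_sum, Complex.exp_log hC₀, Complex.exp_int_mul]
    rw [discr, ← Finset.mul_prod_erase _ _ (Finset.mem_univ H), hδ, map_add, hpH, zero_add,
      map_smul, smul_eq_mul, mul_zpow]
    simp only [C₀]
    have : ∀ H' ∈ Finset.univ.erase H, H'.cform (p + z r • l) ^ weight ν H' =
        H'.cform p ^ weight ν H' * Complex.exp (Complex.log (1 + z r * c H')) ^ weight ν H' := by
      intro H' hH'
      have hne := (Finset.mem_erase.1 hH').1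
      rw [Complex.exp_log (Complex.slitPlane_ne_zero (hslit H' hne r)), ← mul_zpow, map_add,
        map_smul, smul_eq_mul]
      congr 1
      simp only [c]
      field_simp [hpH' H' hne]
    rw [Finset.prod_congr rfl this, Finset.prod_mul_distrib]
    ring
  -- As `s` fixes `p` and multiplies `l` by `ζ`, one has `ζ * c (s • H') = c H'`; the two sums agree
  -- after reindexing by `s`.
  have hperm : ∑ H' ∈ Finset.univ.erase H, (weight ν H' : ℂ) * Complex.log (1 + ζ * c H') =
      ∑ H' ∈ Finset.univ.erase H, (weight ν H' : ℂ) * Complex.log (1 + c H') := by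
    let σ : W := ⟨s, hs.1⟩
    have hσ : σ • H = H := smul_eq_self_of_mem_pointwiseStabilizer hs
    refine (Finset.sum_equiv (MulAction.toPerm σ) (fun H' => ?_) fun H' _ => ?_).symm
    · simp only [Finset.mem_erase, Finset.mem_univ, and_true, ne_eq, MulAction.toPerm_apply]
      rw [← smul_left_cancel_iff σ (x := H') (y := H), hσ]
    · rw [MulAction.toPerm_apply, weight_smul]
      have h1 := cform_smul_act σ H' l
      have h2 := cform_smul_act σ H' p
      rw [act_eq_self_of_mem_pointwiseStabilizer hs hp] at h2
      rw [hsl, map_smul, smul_eq_mul] at h1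
      simp only [c]
      rw [← mul_div_assoc, h1, h2,
        mul_div_mul_left _ _ ((map_ne_zero _).2 (formFactor_ne_zero σ H'))]
  rw [logChange_eq (discrMap hW ν) ((δ.map continuous_proj).cast rfl h) Γ hΓ hexp]
  simp only [Γ, z]
  have hw : (weight ν H : ℂ) = e * ν (Quotient.mk (hyperplaneSetoid W) H) := by
    rw [weight]; push_cast; rfl
  simp only [Set.Icc.coe_one, Set.Icc.coe_zero, Complex.ofReal_one, Complex.ofReal_zero,
    mul_one, mul_zero, zero_div, Complex.exp_zero, one_mul, ← hζ, hperm, hw]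
  field_simp
  ring

end Length

/-! ### The homomorphism from the braid group to the reflection group -/

section MapsTo

variable {K : Type*} [Field K] {V : Type*} [AddCommGroup V] [Module K V]
  {W : Subgroup (V ≃ₗ[K] V)} [Algebra K ℂ] {x₀ : VReg W}

lemma Braid.ofLoop_mul (γ γ' : Path (proj x₀) (proj x₀)) :
    Braid.ofLoop γ * Braid.ofLoop γ' = Braid.ofLoop (γ.trans γ') := rfl

lemma Braid.ofLoop_congr {γ γ' : Path (proj x₀) (proj x₀)} (h : γ.Homotopic γ') :
    Braid.ofLoop γ = Braid.ofLoop γ' :=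
  congrArg MulOpposite.op (Path.Homotopic.Quotient.eq.2 h)

lemma Braid.mapsTo_iff (b : Braid x₀) (w : W) : b.MapsTo w ↔ ∃ γ : Path x₀ (w • x₀),
    b = Braid.ofLoop ((γ.map continuous_proj).cast rfl (proj_smul w x₀).symm) := by
  constructor
  · rintro ⟨x₁, h, γ, hx₁, hb⟩
    obtain rfl : x₁ = w • x₀ := Subtype.ext hx₁
    exact ⟨γ, hb⟩
  · rintro ⟨γ, hb⟩
    exact ⟨w • x₀, (proj_smul w x₀).symm, γ, rfl, hb⟩

lemma Braid.mapsTo_one : (1 : Braid x₀).MapsTo (1 : W) :=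
  (Braid.mapsTo_iff _ _).2 ⟨(Path.refl x₀).cast rfl (one_smul W x₀), rfl⟩

lemma Braid.MapsTo.mul {b b' : Braid x₀} {w w' : W} (h : b.MapsTo w) (h' : b'.MapsTo w') :
    (b * b').MapsTo (w * w') := by
  obtain ⟨γ, rfl⟩ := (Braid.mapsTo_iff _ _).1 h
  obtain ⟨γ', rfl⟩ := (Braid.mapsTo_iff _ _).1 h'
  refine (Braid.mapsTo_iff _ _).2
    ⟨(γ.trans (γ'.map (continuous_const_smul w))).cast rfl (mul_smul w w' x₀), ?_⟩
  rw [Braid.ofLoop_mul]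
  congr 1
  ext r
  simp only [Path.trans_apply, Path.cast_coe, Path.map_coe, Function.comp_apply]
  split_ifs
  · rfl
  · exact (proj_smul w _).symm

/-- Follow a path `γ` from `x₀` to the fixed point `x`, then the reverse of its `w`-translate: this
ends at `w • x₀` and projects to a path followed by its own reverse, which is null-homotopic. -/
lemma Braid.one_mapsTo_of_smul_eq [Finite W] {w : W} {x : VReg W} (h : w • x = x) :
    (1 : Braid x₀).MapsTo w := by
  obtain ⟨γ⟩ := joined_VReg x₀ x
  refine (Braid.mapsTo_iff _ _).2
    ⟨γ.trans ((γ.map (continuous_const_smul w)).symm.cast h.symm rfl), ?_⟩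
  have : ((γ.trans ((γ.map (continuous_const_smul w)).symm.cast h.symm rfl)).map
      continuous_proj).cast rfl (proj_smul w x₀).symm =
      (γ.map continuous_proj).trans (γ.map continuous_proj).symm := by
    ext r
    simp only [Path.trans_apply, Path.cast_coe, Path.map_coe, Function.comp_apply]
    split_ifs
    · rfl
    · exact proj_smul w _
  rw [this]
  refine Eq.trans ?_ (Braid.ofLoop_congr ⟨Path.Homotopy.reflTransSymm (γ.map continuous_proj)⟩)
  rfl

lemma Braid.exists_mapsTo_of_mem [Finite W] (w : W) : ∃ b : Braid x₀, b.MapsTo w := by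
  obtain ⟨γ⟩ := joined_VReg x₀ (w • x₀)
  exact ⟨_, (Braid.mapsTo_iff _ _).2 ⟨γ, rfl⟩⟩

/-- A finite group acting freely by homeomorphisms on a Hausdorff space acts properly
discontinuously: intersect the neighbourhoods separating `x` from each of its translates. -/
lemma isQuotientCoveringMap_proj [Finite W] (hfree : ∀ (w : W) (x : VReg W), w • x = x → w = 1) :
    IsQuotientCoveringMap (proj (W := W)) W where
  __ := (isQuotientMap_quotient_mk' : Topology.IsQuotientMap (Quotient.mk (regSetoid W)))
  continuous_const_smul := continuous_const_smul
  apply_eq_iff_mem_orbit := by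
    intro x y
    rw [eq_comm, proj_eq_iff]
    rfl
  disjoint x := by
    have hsep (w : W) : ∃ U ∈ nhds x, w ≠ 1 → ∀ y ∈ U, w • y ∉ U := by
      by_cases hw : w = 1
      · exact ⟨Set.univ, Filter.univ_mem, fun h => absurd hw h⟩
      · obtain ⟨U, V, hU, hV, hxU, hxV, hd⟩ := t2_separation fun h => hw (hfree w x h)
        refine ⟨V ∩ (w • ·) ⁻¹' U, Filter.inter_mem (hV.mem_nhds hxV)
          ((hU.preimage (continuous_const_smul w)).mem_nhds hxU), fun _ y hy hy' => ?_⟩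
        exact Set.disjoint_left.1 hd hy.2 hy'.1
    choose U hU hU' using hsep
    refine ⟨⋂ w, U w, Filter.iInter_mem.2 hU, ?_⟩
    rintro w ⟨_, ⟨y, hy, rfl⟩, hy'⟩
    by_contra hw
    exact hU' w hw y (Set.mem_iInter.1 hy w) (Set.mem_iInter.1 hy' w)

lemma Braid.exists_mapsTo [Finite W] (hfree : ∀ (w : W) (x : VReg W), w • x = x → w = 1)
    (b : Braid x₀) : ∃ w : W, b.MapsTo w := by
  obtain ⟨⟨γ⟩⟩ := b
  have cov := (isQuotientCoveringMap_proj hfree).isCoveringMap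
  obtain ⟨Γ, hΓ, h0⟩ := cov.exists_path_lifts γ.toContinuousMap x₀ γ.source
  have h1 : proj (Γ 1) = proj x₀ := (congrFun hΓ 1).trans γ.target
  obtain ⟨w, hw⟩ := proj_eq_iff.1 h1.symm
  refine ⟨w, (Braid.mapsTo_iff _ _).2 ⟨⟨Γ, h0, hw.symm⟩, ?_⟩⟩
  change Braid.ofLoop γ = _
  congr 1
  ext r
  exact (congrFun hΓ r).symm

variable [NumberField K] {ζ : HOrbit W → (𝓞 K)ˣ}
  {t : GenericHecke x₀ →ₗ[MvLaurent (ParamIndex W)] MvLaurent (ParamIndex W)}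

/-- Otherwise the specialization of `t 1` would be both `1` and `0`. With
`Braid.one_mapsTo_of_smul_eq` this gives the freeness of the action on `V^reg` (Steinberg's theorem)
from the existence of the form. -/
lemma IsCanonicalForm.eq_one_of_one_mapsTo (ht : IsCanonicalForm ζ t) {w : W}
    (h : (1 : Braid x₀).MapsTo w) : w = 1 := by
  by_contra hw
  have h1 := (ht.specialization 1 1 Braid.mapsTo_one).1 rfl
  rw [(ht.specialization 1 w h).2 hw] at h1
  exact zero_ne_one h1

lemma IsCanonicalForm.exists_mapsTo [Finite W] (ht : IsCanonicalForm ζ t) (b : Braid x₀) :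
    ∃ w : W, b.MapsTo w :=
  Braid.exists_mapsTo (fun _ _ h => ht.eq_one_of_one_mapsTo (Braid.one_mapsTo_of_smul_eq h)) b

end MapsTo

/-! ### Gradings given by homomorphisms to Laurent polynomials -/

section Grading

open AddMonoidAlgebra (single)

/-- `x` is homogeneous of degree `k` for the grading defined by `α : Q → Q[T, T⁻¹]`. -/
def IsHomog {Q : Type*} [Ring Q] (α : Q →+* Q[T;T⁻¹]) (k : ℤ) (x : Q) : Prop :=
  α x = single k x

/-! ### Homogeneous elements and homogeneous components -/

section Ring

variable {Q : Type*} [Ring Q] {α : Q →+* Q[T;T⁻¹]}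

lemma IsHomog.zero (k : ℤ) : IsHomog α k 0 := by simp [IsHomog]

lemma IsHomog.add {k : ℤ} {x y : Q} (hx : IsHomog α k x) (hy : IsHomog α k y) :
    IsHomog α k (x + y) := by
  rw [IsHomog, map_add, hx, hy, AddMonoidAlgebra.single_add]

lemma IsHomog.one : IsHomog α 0 1 := by rw [IsHomog, map_one]; rfl

lemma IsHomog.mul {k k' : ℤ} {x y : Q} (hx : IsHomog α k x) (hy : IsHomog α k' y) :
    IsHomog α (k + k') (x * y) := by
  rw [IsHomog, map_mul, hx, hy, AddMonoidAlgebra.single_mul_single]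

lemma homog_induction (hα : AddSubgroup.closure {x | ∃ k, IsHomog α k x} = ⊤)
    {p : Q → Prop} (x : Q) (zero : p 0) (homog : ∀ k x, IsHomog α k x → p x)
    (add : ∀ x y, p x → p y → p (x + y)) : p x := by
  have hx : x ∈ AddSubgroup.closure {x | ∃ k, IsHomog α k x} := hα ▸ AddSubgroup.mem_top x
  induction hx using AddSubgroup.closure_induction'' with
  | mem x hx => exact homog _ x hx.choose_spec
  | neg_mem x hx =>
    refine homog hx.choose (-x) ?_
    rw [IsHomog, map_neg, hx.choose_spec, AddMonoidAlgebra.single_neg]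
  | zero => exact zero
  | add x y _ _ hx hy => exact add x y hx hy

/-- The coefficients of `α x` are the homogeneous components of `x`. Only a ring homomorphism `α` is
given; coassociativity comes from generation by homogeneous elements. -/
lemma isHomog_coeff (hα : AddSubgroup.closure {x | ∃ k, IsHomog α k x} = ⊤) (x : Q) (c : ℤ) :
    IsHomog α c ((α x).coeff c) := by
  induction x using homog_induction hα with
  | zero => simpa using IsHomog.zero c
  | homog k x hx =>
    rw [hx, AddMonoidAlgebra.coeff_single, Finsupp.single_apply]
    split_ifs with h
    · exact h ▸ hx
    · exact IsHomog.zero c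
  | add x y hx hy =>
    rw [map_add, AddMonoidAlgebra.coeff_add, Finsupp.add_apply]
    exact hx.add hy

/-- It is enough to commute with homogeneous elements, and for those one compares coefficients in
the image under `α` of the commutation relation. -/
lemma coeff_mul_comm_of_mem_center (hα : AddSubgroup.closure {x | ∃ k, IsHomog α k x} = ⊤)
    {x : Q} (hx : x ∈ Subring.center Q) (c : ℤ) : (α x).coeff c ∈ Subring.center Q := by
  rw [Subring.mem_center_iff] at hx ⊢
  intro y
  induction y using homog_induction hα with
  | zero => simp
  | homog k y hy =>
    have h1 := congrArg α (hx y)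
    rw [map_mul, map_mul, hy] at h1
    have h2 := congrArg (fun p => p.coeff (c + k)) h1
    rwa [AddMonoidAlgebra.coeff_single_mul_eq_mul_coeff c (by intros; omega),
      AddMonoidAlgebra.coeff_mul_single_eq_coeff_mul c (by intros; omega)] at h2
  | add y y' h h' => rw [add_mul, mul_add, h, h']

end Ring

/-- A factor of a nonzero monomial over a domain is a monomial. -/
lemma coeff_eq_zero_of_mul_eq_single {D : Type*} [CommRing D] [IsDomain D] {p q : D[T;T⁻¹]}
    {k : ℤ} {x : D} (hx : x ≠ 0) (h : p * q = single k x) {i j : ℤ} (hij : i ≠ j) :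
    p.coeff i * p.coeff j = 0 := by
  by_contra hne
  have hi : i ∈ p.coeff.support := Finsupp.mem_support_iff.2 (left_ne_zero_of_mul hne)
  have hj : j ∈ p.coeff.support := Finsupp.mem_support_iff.2 (right_ne_zero_of_mul hne)
  have hq : q ≠ 0 := by
    rintro rfl
    rw [mul_zero, eq_comm, AddMonoidAlgebra.single_eq_zero] at h
    exact hx h
  have hqs : 0 < q.coeff.support.card := by
    rw [Finset.card_pos, Finsupp.support_nonempty_iff]
    exact fun h0 => hq (AddMonoidAlgebra.coeff_eq_zero.1 h0)
  have hps : 1 < p.coeff.support.card := Finset.one_lt_card.2 ⟨i, hi, j, hj, hij⟩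
  -- If `p` had two terms, two different pairs of exponents would each have a sum attained only
  -- once. Both sums carry nonzero coefficients of the product, so both equal `k`, which contradicts
  -- uniqueness.
  obtain ⟨a, ha, b, hb, hab, hua, hub⟩ := TwoUniqueSums.uniqueAdd_of_one_lt_card
    (A := p.coeff.support) (B := q.coeff.support) (by nlinarith)
  rw [Finset.mem_product] at ha hb
  have key (a : ℤ × ℤ) (ha : a.1 ∈ p.coeff.support ∧ a.2 ∈ q.coeff.support)
      (hu : UniqueAdd p.coeff.support q.coeff.support a.1 a.2) : a.1 + a.2 = k := by
    by_contra hk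
    have h1 := AddMonoidAlgebra.coeff_mul_add_of_uniqueAdd hu
    rw [h, AddMonoidAlgebra.coeff_single, Finsupp.single_apply, if_neg (Ne.symm hk)] at h1
    exact mul_ne_zero (Finsupp.mem_support_iff.1 ha.1) (Finsupp.mem_support_iff.1 ha.2) h1.symm
  have := hub ha.1 ha.2 ((key a ha hua).trans (key b hb hub).symm)
  exact hab (Prod.ext this.1 this.2)

lemma exists_coeff_eq_of_mem_center {Q : Type*} [Ring Q] (p : Q[T;T⁻¹])
    (hp : ∀ i, p.coeff i ∈ Subring.center Q) :
    ∃ p' : (Subring.center Q)[T;T⁻¹],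
      AddMonoidAlgebra.mapRingHom ℤ (Subring.center Q).subtype p' = p := by
  classical
  refine ⟨AddMonoidAlgebra.ofCoeff (Finsupp.onFinset p.coeff.support (fun i => ⟨p.coeff i, hp i⟩)
    fun i hi => Finsupp.mem_support_iff.2 fun h => hi (Subtype.ext h)), ?_⟩
  ext i
  rw [AddMonoidAlgebra.coeff_mapRingHom]
  rfl

/-- The coefficients of a factor of a family of monomials generating the unit ideal in a reduced
commutative ring are orthogonal. -/
lemma mul_eq_zero_of_mul_eq_single {Z : Type*} [CommRing Z] [IsReduced Z] (z : Z[T;T⁻¹])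
    (w : ℤ → Z[T;T⁻¹]) (hsum : (z.coeff.sum fun _ x => x) = 1)
    (h : ∀ j, z * w j = single j (z.coeff j)) {i j : ℤ} (hij : i ≠ j) :
    z.coeff i * z.coeff j = 0 := by
  suffices hn : z.coeff i * z.coeff j ∈ nilradical Z by
    rwa [nilradical_eq_zero, Ideal.zero_eq_bot, Ideal.mem_bot] at hn
  rw [nilradical_eq_sInf, Submodule.mem_sInf]
  intro (P : Ideal Z) (hP : P.IsPrime)
  rw [← Ideal.Quotient.eq_zero_iff_mem, map_mul]
  -- Modulo a prime some coefficient survives because they sum to `1`; the identity with that index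
  -- makes `z` a factor of a nonzero monomial over a domain, hence a monomial.
  obtain ⟨l, hl⟩ : ∃ l, Ideal.Quotient.mk P (z.coeff l) ≠ 0 := by
    by_contra! hc
    have h1 := congrArg (Ideal.Quotient.mk P) hsum
    rw [Finsupp.sum, map_sum, map_one, Finset.sum_eq_zero fun l _ => hc l] at h1
    exact zero_ne_one h1
  have h1 := congrArg (AddMonoidAlgebra.mapRingHom ℤ (Ideal.Quotient.mk P)) (h l)
  rw [map_mul, AddMonoidAlgebra.mapRingHom_single] at h1
  simpa only [AddMonoidAlgebra.coeff_mapRingHom] using coeff_eq_zero_of_mul_eq_single hl h1 hij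

/-! ### Homogeneous components of a linear form -/

section Form

variable {A H : Type*} [CommRing A] [Ring H] [Algebra A H]
  {αA : A →+* A[T;T⁻¹]} {αH : H →+* H[T;T⁻¹]}

/-- The gradings defined by `αA` and `αH` make `H` a graded `A`-algebra. -/
structure IsGradedBy (αA : A →+* A[T;T⁻¹]) (αH : H →+* H[T;T⁻¹]) : Prop where
  closure_left : AddSubgroup.closure {a | ∃ k, IsHomog αA k a} = ⊤
  closure_right : AddSubgroup.closure {h | ∃ k, IsHomog αH k h} = ⊤
  smul {k d : ℤ} {a : A} {h : H} : IsHomog αA k a → IsHomog αH d h → IsHomog αH (k + d) (a • h)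

variable (αA αH) in
/-- The generating function of the homogeneous components of a linear form. -/
def formSeries (t : H →ₗ[A] A) : H →+ A[T;T⁻¹] :=
  (Finsupp.liftAddHom fun c : ℤ => (AddMonoidHom.mulRight (single (-c) (1 : A))).comp
    (αA.toAddMonoidHom.comp t.toAddMonoidHom)).comp
    ((AddMonoidAlgebra.coeffAddEquiv (R := H) (M := ℤ)).toAddMonoidHom.comp αH.toAddMonoidHom)

/-- The coefficient at `d` is the component of degree `c + d` of `t x`: the `d`-th component of `t`
raises degrees by `d`. Subtracting the degree of the argument is what makes these components
`A`-linear. -/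
lemma formSeries_of_isHomog (t : H →ₗ[A] A) {c : ℤ} {x : H} (hx : IsHomog αH c x) :
    formSeries αA αH t x = αA (t x) * single (-c) 1 := by
  have : formSeries αA αH t x = (αH x).coeff.sum fun c y => αA (t y) * single (-c) 1 := rfl
  rw [this, hx, AddMonoidAlgebra.coeff_single, Finsupp.sum_single_index (by simp)]

lemma formSeries_smul (g : IsGradedBy αA αH) (t : H →ₗ[A] A) (a : A) (x : H) :
    formSeries αA αH t (a • x) = a • formSeries αA αH t x := by
  induction x using homog_induction g.closure_right with
  | zero => simp
  | homog c x hx =>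
    induction a using homog_induction g.closure_left with
    | zero => simp
    | homog k a ha =>
      rw [formSeries_of_isHomog t (g.smul ha hx), formSeries_of_isHomog t hx, map_smul,
        smul_eq_mul, map_mul, ha, mul_right_comm, AddMonoidAlgebra.single_mul_single, mul_one,
        LaurentPolynomial.smul_eq_C_mul, ← LaurentPolynomial.single_eq_C, mul_comm (αA (t x)),
        ← mul_assoc, AddMonoidAlgebra.single_mul_single, mul_one, neg_add, zero_add,
        add_neg_cancel_left]
    | add a a' h h' => rw [add_smul, map_add, h, h', add_smul]
  | add x y hx hy => rw [smul_add, map_add, hx, hy, map_add, smul_add]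

lemma formSeries_mul_comm (g : IsGradedBy αA αH) {t : H →ₗ[A] A}
    (symm : ∀ h h', t (h * h') = t (h' * h)) (x y : H) :
    formSeries αA αH t (x * y) = formSeries αA αH t (y * x) := by
  induction x using homog_induction g.closure_right with
  | zero => simp
  | homog c x hx =>
    induction y using homog_induction g.closure_right with
    | zero => simp
    | homog d y hy =>
      rw [formSeries_of_isHomog t (hx.mul hy), formSeries_of_isHomog t (hy.mul hx), symm,
        add_comm c]
    | add y y' h h' => rw [mul_add, map_add, h, h', add_mul, map_add]
  | add x x' h h' => rw [add_mul, map_add, h, h', mul_add, map_add]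

lemma sum_coeff_formSeries (g : IsGradedBy αA αH) (t : H →ₗ[A] A) (x : H) :
    ((formSeries αA αH t x).coeff.sum fun _ a => a) = t x := by
  have hA (a : A) (c : ℤ) : ((αA a * single (-c) 1).coeff.sum fun _ a => a) = a := by
    induction a using homog_induction g.closure_left with
    | zero => simp
    | homog k a ha =>
      rw [ha, AddMonoidAlgebra.single_mul_single, mul_one, AddMonoidAlgebra.coeff_single,
        Finsupp.sum_single_index rfl]
    | add a b h h' =>
      rw [map_add, add_mul, AddMonoidAlgebra.coeff_add,
        Finsupp.sum_add_index' (fun _ => rfl) (fun _ _ _ => rfl), h, h']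
  induction x using homog_induction g.closure_right with
  | zero => simp
  | homog c x hx => rw [formSeries_of_isHomog t hx, hA]
  | add x y hx hy =>
    rw [map_add, AddMonoidAlgebra.coeff_add,
      Finsupp.sum_add_index' (fun _ => rfl) (fun _ _ _ => rfl), hx, hy, map_add]

/-- The homogeneous component of degree `d` of a linear form. -/
def formComponent (g : IsGradedBy αA αH) (t : H →ₗ[A] A) (d : ℤ) : H →ₗ[A] A where
  toFun x := (formSeries αA αH t x).coeff d
  map_add' x y := by rw [map_add]; rfl
  map_smul' a x := by rw [formSeries_smul g]; rfl

/-- The coefficientwise extension of a linear form. -/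
def coeffForm (t : H →ₗ[A] A) : H[T;T⁻¹] →+ A[T;T⁻¹] :=
  (AddMonoidAlgebra.coeffAddEquiv (R := A) (M := ℤ)).symm.toAddMonoidHom.comp
    ((Finsupp.mapRange.addMonoidHom t.toAddMonoidHom).comp
      (AddMonoidAlgebra.coeffAddEquiv (R := H) (M := ℤ)).toAddMonoidHom)

lemma coeff_coeffForm (t : H →ₗ[A] A) (p : H[T;T⁻¹]) (d : ℤ) :
    (coeffForm t p).coeff d = t (p.coeff d) := rfl

lemma coeffForm_single (t : H →ₗ[A] A) (d : ℤ) (x : H) :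
    coeffForm t (single d x) = single d (t x) := by
  ext i
  rw [coeff_coeffForm, AddMonoidAlgebra.coeff_single, AddMonoidAlgebra.coeff_single,
    Finsupp.single_apply, Finsupp.single_apply, apply_ite t, map_zero]

lemma coeffForm_mul_single_one (t : H →ₗ[A] A) (p : H[T;T⁻¹]) (d : ℤ) :
    coeffForm t (p * single d 1) = coeffForm t p * single d 1 := by
  ext i
  rw [coeff_coeffForm,
    AddMonoidAlgebra.coeff_mul_single_eq_coeff_mul (i - d) (by intros; omega),
    AddMonoidAlgebra.coeff_mul_single_eq_coeff_mul (i - d) (by intros; omega), mul_one, mul_one,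
    coeff_coeffForm]

/-- A symmetrizing form with `t 1 = 1` on a graded algebra with reduced center is homogeneous of
degree `0`, if it does not vanish on the nonzero central idempotents. -/
theorem isHomog_of_symmetrizing [Module.Finite A H] (g : IsGradedBy αA αH) {t : H →ₗ[A] A}
    (symm : ∀ h h', t (h * h') = t (h' * h))
    (nondegenerate : Function.Bijective fun h => t ∘ₗ LinearMap.mulLeft A h) (one : t 1 = 1)
    (hred : IsReduced (Subring.center H))
    (hidem : ∀ e : H, e * e = e → t e = 0 → e = 0) {k : ℤ} {h : H} (hh : IsHomog αH k h) :
    IsHomog αA k (t h) := by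
  classical
  have hinj {x y : H} (hxy : ∀ h, t (x * h) = t (y * h)) : x = y :=
    nondegenerate.1 (LinearMap.ext hxy)
  -- Each component `t_d` is represented as `t (z d * ·)`; since `t_d` is again a trace form, `z d`
  -- is central.
  choose z hz using fun d => nondegenerate.2 (formComponent g t d)
  replace hz (d : ℤ) (x : H) : t (z d * x) = (formSeries αA αH t x).coeff d :=
    LinearMap.congr_fun (hz d) x
  have hcentral (d : ℤ) : z d ∈ Subring.center H := by
    refine Subring.mem_center_iff.2 fun x => hinj fun y => ?_
    rw [mul_assoc, mul_assoc, symm, mul_assoc, hz, hz, formSeries_mul_comm g symm]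
  obtain ⟨S, hS⟩ := Module.Finite.fg_top (R := A) (M := H)
  -- Finite generation of `H` leaves only finitely many nonzero `z d`, so that they are the
  -- coefficients of a Laurent polynomial `zL`.
  let D : Finset ℤ := S.biUnion fun x => (formSeries αA αH t x).coeff.support
  have hD (d : ℤ) (hd : d ∉ D) : z d = 0 := by
    refine hinj fun x => ?_
    rw [zero_mul, map_zero]
    have hx : x ∈ Submodule.span A (S : Set H) := hS ▸ Submodule.mem_top
    induction hx using Submodule.span_induction with
    | mem x hx =>
      rw [hz]
      by_contra hne
      exact hd (Finset.mem_biUnion.2 ⟨x, hx, Finsupp.mem_support_iff.2 hne⟩)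
    | zero => rw [mul_zero, map_zero]
    | add x y _ _ hx hy => rw [mul_add, map_add, hx, hy, add_zero]
    | smul a x _ hx => rw [mul_smul_comm, map_smul, hx, smul_zero]
  let zL : H[T;T⁻¹] := AddMonoidAlgebra.ofCoeff
    (Finsupp.onFinset D z fun d hd => by_contra fun h => hd (hD d h))
  have hzL (d : ℤ) : zL.coeff d = z d := rfl
  have hseries (x : H) : formSeries αA αH t x = coeffForm t (zL * single 0 x) := by
    ext d
    rw [coeff_coeffForm, AddMonoidAlgebra.coeff_mul_single_eq_coeff_mul d (by intros; omega),
      hzL, hz]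
  have hsum : (zL.coeff.sum fun _ x => x) = 1 := by
    refine hinj fun x => ?_
    rw [one_mul, ← sum_coeff_formSeries g t x, Finsupp.sum, Finset.sum_mul, map_sum,
      Finsupp.sum_of_support_subset (s := zL.coeff.support) _ ?_ _ (fun _ _ => rfl)]
    · exact Finset.sum_congr rfl fun d _ => by rw [hzL, hz]
    · intro d hd
      rw [Finsupp.mem_support_iff, hseries, coeff_coeffForm,
        AddMonoidAlgebra.coeff_mul_single_eq_coeff_mul d (by intros; omega)] at hd
      exact Finsupp.mem_support_iff.2 fun h0 => hd (by rw [h0, zero_mul, map_zero])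
  -- The form `t (z j * ·)` is already homogeneous of degree `j`, so its own generating series is
  -- one monomial. Computing that series by decomposing `z j` into homogeneous components gives the
  -- left-hand side.
  have hmul (j : ℤ) : zL * αH (z j) = single j (z j) := by
    have key (x : H) : coeffForm t (zL * αH (z j) * single 0 x) =
        coeffForm t (single j (z j) * single 0 x) := by
      induction x using homog_induction g.closure_right with
      | zero => simp
      | homog c x hx =>
        have hcomp (e : ℤ) (y : H) (hy : IsHomog αH e y) :
            coeffForm t (zL * single e y * single 0 x) = αA (t (y * x)) * single (-c) 1 := by
          have : zL * single e y * single 0 x = zL * single 0 (y * x) * single e 1 := by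
            rw [mul_assoc, mul_assoc, AddMonoidAlgebra.single_mul_single,
              AddMonoidAlgebra.single_mul_single, add_zero, zero_add, mul_one]
          rw [this, coeffForm_mul_single_one, ← hseries, formSeries_of_isHomog t (hy.mul hx),
            mul_assoc, AddMonoidAlgebra.single_mul_single, mul_one]
          congr 2
          ring
        have hdec : coeffForm t (zL * αH (z j) * single 0 x) =
            αA (t (z j * x)) * single (-c) 1 := by
          generalize z j = y
          induction y using homog_induction g.closure_right with
          | zero => simp
          | homog e y hy => rw [hy, hcomp e y hy]
          | add y y' h h' =>
            rw [map_add, mul_add, add_mul, map_add, h, h', add_mul, map_add, map_add, add_mul]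
        rw [hdec, AddMonoidAlgebra.single_mul_single, add_zero, coeffForm_single, hz,
          formSeries_of_isHomog t hx,
          AddMonoidAlgebra.coeff_mul_single_eq_coeff_mul (j + c) (by intros; omega), mul_one,
          isHomog_coeff g.closure_left, AddMonoidAlgebra.single_mul_single, mul_one,
          add_neg_cancel_right]
      | add x y hx hy =>
        rw [AddMonoidAlgebra.single_add, mul_add, map_add, hx, hy, mul_add, map_add]
    ext i
    refine hinj fun x => ?_
    have := congrArg (fun p => p.coeff i) (key x)
    simp only [coeff_coeffForm] at this
    rwa [AddMonoidAlgebra.coeff_mul_single_eq_coeff_mul i (by intros; omega),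
      AddMonoidAlgebra.coeff_mul_single_eq_coeff_mul i (by intros; omega)] at this
  have horth {i j : ℤ} (hij : i ≠ j) : z i * z j = 0 := by
    let ι := AddMonoidAlgebra.mapRingHom ℤ (Subring.center H).subtype
    have hι : Function.Injective ι := by
      intro p q hpq
      ext i
      have := congrArg (fun p => p.coeff i) hpq
      simp only [ι, AddMonoidAlgebra.coeff_mapRingHom] at this
      exact this
    -- The `z d` and all their homogeneous components are central, so the identities `hmul` descend
    -- to the center, a reduced commutative ring.
    obtain ⟨z', hz'⟩ := exists_coeff_eq_of_mem_center zL hcentral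
    choose w hw using fun j => exists_coeff_eq_of_mem_center (αH (z j))
      (coeff_mul_comm_of_mem_center g.closure_right (hcentral j))
    have hcoeff (i : ℤ) : ((z'.coeff i : Subring.center H) : H) = z i := by
      rw [← hzL, ← hz', AddMonoidAlgebra.coeff_mapRingHom]; rfl
    have hs : (z'.coeff.sum fun _ x => x) = 1 := by
      apply Subtype.ext
      rw [← hz'] at hsum
      rw [Finsupp.sum, AddSubmonoidClass.coe_finsetSum, Subring.coe_one, ← hsum,
        Finsupp.sum_of_support_subset (s := z'.coeff.support) _ ?_ _ (fun _ _ => rfl)]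
      · rfl
      · intro d hd
        rw [Finsupp.mem_support_iff, AddMonoidAlgebra.coeff_mapRingHom] at hd
        exact Finsupp.mem_support_iff.2 fun h0 => hd (by rw [h0, map_zero])
    have := mul_eq_zero_of_mul_eq_single z' w hs (fun j => hι (by
      rw [map_mul]
      refine (congrArg₂ (· * ·) hz' (hw j)).trans ((hmul j).trans ?_)
      rw [AddMonoidAlgebra.mapRingHom_single, ← hcoeff]; rfl)) hij
    rw [← hcoeff, ← hcoeff]
    exact congrArg Subtype.val this
  have hsum' : ∑ d ∈ zL.coeff.support, z d = 1 := hsum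
  have hsupp {j : ℤ} (hj : j ∉ zL.coeff.support) : z j = 0 := Finsupp.notMem_support_iff.1 hj
  have hidem' (j : ℤ) : z j * z j = z j := by
    conv_rhs => rw [← mul_one (z j), ← hsum', Finset.mul_sum]
    rw [Finset.sum_eq_single j (fun i _ hij => horth hij.symm)
      (fun hj => by rw [hsupp hj, mul_zero])]
  have hzero (j : ℤ) (hj : j ≠ 0) : z j = 0 := by
    -- `t (z j)` is the coefficient at `j` of the series of `1`, which is the constant `1` because
    -- `t 1 = 1`.
    refine hidem _ (hidem' j) ?_
    rw [← mul_one (z j), hz, formSeries_of_isHomog t IsHomog.one, one, map_one, one_mul,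
      AddMonoidAlgebra.coeff_single, Finsupp.single_apply, if_neg (by omega)]
  have hfin : formSeries αA αH t h = single 0 (t h) := by
    have hz0 : z 0 = 1 := by
      rw [← hsum', Finset.sum_eq_single 0 (fun i _ hi => hzero i hi) hsupp]
    ext d
    rw [← hz, AddMonoidAlgebra.coeff_single, Finsupp.single_apply]
    split_ifs with hd
    · rw [← hd, hz0, one_mul]
    · rw [hzero d (Ne.symm hd), zero_mul, map_zero]
  rw [formSeries_of_isHomog t hh] at hfin
  have := congrArg (· * single k (1 : A)) hfin
  simp only [mul_assoc, AddMonoidAlgebra.single_mul_single, mul_one, neg_add_cancel,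
    zero_add] at this
  rwa [show (single 0 1 : A[T;T⁻¹]) = 1 from rfl, mul_one] at this

end Form

end Grading

/-! ### Symmetrizing forms specializing to the canonical form of a group algebra -/

section Trace

variable {A H F : Type*} [CommRing A] [Ring H] [Algebra A H] [Field F]
  {σ : A →+* F} {t : H →ₗ[A] A}

/-- The coordinates of the dual basis `c` form an inverse of the Gram matrix. -/
lemma isUnit_det_gram {ι : Type*} [Fintype ι] [DecidableEq ι] (b : Module.Basis ι A H)
    (nondegenerate : Function.Surjective fun h => t ∘ₗ LinearMap.mulLeft A h) :
    IsUnit (Matrix.of fun i j => t (b i * b j)).det := by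
  choose c hc using fun i => nondegenerate (b.coord i)
  replace hc (i : ι) (x : H) : t (c i * x) = b.coord i x := LinearMap.congr_fun (hc i) x
  have hmul : (Matrix.of fun i j => b.repr (c i) j) * (Matrix.of fun i j => t (b i * b j)) = 1 := by
    ext i j
    rw [Matrix.mul_apply, Matrix.one_apply]
    have h1 := hc i (b j)
    conv_lhs at h1 => rw [← b.sum_repr (c i), Finset.sum_mul, map_sum]
    simp only [smul_mul_assoc, map_smul, smul_eq_mul] at h1
    simp only [Matrix.of_apply, h1, Module.Basis.coord_apply, Module.Basis.repr_self,
      Finsupp.single_apply, eq_comm]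
  rw [← Matrix.isUnit_iff_isUnit_det]
  exact IsUnit.of_mul_eq_one_right _ hmul

variable [Module.Free A H] [Module.Finite A H]

/-- A nilpotent central element is in the radical of the regular trace form. That form is
nondegenerate over the domain `A`: its Gram matrix specializes to `N` times that of `t`, whose
determinant is a unit. -/
lemma isReduced_center_of_trace [IsDomain A] [CharZero F] {N : ℕ} (hN : N ≠ 0)
    (nondegenerate : Function.Surjective fun h => t ∘ₗ LinearMap.mulLeft A h)
    (htr : ∀ h, σ (LinearMap.trace A H (LinearMap.mulLeft A h)) = N * σ (t h)) :
    IsReduced (Subring.center H) := by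
  classical
  refine ⟨fun z ⟨n, hz⟩ => Subtype.ext ?_⟩
  have hzn : (z : H) ^ n = 0 := congrArg Subtype.val hz
  have htr0 (h : H) : LinearMap.trace A H (LinearMap.mulLeft A ((z : H) * h)) = 0 := by
    refine (LinearMap.isNilpotent_trace_of_isNilpotent ⟨n, ?_⟩).eq_zero
    have hcomm : Commute (z : H) h := ((Subring.mem_center_iff.1 z.2) h).symm
    rw [LinearMap.pow_mulLeft, hcomm.mul_pow, hzn, zero_mul, LinearMap.mulLeft_zero_eq_zero]
  let b := Module.Free.chooseBasis A H
  let G : Matrix _ _ A := Matrix.of fun i j => LinearMap.trace A H (LinearMap.mulLeft A (b i * b j))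
  have hG : G.det ≠ 0 := by
    intro h0
    have h1 : G.map σ = (N : F) • (Matrix.of fun i j => t (b i * b j)).map σ := by
      ext i j
      exact htr _
    have h2 := congrArg Matrix.det h1
    rw [Matrix.det_smul, ← RingHom.mapMatrix_apply, ← RingHom.mapMatrix_apply, ← RingHom.map_det,
      ← RingHom.map_det, h0, map_zero] at h2
    exact mul_ne_zero (pow_ne_zero _ (Nat.cast_ne_zero.2 hN))
      ((isUnit_det_gram b nondegenerate).map σ).ne_zero h2.symm
  have hvec : Matrix.vecMul (b.repr z) G = 0 := by
    ext j
    have h1 := htr0 (b j)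
    rw [← b.sum_repr (z : H), Finset.sum_mul] at h1
    simp only [smul_mul_assoc] at h1
    have hlin (i) : LinearMap.trace A H (LinearMap.mulLeft A (b.repr (z : H) i • (b i * b j))) =
        b.repr (z : H) i * G i j := by
      have : LinearMap.mulLeft A (b.repr (z : H) i • (b i * b j)) =
          b.repr (z : H) i • LinearMap.mulLeft A (b i * b j) := by
        ext x; simp [mul_assoc]
      rw [this, map_smul, smul_eq_mul]; rfl
    have hsum : LinearMap.mulLeft A (∑ i, b.repr (z : H) i • (b i * b j)) =
        ∑ i, LinearMap.mulLeft A (b.repr (z : H) i • (b i * b j)) := by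
      ext x; simp [Finset.sum_mul]
    rw [hsum, map_sum] at h1
    simp only [hlin] at h1
    exact h1
  have := Matrix.eq_zero_of_vecMul_eq_zero hG hvec
  exact b.repr.map_eq_zero_iff.1 (Finsupp.ext (congrFun this))

/-- The matrix `E` of multiplication by `e` specializes to an idempotent of trace `0` in
characteristic zero, hence to `0`. The determinant of the idempotent `1 - E` is `0` or `1` over a
domain, and it specializes to `1`; so `1 - E` is an invertible idempotent, and `E = 0`. -/
lemma eq_zero_of_isIdempotentElem_of_trace [IsDomain A] [CharZero F] {N : ℕ}
    (htr : ∀ h, σ (LinearMap.trace A H (LinearMap.mulLeft A h)) = N * σ (t h))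
    {e : H} (he : e * e = e) (ht : t e = 0) : e = 0 := by
  classical
  let b := Module.Free.chooseBasis A H
  let E : Matrix _ _ A := LinearMap.toMatrix b b (LinearMap.mulLeft A e)
  have hE : E * E = E := by
    rw [← LinearMap.toMatrix_comp, ← LinearMap.mulLeft_mul, he]
  have hF : E.map σ = 0 := by
    have hidem : IsIdempotentElem (Matrix.toLin' (E.map σ)) := by
      rw [IsIdempotentElem, Module.End.mul_eq_comp, ← Matrix.toLin'_mul, ← Matrix.map_mul, hE]
    have htrace : LinearMap.trace F _ (Matrix.toLin' (E.map σ)) = 0 := by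
      rw [Matrix.trace_toLin'_eq, ← AddMonoidHom.map_trace, ← LinearMap.trace_eq_matrix_trace]
      refine (htr e).trans ?_
      rw [ht, map_zero, mul_zero]
    exact Matrix.toLin'.map_eq_zero_iff.1
      (LinearMap.IsIdempotentElem.eq_zero_of_trace_eq_zero hidem htrace)
  have hone : (1 - E) * (1 - E) = 1 - E := by
    rw [sub_mul, mul_sub, mul_sub, hE]; simp
  have hdet : (1 - E).det = 1 := by
    have h1 : (1 - E).det * ((1 - E).det - 1) = 0 := by
      rw [mul_sub, mul_one, ← Matrix.det_mul, hone, sub_self]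
    refine (mul_eq_zero.1 h1).elim (fun h0 => ?_) sub_eq_zero.1
    have h2 := congrArg σ h0
    rw [RingHom.map_det, map_sub, map_one, RingHom.mapMatrix_apply, hF, sub_zero, Matrix.det_one,
      map_zero] at h2
    exact absurd h2 one_ne_zero
  have hu : IsUnit (1 - E) := (Matrix.isUnit_iff_isUnit_det _).2 (hdet ▸ isUnit_one)
  have h1 : 1 - E = 1 := hu.mul_left_cancel (by rw [hone, mul_one])
  have hE0 : E = 0 := by rwa [sub_eq_self] at h1
  have h2 : LinearMap.mulLeft A e = 0 := (LinearMap.toMatrix b b).map_eq_zero_iff.1 hE0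
  simpa using LinearMap.congr_fun h2 1

variable {B W : Type*} [Monoid B] [Group W] [Finite W]

/-- If a symmetrizing form specializes to the canonical form of the group algebra of `W`, the
trace of the regular representation specializes to its multiple by `|W|`. -/
lemma trace_mulLeft_specialization
    (nondegenerate : Function.Surjective fun h => t ∘ₗ LinearMap.mulLeft A h)
    (T : B →* H) (hT : Submodule.span A (Set.range T) = ⊤)
    (f : B →* W) (hf : Function.Surjective f) (hcard : Module.finrank A H = Nat.card W)
    (h1 : ∀ b, f b = 1 → σ (t (T b)) = 1) (h0 : ∀ b, f b ≠ 1 → σ (t (T b)) = 0) (h : H) :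
    σ (LinearMap.trace A H (LinearMap.mulLeft A h)) = Nat.card W * σ (t h) := by
  classical
  have : Nontrivial A := σ.domain_nontrivial
  have := Fintype.ofFinite W
  let _ : Algebra A F := σ.toAlgebra
  have hσ (a : A) : algebraMap A F a = σ a := rfl
  -- The specialized form remains nondegenerate, since pairing with the dual basis recovers all
  -- coordinates.
  have hzero (x : H) (hx : ∀ y, σ (t (y * x)) = 0) : (1 : F) ⊗ₜ[A] x = 0 := by
    let b := Module.Free.chooseBasis A H
    choose c hc using fun i => nondegenerate (b.coord i)
    refine (Algebra.TensorProduct.basis F b).ext_elem fun i => ?_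
    have h2 : t (c i * x) = b.coord i x := LinearMap.congr_fun (hc i) x
    rw [Algebra.TensorProduct.basis_repr_tmul, map_zero]
    have h3 := hx (c i)
    rw [h2] at h3
    simpa [hσ] using h3
  have hval (b b' : B) (hb : f b = f b') : σ (t (T b)) = σ (t (T b')) := by
    by_cases hb1 : f b = 1
    · rw [h1 b hb1, h1 b' (hb ▸ hb1)]
    · rw [h0 b hb1, h0 b' (hb ▸ hb1)]
  -- The specialized values depend only on the image in `W`, so by nondegeneracy the specialized
  -- elements do too.
  have hTb (b b' : B) (hb : f b = f b') : (1 : F) ⊗ₜ[A] T b = 1 ⊗ₜ T b' := by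
    rw [← sub_eq_zero, ← TensorProduct.tmul_sub]
    refine hzero _ fun y => ?_
    have hy : y ∈ Submodule.span A (Set.range T) := hT ▸ Submodule.mem_top
    induction hy using Submodule.span_induction with
    | mem y hy =>
      obtain ⟨c, rfl⟩ := hy
      rw [mul_sub, ← map_mul, ← map_mul, map_sub, map_sub,
        hval (c * b) (c * b') (by rw [map_mul, map_mul, hb]), sub_self]
    | zero => rw [zero_mul, map_zero, map_zero]
    | add x y _ _ hx hy => rw [add_mul, map_add, map_add, hx, hy, add_zero]
    | smul a x _ hx => rw [smul_mul_assoc, map_smul, smul_eq_mul, map_mul, hx, mul_zero]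
  choose s hs using hf
  let v : W → F ⊗[A] H := fun w => 1 ⊗ₜ T (s w)
  have hspan : ⊤ ≤ Submodule.span F (Set.range v) := by
    rintro x -
    induction x using TensorProduct.induction_on with
    | zero => exact Submodule.zero_mem _
    | add x y hx hy => exact Submodule.add_mem _ hx hy
    | tmul c y =>
      have hy : y ∈ Submodule.span A (Set.range T) := hT ▸ Submodule.mem_top
      induction hy using Submodule.span_induction with
      | mem y hy =>
        obtain ⟨b, rfl⟩ := hy
        have : c ⊗ₜ[A] T b = c • v (f b) := by
          simp only [v]
          rw [← hTb b _ (hs _).symm, TensorProduct.smul_tmul', smul_eq_mul, mul_one]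
        rw [this]
        exact Submodule.smul_mem _ _ (Submodule.subset_span ⟨_, rfl⟩)
      | zero => rw [TensorProduct.tmul_zero]; exact Submodule.zero_mem _
      | add x y _ _ hx hy => rw [TensorProduct.tmul_add]; exact Submodule.add_mem _ hx hy
      | smul a x _ hx =>
        rw [TensorProduct.tmul_smul, ← algebraMap_smul F a]
        exact Submodule.smul_mem _ _ hx
  -- One element for each `w` suffices to span, and the rank is `|W|`, so the specialized algebra
  -- has a basis indexed by `W`. Multiplication by `T b` permutes it by left translation, and its
  -- trace counts fixed points: all or none.
  let vb : Module.Basis W F (F ⊗[A] H) := basisOfTopLeSpanOfCardEqFinrank v hspan (by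
    rw [Module.finrank_baseChange, hcard, Nat.card_eq_fintype_card])
  have hvb (w : W) : vb w = 1 ⊗ₜ T (s w) := by
    simp only [vb, coe_basisOfTopLeSpanOfCardEqFinrank, v]
  have hbraid (b : B) : σ (LinearMap.trace A H (LinearMap.mulLeft A (T b))) =
      Nat.card W * σ (t (T b)) := by
    have hmul (w : W) : (LinearMap.mulLeft A (T b)).baseChange F (vb w) = vb (f b * w) := by
      rw [hvb, hvb, LinearMap.baseChange_tmul, LinearMap.mulLeft_apply, ← map_mul]
      exact hTb _ _ (by rw [map_mul, hs, hs])
    rw [← hσ, ← LinearMap.trace_baseChange, LinearMap.trace_eq_matrix_trace F vb, Matrix.trace]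
    simp only [Matrix.diag_apply, LinearMap.toMatrix_apply, hmul, Module.Basis.repr_self,
      Finsupp.single_apply, mul_eq_right]
    rw [Finset.sum_const, Finset.card_univ, nsmul_eq_mul, Nat.card_eq_fintype_card]
    split_ifs with hb
    · rw [h1 b hb]
    · rw [h0 b hb]
  have hh : h ∈ Submodule.span A (Set.range T) := hT ▸ Submodule.mem_top
  induction hh using Submodule.span_induction with
  | mem y hy => obtain ⟨b, rfl⟩ := hy; exact hbraid b
  | zero => simp
  | add x y _ _ hx hy =>
    have : LinearMap.mulLeft A (x + y) = LinearMap.mulLeft A x + LinearMap.mulLeft A y := by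
      ext z; simp [add_mul]
    rw [this, map_add, map_add, hx, hy, map_add, map_add, mul_add]
  | smul a x _ hx =>
    have : LinearMap.mulLeft A (a • x) = a • LinearMap.mulLeft A x := by
      ext z; simp
    rw [this, map_smul (LinearMap.trace A H), map_smul t, smul_eq_mul, smul_eq_mul, map_mul,
      map_mul, hx]
    ring

end Trace

/-! ### Laurent polynomials in several indeterminates -/

section MvLaurent

open AddMonoidAlgebra (single)

variable {I : Type*}

lemma exponent_induction {p : (I →₀ ℤ) → Prop} (e : I →₀ ℤ) (zero : p 0)
    (single : ∀ i, p (Finsupp.single i 1)) (add : ∀ e e', p e → p e' → p (e + e'))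
    (neg : ∀ e, p e → p (-e)) : p e := by
  induction e using Finsupp.induction_linear with
  | zero => exact zero
  | add e e' h h' => exact add e e' h h'
  | single i n =>
    induction n using Int.induction_on with
    | zero => rwa [Finsupp.single_zero]
    | succ n ih => rw [Finsupp.single_add]; exact add _ _ ih (single i)
    | pred n ih =>
      rw [sub_eq_add_neg, Finsupp.single_add, Finsupp.single_neg i (1 : ℤ)]
      exact add _ _ ih (neg _ (single i))

lemma single_mul_single_neg (e : I →₀ ℤ) : (single e 1 * single (-e) 1 : MvLaurent I) = 1 := by
  rw [AddMonoidAlgebra.single_mul_single, add_neg_cancel, mul_one]; rfl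

lemma mvLaurent_hom_ext {S : Type*} [CommRing S] {f g : MvLaurent I →+* S}
    (h : ∀ i, f (indet i) = g (indet i)) : f = g := by
  refine AddMonoidAlgebra.ringHom_ext (fun r => ?_) fun e => ?_
  · have : (single 0 r : MvLaurent I) = (r : MvLaurent I) := by
      rw [← zsmul_one, AddMonoidAlgebra.one_def, AddMonoidAlgebra.smul_single, zsmul_eq_mul,
        mul_one]; rfl
    rw [this, map_intCast, map_intCast]
  · induction e using exponent_induction with
    | zero => exact (map_one f).trans (map_one g).symm
    | single i => exact h i
    | add e e' h h' =>
      have : (single (e + e') 1 : MvLaurent I) = single e 1 * single e' 1 := by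
        rw [AddMonoidAlgebra.single_mul_single, mul_one]
      rw [this, map_mul, map_mul, h, h']
    | neg e h =>
      have hf := congrArg f (single_mul_single_neg e)
      have hg := congrArg g (single_mul_single_neg e)
      rw [map_mul, map_one] at hf hg
      rw [← h] at hg
      exact (left_inv_eq_right_inv ((mul_comm _ _).trans hf) hg)

lemma evalUnits_indet {S : Type*} [CommRing S] (x : I → Sˣ) (i : I) :
    evalUnits x (indet i) = x i := by
  simp [evalUnits, indet]

/-- The indeterminate `u i` as a unit. -/
def indetUnit (i : I) : (MvLaurent I)ˣ where
  val := indet i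
  inv := single (-Finsupp.single i 1) 1
  val_inv := single_mul_single_neg _
  inv_val := (mul_comm _ _).trans (single_mul_single_neg _)

/-- The grading of `ℤ[u, u⁻¹]` with `u i` in degree `ν i`. -/
def gradeLaurent (ν : I → ℤ) : MvLaurent I →+* (MvLaurent I)[T;T⁻¹] :=
  evalUnits fun i => Units.map LaurentPolynomial.C.toMonoidHom (indetUnit i) * yPow _ (ν i)

lemma gradeLaurent_indet (ν : I → ℤ) (i : I) :
    gradeLaurent ν (indet i) = single (ν i) (indet i) := by
  rw [gradeLaurent, evalUnits_indet, LaurentPolynomial.single_eq_C_mul_T]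
  rfl

lemma IsHomog.of_mul_eq_one {Q : Type*} [CommRing Q] {α : Q →+* Q[T;T⁻¹]} {k : ℤ} {x y : Q}
    (hx : IsHomog α k x) (hxy : x * y = 1) : IsHomog α (-k) y := by
  have h1 := congrArg α hxy
  rw [map_mul, map_one, hx] at h1
  refine left_inv_eq_right_inv ((mul_comm _ _).trans h1) ?_
  rw [AddMonoidAlgebra.single_mul_single, hxy, add_neg_cancel]; rfl

lemma IsHomog.zsmul {Q : Type*} [Ring Q] {α : Q →+* Q[T;T⁻¹]} {k : ℤ} {x : Q}
    (hx : IsHomog α k x) (r : ℤ) : IsHomog α k (r • x) := by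
  rw [IsHomog, map_zsmul, hx, AddMonoidAlgebra.smul_single]

lemma closure_isHomog_gradeLaurent (ν : I → ℤ) :
    AddSubgroup.closure {a | ∃ k, IsHomog (gradeLaurent ν) k a} = ⊤ := by
  refine (AddSubgroup.eq_top_iff' _).2 fun a => ?_
  induction a using AddMonoidAlgebra.induction_linear with
  | zero => exact AddSubgroup.zero_mem _
  | add f g hf hg => exact AddSubgroup.add_mem _ hf hg
  | single e r =>
    apply AddSubgroup.subset_closure
    suffices h : ∃ k, IsHomog (gradeLaurent ν) k (single e 1) by
      obtain ⟨k, hk⟩ := h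
      refine ⟨k, ?_⟩
      have := hk.zsmul r
      rwa [AddMonoidAlgebra.smul_single, smul_eq_mul, mul_one] at this
    induction e using exponent_induction with
    | zero => exact ⟨0, IsHomog.one⟩
    | single i => exact ⟨_, gradeLaurent_indet ν i⟩
    | add e e' h h' =>
      obtain ⟨k, hk⟩ := h
      obtain ⟨k', hk'⟩ := h'
      have := hk.mul hk'
      rw [AddMonoidAlgebra.single_mul_single, mul_one] at this
      exact ⟨_, this⟩
    | neg e h =>
      obtain ⟨k, hk⟩ := h
      exact ⟨_, hk.of_mul_eq_one (single_mul_single_neg e)⟩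

end MvLaurent

/-! ### Twisting the generic Hecke algebra by a length function -/

section Twist

open AddMonoidAlgebra (single)

variable {K : Type*} [Field K] {V : Type*} [AddCommGroup V] [Module K V]
  {W : Subgroup (V ≃ₗ[K] V)} [Algebra K ℂ] {x₀ : VReg W} {Q : Type*} [Ring Q]

/-- `ℓ` is a homomorphism from the braid group to `ℤ` taking the value `ν C` at the monodromy
generators around the hyperplanes in the orbit `C`. -/
def IsLength (ν : HOrbit W → ℤ) (ℓ : Braid x₀ →* Multiplicative ℤ) : Prop :=
  ∀ (H : Hyperplane W) (s : Braid x₀), IsMonodromyGenerator H s →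
    ℓ s = Multiplicative.ofAdd (ν (Quotient.mk (hyperplaneSetoid W) H))

lemma IsLength.inv {ν : HOrbit W → ℤ} {ℓ : Braid x₀ →* Multiplicative ℤ} (h : IsLength ν ℓ) :
    IsLength (-ν) ℓ⁻¹ := fun H s hs => by
  rw [MonoidHom.inv_apply, h H s hs]; rfl

variable (x₀) in
/-- The homomorphism from the braid group to the generic Hecke algebra. -/
def braidHom : Braid x₀ →* GenericHecke x₀ :=
  (RingQuot.mkRingHom (HeckeRel x₀)).toMonoidHom.comp (MonoidAlgebra.of _ _)

lemma braidHom_apply (b : Braid x₀) : braidHom x₀ b = braidElt b := rfl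

lemma braidElt_mul (b b' : Braid x₀) : braidElt (b * b') = braidElt b * braidElt b' :=
  map_mul (braidHom x₀) b b'

lemma braidElt_one : braidElt (1 : Braid x₀) = 1 := map_one (braidHom x₀)

lemma mkRingHom_single_one (a : MvLaurent (ParamIndex W)) :
    RingQuot.mkRingHom (HeckeRel x₀) (MonoidAlgebra.single 1 a) =
      algebraMap (MvLaurent (ParamIndex W)) (GenericHecke x₀) a := by
  rw [← RingQuot.mkAlgHom_coe (MvLaurent (ParamIndex W)),
    ← AlgHom.commutes (RingQuot.mkAlgHom (MvLaurent (ParamIndex W)) (HeckeRel x₀))]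
  rfl

lemma mkRingHom_single (b : Braid x₀) (a : MvLaurent (ParamIndex W)) :
    RingQuot.mkRingHom (HeckeRel x₀) (MonoidAlgebra.single b a) = a • braidElt b := by
  rw [Algebra.smul_def, ← mkRingHom_single_one, braidElt, ← map_mul,
    MonoidAlgebra.single_mul_single, one_mul, mul_one]

lemma span_braidElt :
    Submodule.span (MvLaurent (ParamIndex W)) (Set.range (braidHom x₀)) = ⊤ := by
  refine eq_top_iff.2 fun h _ => ?_
  obtain ⟨p, rfl⟩ := RingQuot.mkRingHom_surjective (HeckeRel x₀) h
  induction p using MonoidAlgebra.induction_linear with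
  | zero => rw [map_zero]; exact Submodule.zero_mem _
  | add f g hf hg => rw [map_add]; exact Submodule.add_mem _ (hf trivial) (hg trivial)
  | single b a =>
    rw [mkRingHom_single]
    exact Submodule.smul_mem _ _ (Submodule.subset_span ⟨b, rfl⟩)

lemma prod_ofFn_mul {n : ℕ} {c : Q} (hc : ∀ x, Commute c x) (x : Fin n → Q) :
    (List.ofFn fun j => c * x j).prod = c ^ n * (List.ofFn x).prod := by
  induction n with
  | zero => simp
  | succ n ih =>
    rw [List.ofFn_succ, List.ofFn_succ, List.prod_cons, List.prod_cons, ih, pow_succ', mul_assoc,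
      mul_assoc, ← mul_assoc (x 0), ← mul_assoc (c ^ n), ((hc (x 0)).pow_left n).eq]

variable {ν : HOrbit W → ℤ} {ℓ : Braid x₀ →* Multiplicative ℤ}

variable (ℓ) in
/-- The homomorphism `b ↦ χ(ℓ(b)) f(b)`. -/
def twistBraid (f : GenericHecke x₀ →+* Q) (χ : Multiplicative ℤ →* Q)
    (hχ : ∀ n x, Commute (χ n) x) : Braid x₀ →* Q where
  toFun b := χ (ℓ b) * f (braidElt b)
  map_one' := by rw [map_one, map_one, braidElt_one, map_one, one_mul]
  map_mul' b b' := by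
    rw [map_mul, map_mul, braidElt_mul, map_mul, mul_assoc, mul_assoc, ← mul_assoc (χ (ℓ b')),
      (hχ (ℓ b') (f (braidElt b))).eq, mul_assoc]

lemma twistBraid_apply (f : GenericHecke x₀ →+* Q) (χ : Multiplicative ℤ →* Q)
    (hχ : ∀ n x, Commute (χ n) x) (b : Braid x₀) :
    twistBraid ℓ f χ hχ b = χ (ℓ b) * f (braidElt b) := rfl

/-- Each factor `s - u_{C,j}` goes to its image under `f` times the central element `χ (ν C)`, which
does not depend on `j`, so the whole product is a multiple of a relation already killed by `f`. This
one construction yields both the grading `gradeHecke` and the map `genericTwist`. -/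
lemma heckeTwist_rel (hℓ : IsLength ν ℓ) (f : GenericHecke x₀ →+* Q)
    (χ : Multiplicative ℤ →* Q) (hχ : ∀ n x, Commute (χ n) x)
    (gA : MvLaurent (ParamIndex W) →+* Q) (hgA : ∀ a x, Commute (gA a) x)
    (h : ∀ C j, gA (indet ⟨C, j⟩) = χ (Multiplicative.ofAdd (ν C)) *
      f (algebraMap (MvLaurent (ParamIndex W)) _ (indet ⟨C, j⟩)))
    ⦃x y : MonoidAlgebra (MvLaurent (ParamIndex W)) (Braid x₀)⦄ (hxy : HeckeRel x₀ x y) :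
    MonoidAlgebra.liftNCRingHom gA (twistBraid ℓ f χ hχ) (fun a _ => hgA a _) x =
      MonoidAlgebra.liftNCRingHom gA (twistBraid ℓ f χ hχ) (fun a _ => hgA a _) y := by
  obtain ⟨C, H, hH, s, hs⟩ := hxy
  have hrel := congrArg f (RingQuot.mkRingHom_rel (HeckeRel.mk C H hH s hs))
  rw [map_zero, map_zero, map_list_prod, map_list_prod, List.map_ofFn, List.map_ofFn] at hrel
  rw [map_zero, map_list_prod, List.map_ofFn]
  have hfac (j : Fin (ordC W C)) :
      MonoidAlgebra.liftNCRingHom gA (twistBraid ℓ f χ hχ) (fun a _ => hgA a _)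
        (MonoidAlgebra.single s 1 - MonoidAlgebra.single 1 (indet ⟨C, j⟩)) =
      χ (Multiplicative.ofAdd (ν C)) * f (RingQuot.mkRingHom (HeckeRel x₀)
        (MonoidAlgebra.single s 1 - MonoidAlgebra.single 1 (indet ⟨C, j⟩))) := by
    rw [map_sub, MonoidAlgebra.liftNCRingHom_single, MonoidAlgebra.liftNCRingHom_single, map_one,
      one_mul, map_one, mul_one, h, map_sub, mkRingHom_single_one, map_sub, mul_sub,
      twistBraid_apply, hℓ H s hs, hH]
    rfl
  refine (congrArg (fun l : List Q => l.prod) (congrArg List.ofFn (funext hfac))).trans ?_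
  rw [prod_ofFn_mul (hχ _)]
  exact (congrArg _ hrel).trans (mul_zero _)

/-- The twist by the length function `ℓ` of a homomorphism `f` defined on the generic Hecke
algebra. -/
def heckeTwist (hℓ : IsLength ν ℓ) (f : GenericHecke x₀ →+* Q)
    (χ : Multiplicative ℤ →* Q) (hχ : ∀ n x, Commute (χ n) x)
    (gA : MvLaurent (ParamIndex W) →+* Q) (hgA : ∀ a x, Commute (gA a) x)
    (h : ∀ C j, gA (indet ⟨C, j⟩) = χ (Multiplicative.ofAdd (ν C)) *
      f (algebraMap (MvLaurent (ParamIndex W)) _ (indet ⟨C, j⟩))) : GenericHecke x₀ →+* Q :=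
  RingQuot.lift ⟨_, heckeTwist_rel hℓ f χ hχ gA hgA h⟩

variable (hℓ : IsLength ν ℓ) (f : GenericHecke x₀ →+* Q)
    (χ : Multiplicative ℤ →* Q) (hχ : ∀ n x, Commute (χ n) x)
    (gA : MvLaurent (ParamIndex W) →+* Q) (hgA : ∀ a x, Commute (gA a) x)
    (h : ∀ C j, gA (indet ⟨C, j⟩) = χ (Multiplicative.ofAdd (ν C)) *
      f (algebraMap (MvLaurent (ParamIndex W)) _ (indet ⟨C, j⟩)))

lemma heckeTwist_algebraMap (a : MvLaurent (ParamIndex W)) :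
    heckeTwist hℓ f χ hχ gA hgA h (algebraMap _ _ a) = gA a := by
  rw [← mkRingHom_single_one, heckeTwist, RingQuot.lift_mkRingHom_apply,
    MonoidAlgebra.liftNCRingHom_single, map_one, mul_one]

lemma heckeTwist_braidElt (b : Braid x₀) :
    heckeTwist hℓ f χ hχ gA hgA h (braidElt b) = χ (ℓ b) * f (braidElt b) := by
  rw [braidElt, heckeTwist, RingQuot.lift_mkRingHom_apply,
    MonoidAlgebra.liftNCRingHom_single, map_one, one_mul]
  rfl

end Twist

/-! ### Homogeneity of the canonical form -/

section Homogeneity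

open AddMonoidAlgebra (single)

variable {K : Type*} [Field K] {V : Type*} [AddCommGroup V] [Module K V]
  {W : Subgroup (V ≃ₗ[K] V)} [Algebra K ℂ] {x₀ : VReg W}
  {ν : HOrbit W → ℤ} {ℓ : Braid x₀ →* Multiplicative ℤ}

/-- Laurent polynomials over a ring. -/
abbrev LaurentOver (Q : Type*) [Ring Q] : Type _ := Q[T;T⁻¹]

lemma commute_single_one {Q : Type*} [Ring Q] (n : ℤ) (p : Q[T;T⁻¹]) :
    Commute (single n 1) p := LaurentPolynomial.commute_T n p

/-- The homomorphism `n ↦ T ^ n`. -/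
def singleHom (Q : Type*) [Ring Q] : Multiplicative ℤ →* Q[T;T⁻¹] where
  toFun n := single n.toAdd 1
  map_one' := rfl
  map_mul' m n := by rw [AddMonoidAlgebra.single_mul_single, mul_one]; rfl

variable (ν) in
/-- The grading of the parameter ring, with `u_{C,j}` in degree `ν C`. -/
def gradeParam : MvLaurent (ParamIndex W) →+* (MvLaurent (ParamIndex W))[T;T⁻¹] :=
  gradeLaurent fun i => ν i.1

/-- The grading of the generic Hecke algebra, with `u_{C,j}` in degree `ν C` and a braid `b` in
degree `ℓ(b)`. -/
def gradeHecke (hℓ : IsLength ν ℓ) : GenericHecke x₀ →+* LaurentOver (GenericHecke x₀) :=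
  heckeTwist (Q := LaurentOver (GenericHecke x₀)) hℓ LaurentPolynomial.C (singleHom _)
    (fun _ _ => commute_single_one _ _)
    ((AddMonoidAlgebra.mapRingHom ℤ
      (algebraMap (MvLaurent (ParamIndex W)) (GenericHecke x₀))).comp (gradeParam ν))
    (fun a p => by
      rw [RingHom.comp_apply]
      generalize gradeParam ν a = q
      induction q using AddMonoidAlgebra.induction_linear with
      | zero => rw [map_zero]; exact Commute.zero_left _
      | add q q' h h' => rw [map_add]; exact h.add_left h'
      | single n c =>
        rw [AddMonoidAlgebra.mapRingHom_single]
        induction p using AddMonoidAlgebra.induction_linear with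
        | zero => exact Commute.zero_right _
        | add p p' h h' => exact h.add_right h'
        | single k x =>
          rw [Commute, SemiconjBy, AddMonoidAlgebra.single_mul_single,
            AddMonoidAlgebra.single_mul_single, Algebra.commutes, add_comm])
    (fun C j => by
      rw [RingHom.comp_apply, gradeParam, gradeLaurent_indet, AddMonoidAlgebra.mapRingHom_single,
        ← LaurentPolynomial.single_eq_C]
      refine Eq.trans ?_ (AddMonoidAlgebra.single_mul_single ..).symm
      rw [one_mul, add_zero]; rfl)

lemma gradeHecke_algebraMap (hℓ : IsLength ν ℓ) (a : MvLaurent (ParamIndex W)) :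
    gradeHecke hℓ (algebraMap _ _ a) =
      (AddMonoidAlgebra.mapRingHom ℤ (algebraMap (MvLaurent (ParamIndex W)) (GenericHecke x₀))
        (gradeParam ν a) : LaurentOver (GenericHecke x₀)) :=
  heckeTwist_algebraMap ..

lemma isHomog_braidElt (hℓ : IsLength ν ℓ) (b : Braid x₀) :
    IsHomog (gradeHecke hℓ) (ℓ b).toAdd (braidElt b) := by
  refine (heckeTwist_braidElt ..).trans ?_
  rw [← LaurentPolynomial.single_eq_C]
  refine (AddMonoidAlgebra.single_mul_single ..).trans ?_
  rw [one_mul, add_zero]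

lemma isGradedBy_gradeHecke (hℓ : IsLength ν ℓ) :
    IsGradedBy (gradeParam ν) (gradeHecke hℓ) := by
  have hsmul {k d : ℤ} {a : MvLaurent (ParamIndex W)} {h : GenericHecke x₀}
      (ha : IsHomog (gradeParam ν) k a) (hh : IsHomog (gradeHecke hℓ) d h) :
      IsHomog (gradeHecke hℓ) (k + d) (a • h) := by
    rw [IsHomog, Algebra.smul_def, map_mul, gradeHecke_algebraMap, ha, hh,
      AddMonoidAlgebra.mapRingHom_single, AddMonoidAlgebra.single_mul_single]
  refine ⟨closure_isHomog_gradeLaurent _, (AddSubgroup.eq_top_iff' _).2 fun h => ?_, hsmul⟩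
  have hh : h ∈ Submodule.span (MvLaurent (ParamIndex W)) (Set.range (braidHom x₀)) :=
    (span_braidElt (x₀ := x₀)).symm ▸ Submodule.mem_top
  induction hh using Submodule.span_induction with
  | mem h hh =>
    obtain ⟨b, rfl⟩ := hh
    exact AddSubgroup.subset_closure ⟨_, isHomog_braidElt hℓ b⟩
  | zero => exact AddSubgroup.zero_mem _
  | add x y _ _ hx hy => exact AddSubgroup.add_mem _ hx hy
  | smul a x hmem hx =>
    clear hmem
    induction a using homog_induction (closure_isHomog_gradeLaurent fun i : ParamIndex W => ν i.1)
      with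
    | zero => rw [zero_smul]; exact AddSubgroup.zero_mem _
    | add a a' h h' => rw [add_smul]; exact AddSubgroup.add_mem _ h h'
    | homog k a ha =>
      induction hx using AddSubgroup.closure_induction with
      | mem x hx =>
        obtain ⟨d, hd⟩ := hx
        exact AddSubgroup.subset_closure ⟨_, hsmul ha hd⟩
      | zero => rw [smul_zero]; exact AddSubgroup.zero_mem _
      | add x y _ _ hx hy => rw [smul_add]; exact AddSubgroup.add_mem _ hx hy
      | neg x _ hx => rw [smul_neg]; exact AddSubgroup.neg_mem _ hx

variable [NumberField K] {ζ : HOrbit W → (𝓞 K)ˣ}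
  {t : GenericHecke x₀ →ₗ[MvLaurent (ParamIndex W)] MvLaurent (ParamIndex W)}

lemma invertIndets_involutive {I : Type*} (a : MvLaurent I) :
    invertIndets (invertIndets a) = a := by
  have : (invertIndets.comp invertIndets : MvLaurent I →+* MvLaurent I) = RingHom.id _ :=
    mvLaurent_hom_ext fun i => by simp [invertIndets, indet]
  exact RingHom.congr_fun this a

/-- Take `b = 1` in the inversion formula and cancel `t(π)`, which is nonzero because `π` maps to
`1` in `W` and so `t(π)` specializes to `1`. -/
lemma IsCanonicalForm.map_one (ht : IsCanonicalForm ζ t) : t 1 = 1 := by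
  have h1 := ht.inversion 1
  rw [inv_one, one_mul, braidElt_one] at h1
  have hne : t (braidElt (fullTwist x₀)) ≠ 0 := by
    intro h0
    have hmap : (fullTwist x₀).MapsTo (1 : W) :=
      (Braid.mapsTo_iff _ _).2 ⟨(fullTwistLoop x₀).cast rfl (one_smul W x₀), rfl⟩
    have h2 := (ht.specialization _ 1 hmap).1 rfl
    rw [h0, map_zero] at h2
    exact zero_ne_one h2
  have h3 : invertIndets (t 1) = 1 := mul_right_cancel₀ hne (h1.trans (one_mul _).symm)
  rw [← invertIndets_involutive (t 1), h3, _root_.map_one]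

variable [Finite W]

/-- Multiplying by a braid over `w⁻¹` reduces to a braid over both `1` and `w' * w⁻¹`, on which the
specialized form would take the values `1` and `0`. -/
lemma IsCanonicalForm.mapsTo_unique (ht : IsCanonicalForm ζ t) {b : Braid x₀} {w w' : W}
    (h : b.MapsTo w) (h' : b.MapsTo w') : w = w' := by
  obtain ⟨c, hc⟩ := Braid.exists_mapsTo_of_mem (x₀ := x₀) w⁻¹
  by_contra hne
  have h1 := (ht.specialization _ _ (h.mul hc)).1 (mul_inv_cancel w)
  rw [(ht.specialization _ _ (h'.mul hc)).2
    (fun h0 => hne (mul_inv_eq_one.1 h0).symm)] at h1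
  exact zero_ne_one h1

/-- The homomorphism from the braid group to the reflection group. -/
def IsCanonicalForm.toGroup (ht : IsCanonicalForm ζ t) : Braid x₀ →* W where
  toFun b := (ht.exists_mapsTo b).choose
  map_one' := ht.mapsTo_unique (ht.exists_mapsTo 1).choose_spec Braid.mapsTo_one
  map_mul' b b' := ht.mapsTo_unique (ht.exists_mapsTo (b * b')).choose_spec
    ((ht.exists_mapsTo b).choose_spec.mul (ht.exists_mapsTo b').choose_spec)

lemma IsCanonicalForm.mapsTo_toGroup (ht : IsCanonicalForm ζ t) (b : Braid x₀) :
    b.MapsTo (ht.toGroup b) := (ht.exists_mapsTo b).choose_spec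

/-- A symmetrizing form which specializes to the canonical form of a group algebra is homogeneous
with respect to any grading of the algebra. -/
lemma isHomog_of_specialization {A H F B G : Type*} [CommRing A] [IsDomain A] [Ring H] [Algebra A H]
    [Module.Free A H] [Module.Finite A H] [Field F] [CharZero F] [Monoid B] [Group G] [Finite G]
    {αA : A →+* A[T;T⁻¹]} {αH : H →+* H[T;T⁻¹]} (g : IsGradedBy αA αH) {t : H →ₗ[A] A}
    (symm : ∀ h h', t (h * h') = t (h' * h))
    (nondegenerate : Function.Bijective fun h => t ∘ₗ LinearMap.mulLeft A h) (one : t 1 = 1)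
    (T : B →* H) (hT : Submodule.span A (Set.range T) = ⊤)
    (f : B →* G) (hf : Function.Surjective f) (hcard : Module.finrank A H = Nat.card G)
    (σ : A →+* F) (h1 : ∀ b, f b = 1 → σ (t (T b)) = 1) (h0 : ∀ b, f b ≠ 1 → σ (t (T b)) = 0)
    {k : ℤ} {h : H} (hh : IsHomog αH k h) : IsHomog αA k (t h) := by
  have htr := trace_mulLeft_specialization nondegenerate.2 T hT f hf hcard h1 h0
  exact isHomog_of_symmetrizing g symm nondegenerate one
    (isReduced_center_of_trace Nat.card_pos.ne' nondegenerate.2 htr)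
    (fun e he hte => eq_zero_of_isIdempotentElem_of_trace htr he hte) hh

/-- The values of the canonical form are homogeneous. -/
theorem IsCanonicalForm.isHomog (ht : IsCanonicalForm ζ t)
    (hfree : Module.Free (MvLaurent (ParamIndex W)) (GenericHecke x₀))
    (hrank : Module.finrank (MvLaurent (ParamIndex W)) (GenericHecke x₀) = Nat.card W)
    (hℓ : IsLength ν ℓ) (b : Braid x₀) :
    IsHomog (gradeParam ν) (ℓ b).toAdd (t (braidElt b)) := by
  have hfin : Module.Finite (MvLaurent (ParamIndex W)) (GenericHecke x₀) :=
    Module.finite_of_finrank_pos (hrank ▸ Nat.card_pos)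
  let σ : MvLaurent (ParamIndex W) →+* K :=
    (algebraMap (𝓞 K) K).comp (evalUnits fun i : ParamIndex W => ζ i.1 ^ (i.2 : ℕ))
  have hsurj : Function.Surjective ht.toGroup := fun w => by
    obtain ⟨b, hb⟩ := Braid.exists_mapsTo_of_mem (x₀ := x₀) w
    exact ⟨b, ht.mapsTo_unique (ht.mapsTo_toGroup b) hb⟩
  have h1 (b : Braid x₀) (hb : ht.toGroup b = 1) : σ (t (braidHom x₀ b)) = 1 :=
    (congrArg (algebraMap (𝓞 K) K) ((ht.specialization b _ (ht.mapsTo_toGroup b)).1 hb)).trans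
      (_root_.map_one _)
  have h0 (b : Braid x₀) (hb : ht.toGroup b ≠ 1) : σ (t (braidHom x₀ b)) = 0 :=
    (congrArg (algebraMap (𝓞 K) K) ((ht.specialization b _ (ht.mapsTo_toGroup b)).2 hb)).trans
      (map_zero _)
  exact isHomog_of_specialization (A := MvLaurent (ParamIndex W)) (H := GenericHecke x₀)
    (B := Braid x₀) (G := W) (isGradedBy_gradeHecke hℓ) ht.symm ht.nondegenerate ht.map_one
    (braidHom x₀) span_braidElt ht.toGroup hsurj hrank σ h1 h0 (isHomog_braidElt hℓ b)

end Homogeneity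

/-! ### Universal property and functoriality of specializations -/

section Specialization

variable {R S : Type*} [CommRing R] [CommRing S] {f : R →+* S} {H : Type*} [Ring H] [Algebra R H]

lemma specialize_algebraMap (a : R) :
    specialize f (algebraMap R H a) = algebraMap S (Specialization f H) (f a) :=
  (Algebra.TensorProduct.includeRight : H →ₐ[R] Via f ⊗[R] H).commutes a

lemma specialization_induction {p : Specialization f H → Prop} (x : Specialization f H)
    (zero : p 0) (add : ∀ x y, p x → p y → p (x + y))
    (smul : ∀ (c : S) (h : H), p (c • specialize f h)) : p x := by
  refine TensorProduct.induction_on (motive := p) x zero (fun c h => ?_) add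
  have : c ⊗ₜ[R] h = c • ((1 : Via f) ⊗ₜ[R] h) := by
    rw [TensorProduct.smul_tmul', smul_eq_mul, mul_one]
  rw [this]
  exact smul c h

lemma specialize_smul (a : R) (h : H) : specialize f (a • h) = f a • specialize f h := by
  rw [Algebra.smul_def, map_mul, specialize_algebraMap, Algebra.smul_def]

lemma specialization_linearMap_ext {M : Type*} [AddCommMonoid M] [Module S M]
    {g g' : Specialization f H →ₗ[S] M} (h : ∀ x, g (specialize f x) = g' (specialize f x)) :
    g = g' := by
  ext x
  induction x using specialization_induction with
  | zero => rw [map_zero, map_zero]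
  | add x y hx hy => rw [map_add, map_add, hx, hy]
  | smul c x => rw [map_smul, map_smul, h]

lemma specialization_linearMap_ext_span {M : Type*} [AddCommMonoid M] [Module S M]
    {s : Set H} (hs : Submodule.span R s = ⊤) {g g' : Specialization f H →ₗ[S] M}
    (h : ∀ x ∈ s, g (specialize f x) = g' (specialize f x)) : g = g' := by
  refine specialization_linearMap_ext fun x => ?_
  have hx : x ∈ Submodule.span R s := hs ▸ Submodule.mem_top
  induction hx using Submodule.span_induction with
  | mem x hx => exact h x hx
  | zero => rw [map_zero, map_zero, map_zero]
  | add x y _ _ hx hy => rw [map_add, map_add, map_add, hx, hy]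
  | smul a x _ hx => rw [specialize_smul, map_smul, map_smul, hx]

lemma specialization_algHom_ext_span {Q : Type*} [Ring Q] [Algebra S Q]
    {s : Set H} (hs : Submodule.span R s = ⊤) {g g' : Specialization f H →ₐ[S] Q}
    (h : ∀ x ∈ s, g (specialize f x) = g' (specialize f x)) : g = g' :=
  AlgHom.toLinearMap_injective (specialization_linearMap_ext_span hs h)

lemma specialization_algHom_ext {Q : Type*} [Ring Q] [Algebra S Q]
    {g g' : Specialization f H →ₐ[S] Q} (h : ∀ x, g (specialize f x) = g' (specialize f x)) :
    g = g' :=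
  AlgHom.toLinearMap_injective (specialization_linearMap_ext h)

/-- The universal property of `S ⊗[R] H`. -/
def specLift {Q : Type*} [Ring Q] [Algebra S Q] (g : H →+* Q)
    (hg : ∀ a, g (algebraMap R H a) = algebraMap S Q (f a)) : Specialization f H →ₐ[S] Q :=
  letI : Algebra R Q := Algebra.compHom Q f
  letI : Algebra (Via f) Q := inferInstanceAs (Algebra S Q)
  haveI : IsScalarTower R (Via f) Q := IsScalarTower.of_algebraMap_eq fun _ => rfl
  let F : Via f ⊗[R] H →ₐ[Via f] Q := Algebra.TensorProduct.lift (Algebra.ofId (Via f) Q)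
    ({ g with commutes' := hg } : H →ₐ[R] Q) fun c x => Algebra.commutes c (g x)
  { F.toRingHom with commutes' := F.commutes }

lemma specLift_specialize {Q : Type*} [Ring Q] [Algebra S Q] (g : H →+* Q)
    (hg : ∀ a, g (algebraMap R H a) = algebraMap S Q (f a)) (h : H) :
    specLift g hg (specialize f h) = g h := by
  let _ : Algebra R Q := Algebra.compHom Q f
  let _ : Algebra (Via f) Q := inferInstanceAs (Algebra S Q)
  have : IsScalarTower R (Via f) Q := IsScalarTower.of_algebraMap_eq fun _ => rfl
  refine (Algebra.TensorProduct.lift_tmul (Algebra.ofId (Via f) Q)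
    ({ g with commutes' := hg } : H →ₐ[R] Q) (fun c x => Algebra.commutes c (g x)) 1 h).trans ?_
  rw [map_one, one_mul]; rfl

variable (f) in
/-- The homomorphism of specializations induced by a homomorphism of algebras. -/
def specMap {H' : Type*} [Ring H'] [Algebra R H'] (e : H →ₐ[R] H') :
    Specialization f H →ₐ[S] Specialization f H' :=
  specLift ((specialize f).comp e.toRingHom)
    fun a => (congrArg _ (e.commutes a)).trans (specialize_algebraMap a)

lemma specMap_specialize {H' : Type*} [Ring H'] [Algebra R H'] (e : H →ₐ[R] H') (h : H) :
    specMap f e (specialize f h) = specialize f (e h) :=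
  specLift_specialize ..

variable (f) in
/-- The isomorphism of specializations induced by an isomorphism of algebras. -/
def specCongr {H' : Type*} [Ring H'] [Algebra R H'] (e : H ≃ₐ[R] H') :
    Specialization f H ≃ₐ[S] Specialization f H' :=
  AlgEquiv.ofAlgHom (specMap f e.toAlgHom) (specMap f e.symm.toAlgHom)
    (specialization_algHom_ext fun x => by
      rw [AlgHom.comp_apply, specMap_specialize, specMap_specialize, AlgHom.id_apply]
      exact congrArg _ (e.apply_symm_apply x))
    (specialization_algHom_ext fun x => by
      rw [AlgHom.comp_apply, specMap_specialize, specMap_specialize, AlgHom.id_apply]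
      exact congrArg _ (e.symm_apply_apply x))

lemma specCongr_specialize {H' : Type*} [Ring H'] [Algebra R H'] (e : H ≃ₐ[R] H') (h : H) :
    specCongr f e (specialize f h) = specialize f (e h) :=
  specMap_specialize ..

lemma specializeForm_specialize (t : H →ₗ[R] R) (h : H) :
    specializeForm f t (specialize f h) = f (t h) := by
  refine (TensorProduct.AlgebraTensorModule.rid_tmul (R := R) (A := Via f) (t h)
    (1 : Via f)).trans ?_
  exact (Algebra.smul_def (t h) (1 : Via f)).trans (mul_one _)

lemma specializeForm_specCongr {H' : Type*} [Ring H'] [Algebra R H'] (e : H ≃ₐ[R] H')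
    {t : H →ₗ[R] R} {t' : H' →ₗ[R] R} (ht : ∀ h, t' (e h) = t h) (x : Specialization f H) :
    specializeForm f t' (specCongr f e x) = specializeForm f t x := by
  refine LinearMap.congr_fun (f := specializeForm f t' ∘ₗ (specCongr f e).toLinearMap)
    (specialization_linearMap_ext fun h => ?_) x
  rw [specializeForm_specialize, ← ht]
  exact (congrArg _ (specCongr_specialize e h)).trans (specializeForm_specialize ..)

lemma specializeForm_apply_eq {f' : R →+* S} {e : Specialization f' H →ₗ[S] Specialization f H}
    {s : Set H} (hs : Submodule.span R s = ⊤) {t : H →ₗ[R] R}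
    (h : ∀ x ∈ s, specializeForm f t (e (specialize f' x)) = f' (t x)) (x : Specialization f' H) :
    specializeForm f t (e x) = specializeForm f' t x := by
  refine LinearMap.congr_fun (f := specializeForm f t ∘ₗ e)
    (specialization_linearMap_ext_span hs fun x hx => ?_) x
  rw [LinearMap.comp_apply, h x hx, specializeForm_specialize]

instance [Module.Finite R H] : Module.Finite S (Specialization f H) :=
  inferInstanceAs (Module.Finite (Via f) (Via f ⊗[R] H))

end Specialization

/-! ### Cyclotomic Hecke algebras whose parameters differ by a function of the orbit -/

section Twist

set_option linter.unusedSectionVars false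

variable {K : Type*} [Field K] {V : Type*} [AddCommGroup V] [Module K V]
  {W : Subgroup (V ≃ₗ[K] V)} [Algebra K ℂ] [NumberField K] {x₀ : VReg W}
  {ν : HOrbit W → ℤ} {ℓ : Braid x₀ →* Multiplicative ℤ} {ζ : HOrbit W → (𝓞 K)ˣ} {m m' : Params W}

lemma yPow_zpow (R : Type*) [CommRing R] (k n : ℤ) : yPow R k ^ n = yPow R (k * n) := by
  let φ : Multiplicative ℤ →* R[T;T⁻¹]ˣ :=
    { toFun := fun k => yPow R k.toAdd
      map_one' := Units.ext LaurentPolynomial.T_zero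
      map_mul' := fun k k' => Units.ext (LaurentPolynomial.T_add k.toAdd k'.toAdd) }
  rw [mul_comm, ← smul_eq_mul]
  exact (map_zpow φ (Multiplicative.ofAdd k) n).symm

variable (K) in
/-- The power `q ^ n` in `ℤ_K[y, y⁻¹]`, where `q = y ^ |μ(K)|`. -/
def qPow : Multiplicative ℤ →* (𝓞 K)[T;T⁻¹] where
  toFun n := LaurentPolynomial.T (NumberField.Units.torsionOrder K * n.toAdd)
  map_one' := by rw [toAdd_one, mul_zero, LaurentPolynomial.T_zero]
  map_mul' n n' := by rw [toAdd_mul, mul_add, LaurentPolynomial.T_add]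

lemma cycSpec_indet (C : HOrbit W) (j : Fin (ordC W C)) :
    cycSpec ζ m (indet ⟨C, j⟩) = LaurentPolynomial.C ((ζ C ^ (j : ℕ) : (𝓞 K)ˣ) : 𝓞 K) *
      qPow K (Multiplicative.ofAdd (m C j)) :=
  evalUnits_indet _ _

lemma cycSpec_indet_eq (hm : ∀ C j, m' C j = m C j + ν C) (C : HOrbit W) (j : Fin (ordC W C)) :
    cycSpec ζ m' (indet ⟨C, j⟩) =
      qPow K (Multiplicative.ofAdd (ν C)) * cycSpec ζ m (indet ⟨C, j⟩) := by
  rw [cycSpec_indet, cycSpec_indet, hm, ofAdd_add, map_mul]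
  ring

/-- The specialization `φ_{m'}` is the grading followed by `T ↦ q` and `φ_m` on coefficients. -/
lemma cycSpec_of_isHomog (hm : ∀ C j, m' C j = m C j + ν C) {n : ℤ}
    {a : MvLaurent (ParamIndex W)} (ha : IsHomog (gradeParam ν) n a) :
    cycSpec ζ m' a = qPow K (Multiplicative.ofAdd n) * cycSpec ζ m a := by
  let Θ := LaurentPolynomial.eval₂ (cycSpec ζ m) (yPow (𝓞 K) (NumberField.Units.torsionOrder K))
  have hΘ (n : ℤ) (a : MvLaurent (ParamIndex W)) :
      Θ (AddMonoidAlgebra.single n a) = qPow K (Multiplicative.ofAdd n) * cycSpec ζ m a := by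
    rw [LaurentPolynomial.single_eq_C_mul_T, LaurentPolynomial.eval₂_C_mul_T, mul_comm, yPow_zpow]
    rfl
  have h : cycSpec ζ m' = Θ.comp (gradeParam ν) := mvLaurent_hom_ext fun i => by
    rw [RingHom.comp_apply, gradeParam, gradeLaurent_indet, hΘ]
    exact cycSpec_indet_eq hm i.1 i.2
  rw [h, RingHom.comp_apply, ha, hΘ]

lemma cycHecke_algHom_ext {Q : Type*} [Ring Q] [Algebra (𝓞 K)[T;T⁻¹] Q]
    {g g' : CycHecke x₀ ζ m →ₐ[(𝓞 K)[T;T⁻¹]] Q}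
    (h : ∀ b, g (specialize _ (braidElt b)) = g' (specialize _ (braidElt b))) : g = g' :=
  specialization_algHom_ext_span (span_braidElt (x₀ := x₀)) (Set.forall_mem_range.2 h)

/-- The homomorphism `ℋ(W) → ℋ_m`, `u_{C,j} ↦ φ_{m + ν}(u_{C,j})`, `b ↦ q ^ {ℓ(b)} b`. -/
def genericTwist (ζ : HOrbit W → (𝓞 K)ˣ) (hℓ : IsLength ν ℓ) (hm : ∀ C j, m' C j = m C j + ν C) :
    GenericHecke x₀ →+* CycHecke x₀ ζ m :=
  heckeTwist hℓ (specialize (cycSpec ζ m))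
    ((algebraMap (𝓞 K)[T;T⁻¹] (CycHecke x₀ ζ m)).toMonoidHom.comp (qPow K))
    (fun n x => Algebra.commute_algebraMap_left (qPow K n) x)
    ((algebraMap (𝓞 K)[T;T⁻¹] (CycHecke x₀ ζ m)).comp (cycSpec ζ m'))
    (fun a x => Algebra.commute_algebraMap_left (cycSpec ζ m' a) x)
    fun C j => by
      rw [specialize_algebraMap, RingHom.comp_apply, cycSpec_indet_eq hm, map_mul]
      rfl

lemma genericTwist_algebraMap (hℓ : IsLength ν ℓ) (hm : ∀ C j, m' C j = m C j + ν C)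
    (a : MvLaurent (ParamIndex W)) :
    genericTwist ζ hℓ hm (algebraMap _ (GenericHecke x₀) a) =
      algebraMap (𝓞 K)[T;T⁻¹] (CycHecke x₀ ζ m) (cycSpec ζ m' a) :=
  heckeTwist_algebraMap ..

lemma genericTwist_braidElt (hℓ : IsLength ν ℓ) (hm : ∀ C j, m' C j = m C j + ν C) (b : Braid x₀) :
    genericTwist ζ hℓ hm (braidElt b) = qPow K (ℓ b) • specialize (cycSpec ζ m) (braidElt b) := by
  rw [genericTwist, heckeTwist_braidElt, Algebra.smul_def]
  rfl

/-- The homomorphism `ℋ_{m + ν} → ℋ_m`, `b ↦ q ^ {ℓ(b)} b`. -/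
def cycTwist (ζ : HOrbit W → (𝓞 K)ˣ) (hℓ : IsLength ν ℓ) (hm : ∀ C j, m' C j = m C j + ν C) :
    CycHecke x₀ ζ m' →ₐ[(𝓞 K)[T;T⁻¹]] CycHecke x₀ ζ m :=
  specLift (genericTwist ζ hℓ hm) (genericTwist_algebraMap hℓ hm)

lemma cycTwist_braidElt (hℓ : IsLength ν ℓ) (hm : ∀ C j, m' C j = m C j + ν C) (b : Braid x₀) :
    cycTwist ζ hℓ hm (specialize (cycSpec ζ m') (braidElt b)) =
      qPow K (ℓ b) • specialize (cycSpec ζ m) (braidElt b) := by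
  rw [cycTwist, specLift_specialize, genericTwist_braidElt]

lemma cycTwist_comp (hℓ : IsLength ν ℓ) (hm : ∀ C j, m' C j = m C j + ν C)
    {ν' : HOrbit W → ℤ} {ℓ' : Braid x₀ →* Multiplicative ℤ}
    (hℓ' : IsLength ν' ℓ') (hm' : ∀ C j, m C j = m' C j + ν' C) (h : ∀ b, ℓ b * ℓ' b = 1) :
    (cycTwist ζ hℓ hm).comp (cycTwist ζ hℓ' hm') = AlgHom.id _ _ :=
  cycHecke_algHom_ext fun b => by
    rw [AlgHom.comp_apply, cycTwist_braidElt, map_smul, cycTwist_braidElt, smul_smul, ← map_mul,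
      mul_comm, h, map_one, one_smul, AlgHom.id_apply]

/-- The isomorphism `ℋ_{m + ν} ≃ ℋ_m`, `b ↦ q ^ {ℓ(b)} b`. -/
def cycEquiv (ζ : HOrbit W → (𝓞 K)ˣ) (hℓ : IsLength ν ℓ) (hm : ∀ C j, m' C j = m C j + ν C) :
    CycHecke x₀ ζ m' ≃ₐ[(𝓞 K)[T;T⁻¹]] CycHecke x₀ ζ m :=
  AlgEquiv.ofAlgHom (cycTwist ζ hℓ hm)
    (cycTwist ζ hℓ.inv fun C j => by rw [hm, Pi.neg_apply, add_neg_cancel_right])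
    (cycTwist_comp _ _ _ _ fun b => mul_inv_cancel (ℓ b))
    (cycTwist_comp _ _ _ _ fun b => inv_mul_cancel (ℓ b))

lemma cycEquiv_braidElt (hℓ : IsLength ν ℓ) (hm : ∀ C j, m' C j = m C j + ν C) (b : Braid x₀) :
    cycEquiv ζ hℓ hm (specialize _ (braidElt b)) =
      qPow K (ℓ b) • specialize (cycSpec ζ m) (braidElt b) :=
  cycTwist_braidElt hℓ hm b

variable [Finite W] {t : GenericHecke x₀ →ₗ[MvLaurent (ParamIndex W)] MvLaurent (ParamIndex W)}

/-- The isomorphism `ℋ_{m + ν} ≃ ℋ_m` respects the specializations of the canonical form. -/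
lemma specializeForm_cycEquiv (ht : IsCanonicalForm ζ t)
    (hfree : Module.Free (MvLaurent (ParamIndex W)) (GenericHecke x₀))
    (hrank : Module.finrank (MvLaurent (ParamIndex W)) (GenericHecke x₀) = Nat.card W)
    (hℓ : IsLength ν ℓ) (hm : ∀ C j, m' C j = m C j + ν C) (h : CycHecke x₀ ζ m') :
    specializeForm (cycSpec ζ m) t (cycEquiv ζ hℓ hm h) = specializeForm (cycSpec ζ m') t h := by
  refine specializeForm_apply_eq (e := (cycEquiv ζ hℓ hm).toLinearMap) (span_braidElt (x₀ := x₀))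
    (Set.forall_mem_range.2 fun b => ?_) h
  -- On braids both sides equal `q ^ ℓ(b) φ_m(t(b))`, because `t(b)` has degree `ℓ(b)`.
  rw [AlgEquiv.toLinearMap_apply, braidHom_apply, cycEquiv_braidElt, map_smul,
    specializeForm_specialize, smul_eq_mul, cycSpec_of_isHomog hm (ht.isHomog hfree hrank hℓ b)]
  rfl

end Twist

/-! ### Simple modules and isomorphisms of algebras -/

section IrrCongr

variable {F : Type*} [Field F] {A B : Type*} [Ring A] [Ring B] [Algebra F A] [Algebra F B]

/-- The bijection between maximal left ideals induced by an isomorphism of algebras. -/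
def maximalCongr (e : A ≃ₐ[F] B) :
    {I : Submodule A A // IsCoatom I} ≃ {I : Submodule B B // IsCoatom I} :=
  e.symm.toRingEquiv.idealComapOrderIso.toEquiv.subtypeEquiv
    fun I => (OrderIso.isCoatom_iff e.symm.toRingEquiv.idealComapOrderIso I).symm

lemma exists_quotient_congr (e : A ≃ₐ[F] B) (I : {I : Submodule A A // IsCoatom I}) :
    ∃ φ : (A ⧸ I.1) ≃ₗ[F] (B ⧸ (maximalCongr e I).1), ∀ (a : A) v, φ (a • v) = e a • φ v := by
  have h : (I.1.restrictScalars F).map e.toLinearEquiv.toLinearMap =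
      (maximalCongr e I).1.restrictScalars F := by
    ext b
    rw [Submodule.mem_map_equiv]
    exact Iff.rfl
  refine ⟨(Submodule.Quotient.restrictScalarsEquiv F I.1).symm.trans
    ((Submodule.Quotient.equiv _ _ e.toLinearEquiv h).trans
      (Submodule.Quotient.restrictScalarsEquiv F _)), fun a v => ?_⟩
  obtain ⟨v, rfl⟩ := Submodule.Quotient.mk_surjective _ v
  exact congrArg (Submodule.Quotient.mk (p := (maximalCongr e I).1)) (map_mul e a v)

/-- Transport of an isomorphism of modules along an isomorphism of algebras. -/
def linearEquivCongr {M N M' N' : Type*} [AddCommGroup M] [AddCommGroup N] [AddCommGroup M']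
    [AddCommGroup N'] [Module A M] [Module A N] [Module B M'] [Module B N'] [Module F M]
    [Module F N] [Module F M'] [Module F N'] (e : A ≃ₐ[F] B) {φ : M ≃ₗ[F] M'} {ψ : N ≃ₗ[F] N'}
    (hφ : ∀ (a : A) v, φ (a • v) = e a • φ v) (hψ : ∀ (a : A) v, ψ (a • v) = e a • ψ v)
    (f : M ≃ₗ[A] N) : M' ≃ₗ[B] N' where
  __ := (φ.symm.toAddEquiv.trans f.toAddEquiv).trans ψ.toAddEquiv
  map_smul' b v := by
    have h : φ.symm (b • v) = e.symm b • φ.symm v :=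
      φ.injective (by rw [hφ, φ.apply_symm_apply, φ.apply_symm_apply, e.apply_symm_apply])
    change ψ (f (φ.symm (b • v))) = b • ψ (f (φ.symm v))
    rw [h, map_smul, hψ, e.apply_symm_apply]

lemma smul_symm_congr {M M' : Type*} [AddCommGroup M] [AddCommGroup M'] [Module A M] [Module B M']
    [Module F M] [Module F M'] (e : A ≃ₐ[F] B) {φ : M ≃ₗ[F] M'}
    (hφ : ∀ (a : A) v, φ (a • v) = e a • φ v) (b : B) (v : M') :
    φ.symm (b • v) = e.symm b • φ.symm v :=
  φ.injective (by rw [hφ, φ.apply_symm_apply, φ.apply_symm_apply, e.apply_symm_apply])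

/-- The bijection between simple modules induced by an isomorphism of algebras. -/
def irrCongr (e : A ≃ₐ[F] B) : Irr A ≃ Irr B :=
  Quotient.congr (maximalCongr e) fun I J => by
    obtain ⟨φ, hφ⟩ := exists_quotient_congr e I
    obtain ⟨ψ, hψ⟩ := exists_quotient_congr e J
    exact ⟨fun ⟨f⟩ => ⟨linearEquivCongr e hφ hψ f⟩, fun ⟨f⟩ =>
      ⟨linearEquivCongr e.symm (smul_symm_congr e hφ) (smul_symm_congr e hψ) f⟩⟩

lemma exists_irrCongr_mod (e : A ≃ₐ[F] B) (x : Irr A) :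
    ∃ φ : x.Mod ≃ₗ[F] (irrCongr e x).Mod, ∀ (a : A) v, φ (a • v) = e a • φ v := by
  obtain ⟨φ, hφ⟩ := exists_quotient_congr e x.out
  have h : irrCongr e x = Quotient.mk _ (maximalCongr e x.out) := by
    conv_lhs => rw [← Quotient.out_eq x]
    rfl
  -- The chosen representatives of corresponding classes need not correspond under `maximalCongr`;
  -- `g` compares the two.
  obtain ⟨g⟩ : Nonempty ((B ⧸ (maximalCongr e x.out).1) ≃ₗ[B] (irrCongr e x).Mod) := by
    rw [h]
    exact (irrSetoid B).symm (Quotient.mk_out (s := irrSetoid B) (maximalCongr e x.out))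
  refine ⟨φ.trans (g.restrictScalars F), fun a v => ?_⟩
  change g (φ (a • v)) = e a • g (φ v)
  rw [hφ, map_smul]

lemma conj_lsmul {M M' : Type*} [AddCommGroup M] [AddCommGroup M'] [Module A M] [Module B M']
    [Module F M] [Module F M'] [IsScalarTower F A M] [IsScalarTower F B M'] {φ : M ≃ₗ[F] M'}
    {a : A} {b : B} (hφ : ∀ v, φ (a • v) = b • φ v) :
    φ.conj (Algebra.lsmul F F M a) = Algebra.lsmul F F M' b := by
  ext v
  rw [LinearEquiv.conj_apply_apply, Algebra.lsmul_coe, hφ, φ.apply_symm_apply, Algebra.lsmul_coe]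

lemma character_irrCongr (e : A ≃ₐ[F] B) (x : Irr A) (a : A) :
    character F (irrCongr e x) (e a) = character F x a := by
  obtain ⟨φ, hφ⟩ := exists_irrCongr_mod e x
  rw [character, character, ← conj_lsmul (hφ a), LinearMap.trace_conj']

lemma charpolyOn_irrCongr (e : A ≃ₐ[F] B) (x : Irr A) (a : A) :
    charpolyOn F (irrCongr e x) (e a) = charpolyOn F x a := by
  obtain ⟨φ, hφ⟩ := exists_irrCongr_mod e x
  unfold charpolyOn
  by_cases h : Module.Finite F x.Mod
  · have h' : Module.Finite F (irrCongr e x).Mod := Module.Finite.equiv φ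
    rw [dif_pos h, dif_pos h', ← conj_lsmul (hφ a), LinearEquiv.charpoly_conj]
  -- Both sides take the default value `0`.
  · have h' : ¬ Module.Finite F (irrCongr e x).Mod := fun _ => h (Module.Finite.equiv φ.symm)
    rw [dif_neg h, dif_neg h']

end IrrCongr

/-! ### Transport of basic sets -/

section Transport

set_option linter.unusedSectionVars false

variable {K : Type*} [Field K] {V : Type*} [AddCommGroup V] [Module K V]
  {W : Subgroup (V ≃ₗ[K] V)} [Algebra K ℂ] [NumberField K] {x₀ : VReg W}
  {ν : HOrbit W → ℤ} {ℓ : Braid x₀ →* Multiplicative ℤ} {ζ : HOrbit W → (𝓞 K)ˣ} {m m' : Params W}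
  {t : GenericHecke x₀ →ₗ[MvLaurent (ParamIndex W)] MvLaurent (ParamIndex W)}
  {Λ : Type*} [Fintype Λ] {irr : Λ ≃ Irr (MonoidAlgebra K W)}
  {k : Type*} [Field k] {θ : (𝓞 K)[T;T⁻¹] →+* k}

lemma evalOne_qPow (n : Multiplicative ℤ) : evalOne K (qPow K n) = 1 := by
  refine (LaurentPolynomial.eval₂_T ..).trans ?_
  rw [one_zpow, Units.val_one]

lemma character_smul {F : Type*} [Field F] {A : Type*} [Ring A] [Algebra F A] (x : Irr A) (c : F)
    (a : A) : character F x (c • a) = c * character F x a := by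
  rw [character, map_smul, map_smul, smul_eq_mul, character]

lemma character_irrCongr_symm {F : Type*} [Field F] {A B : Type*} [Ring A] [Ring B] [Algebra F A]
    [Algebra F B] (e : A ≃ₐ[F] B) (y : Irr B) (a : A) :
    character F ((irrCongr e).symm y) a = character F y (e a) := by
  rw [← character_irrCongr e, Equiv.apply_symm_apply]

lemma charpolyOn_irrCongr_symm {F : Type*} [Field F] {A B : Type*} [Ring A] [Ring B] [Algebra F A]
    [Algebra F B] (e : A ≃ₐ[F] B) (y : Irr B) (a : A) :
    charpolyOn F ((irrCongr e).symm y) a = charpolyOn F y (e a) := by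
  rw [← charpolyOn_irrCongr e, Equiv.apply_symm_apply]

/-- The character value at a braid is only multiplied by `q ^ ℓ(b)`, which becomes `1` at `y = 1`.
-/
lemma IsTitsBijection.transport {E : Λ ≃ Irr (KyHecke x₀ ζ m)} (hE : IsTitsBijection irr x₀ ζ m E)
    (hℓ : IsLength ν ℓ) (hm : ∀ C j, m' C j = m C j + ν C) :
    IsTitsBijection irr x₀ ζ m'
      (E.trans (irrCongr (specCongr (toRatFunc K) (cycEquiv ζ hℓ hm))).symm) := by
  intro l b w hb
  obtain ⟨p, hp, hp1⟩ := hE l b w hb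
  refine ⟨qPow K (ℓ b) * p, ?_, ?_⟩
  · rw [Equiv.trans_apply, character_irrCongr_symm, specCongr_specialize, cycEquiv_braidElt,
      specialize_smul, character_smul, map_mul, hp]
  · rw [map_mul, evalOne_qPow, one_mul, hp1]

/-- The same `s` serves for both parameters, so the a-values coincide; this is what the homogeneity
of `t` is for. -/
lemma IsSchurFamily.transport [Finite W] {E : Λ ≃ Irr (KyHecke x₀ ζ m)} {s : Λ → RatFunc K}
    (hs : IsSchurFamily x₀ ζ m t E s) (ht : IsCanonicalForm ζ t)
    (hfree : Module.Free (MvLaurent (ParamIndex W)) (GenericHecke x₀))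
    (hrank : Module.finrank (MvLaurent (ParamIndex W)) (GenericHecke x₀) = Nat.card W)
    (hℓ : IsLength ν ℓ) (hm : ∀ C j, m' C j = m C j + ν C) :
    IsSchurFamily x₀ ζ m' t
      (E.trans (irrCongr (specCongr (toRatFunc K) (cycEquiv ζ hℓ hm))).symm) s := by
  refine ⟨hs.1, fun h => ?_⟩
  have h1 := hs.2 (specCongr (toRatFunc K) (cycEquiv ζ hℓ hm) h)
  rw [specializeForm_specCongr _ (specializeForm_cycEquiv ht hfree hrank hℓ hm)] at h1
  rw [h1]
  refine Finset.sum_congr rfl fun l _ => ?_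
  rw [Equiv.trans_apply, character_irrCongr_symm]

lemma IsDecompositionMap.transport {E : Λ ≃ Irr (KyHecke x₀ ζ m)}
    {d : Λ → (Irr (kHecke θ x₀ ζ m) →₀ ℕ)} (hd : IsDecompositionMap x₀ ζ m θ E d)
    (hℓ : IsLength ν ℓ) (hm : ∀ C j, m' C j = m C j + ν C) :
    IsDecompositionMap x₀ ζ m' θ
      (E.trans (irrCongr (specCongr (toRatFunc K) (cycEquiv ζ hℓ hm))).symm)
      fun l => Finsupp.equivMapDomain (irrCongr (specCongr θ (cycEquiv ζ hℓ hm))).symm (d l) := by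
  intro l h
  obtain ⟨p, hp, hp'⟩ := hd l (cycEquiv ζ hℓ hm h)
  refine ⟨p, ?_, ?_⟩
  · rw [hp, Equiv.trans_apply, charpolyOn_irrCongr_symm, specCongr_specialize]
  · rw [hp', Finsupp.prod_equivMapDomain]
    simp only [charpolyOn_irrCongr_symm, specCongr_specialize]

/-- Basic sets do not change when integers which depend only on the orbit are added to the
parameters. -/
theorem IsBasicSet.transport [Finite W] {𝓑 : Set Λ} (h𝓑 : IsBasicSet irr x₀ ζ m t θ 𝓑)
    (ht : IsCanonicalForm ζ t)
    (hfree : Module.Free (MvLaurent (ParamIndex W)) (GenericHecke x₀))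
    (hrank : Module.finrank (MvLaurent (ParamIndex W)) (GenericHecke x₀) = Nat.card W)
    (hℓ : IsLength ν ℓ) (hm : ∀ C j, m' C j = m C j + ν C) :
    IsBasicSet irr x₀ ζ m' t θ 𝓑 := by
  obtain ⟨E, s, d, hE, hs, hd, L, hL, hLd⟩ := h𝓑
  refine ⟨_, s, _, hE.transport hℓ hm, hs.transport ht hfree hrank hℓ hm, hd.transport hℓ hm,
    L ∘ irrCongr (specCongr θ (cycEquiv ζ hℓ hm)), ?_, fun M => ?_⟩
  · exact hL.comp (Set.bijOn_univ.2 (Equiv.bijective _))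
  · obtain ⟨h1, h2⟩ := hLd (irrCongr (specCongr θ (cycEquiv ζ hℓ hm)) M)
    simp only [Finsupp.equivMapDomain_apply, Equiv.symm_symm, Function.comp_apply]
    exact ⟨h1, h2⟩

end Transport

/-! ### Separation of simple modules -/

section Separation

/-- Pairwise non-isomorphic simple modules are separated by elements of the algebra. -/
lemma exists_smul_eq_of_simple {F A ι : Type*} [Field F] [Ring A] [Algebra F A] [Fintype ι]
    [DecidableEq ι] (M : ι → Type*) [∀ i, AddCommGroup (M i)] [∀ i, Module A (M i)]
    [∀ i, Module F (M i)] [∀ i, IsScalarTower F A (M i)] [∀ i, Module.Finite F (M i)]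
    [∀ i, IsSimpleModule A (M i)] (hM : ∀ i j, Nonempty (M i ≃ₗ[A] M j) → i = j) (i : ι) :
    ∃ a : A, (∀ v : M i, a • v = v) ∧ ∀ j ≠ i, ∀ v : M j, a • v = 0 := by
  have hzero (g : Module.End A (∀ i, M i)) {j j' : ι} (hj : j ≠ j') (v : M j) :
      g (Pi.single j v) j' = 0 := by
    let φ : M j →ₗ[A] M j' := LinearMap.proj j' ∘ₗ g ∘ₗ LinearMap.single A M j
    have hφ : φ = 0 := φ.bijective_or_eq_zero.resolve_left fun h =>
      hj (hM _ _ ⟨LinearEquiv.ofBijective φ h⟩)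
    exact LinearMap.congr_fun hφ v
  -- The projection to the `i`-th factor commutes with all endomorphisms of the product, by Schur's
  -- lemma. The density theorem realizes it by an element of `A` on a finite set, taken to span over
  -- `F`.
  let f : Module.End (Module.End A (∀ i, M i)) (∀ i, M i) :=
    { toFun := fun v => Pi.single i (v i)
      map_add' := fun v w => by rw [Pi.add_apply, Pi.single_add]
      map_smul' := fun g v => by
        rw [RingHom.id_apply, Module.End.smul_def, Module.End.smul_def]
        have hv : v = ∑ j, Pi.single j (v j) := (Finset.univ_sum_single v).symm
        have h1 : g v i = g (Pi.single i (v i)) i := by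
          conv_lhs => rw [hv, map_sum, Finset.sum_apply]
          exact Finset.sum_eq_single i (fun j _ hj => hzero g hj _)
            fun h => absurd (Finset.mem_univ i) h
        ext j
        by_cases hj : j = i
        · subst hj
          rw [Pi.single_eq_same, h1]
        · rw [Pi.single_eq_of_ne hj, hzero g (Ne.symm hj)] }
  obtain ⟨s, hs⟩ := Module.Finite.fg_top (R := F) (M := ∀ i, M i)
  obtain ⟨a, ha⟩ := jacobson_density f s
  have ha' (v : ∀ i, M i) : Pi.single i (v i) = a • v := by
    have hv : v ∈ Submodule.span F (s : Set (∀ i, M i)) := hs ▸ Submodule.mem_top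
    induction hv using Submodule.span_induction with
    | mem v hv => exact ha v hv
    | zero => rw [smul_zero, Pi.zero_apply, Pi.single_zero]
    | add v w _ _ hv hw => rw [smul_add, ← hv, ← hw, Pi.add_apply, Pi.single_add]
    | smul c v _ hv => rw [smul_comm a c v, ← hv, Pi.smul_apply, Pi.single_smul]
  refine ⟨a, fun v => ?_, fun j hj v => ?_⟩
  · have := congrFun (ha' (Pi.single i v)) i
    rwa [Pi.single_eq_same, Pi.smul_apply, Pi.single_eq_same, eq_comm] at this
  · have := congrFun (ha' (Pi.single j v)) j
    rwa [Pi.single_eq_of_ne hj, Pi.smul_apply, Pi.single_eq_same, eq_comm] at this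

lemma Irr.ext {A : Type*} [Ring A] {x y : Irr A} (h : Nonempty (x.Mod ≃ₗ[A] y.Mod)) :
    x = y := by
  rw [← Quotient.out_eq x, ← Quotient.out_eq y]
  exact Quotient.sound h

instance Irr.isSimpleModule {A : Type*} [Ring A] (x : Irr A) : IsSimpleModule A x.Mod :=
  isSimpleModule_iff_isCoatom.2 (Quotient.out x).2

lemma Irr.exists_separating (F : Type*) {A : Type*} [Field F] [Ring A] [Algebra F A]
    [Module.Finite F A] (X : Finset (Irr A)) (x : Irr A) (hx : x ∈ X) :
    ∃ a : A, (∀ v : x.Mod, a • v = v) ∧ ∀ y ∈ X, y ≠ x → ∀ v : y.Mod, a • v = 0 := by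
  classical
  obtain ⟨a, ha, ha'⟩ := exists_smul_eq_of_simple (F := F) (A := A) (fun y : X => y.1.Mod)
    (fun y z h => Subtype.ext (Irr.ext h)) ⟨x, hx⟩
  exact ⟨a, ha, fun y hy hyx => ha' ⟨y, hy⟩ fun h => hyx (congrArg Subtype.val h)⟩

variable {F A : Type*} [Field F] [Ring A] [Algebra F A] [Module.Finite F A]

lemma character_eq_of_smul {x : Irr A} {a : A} {c : F} (ha : ∀ v : x.Mod, a • v = c • v) :
    character F x a = c * Module.finrank F x.Mod := by
  have : (Algebra.lsmul F F x.Mod a : x.Mod →ₗ[F] x.Mod) = c • LinearMap.id := LinearMap.ext ha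
  rw [character, this, map_smul, LinearMap.trace_id, smul_eq_mul]

lemma charpoly_lsmul {F A M : Type*} [Field F] [Ring A] [Algebra F A] [AddCommGroup M] [Module A M]
    [Module F M] [IsScalarTower F A M] [Module.Finite F M] {a : A} {c : F}
    (ha : ∀ v : M, a • v = c • v) : LinearMap.charpoly (Algebra.lsmul F F M a) =
      (Polynomial.X - Polynomial.C c) ^ Module.finrank F M := by
  have : (Algebra.lsmul F F M a : Module.End F M) = 0 - (-c) • 1 := by
    rw [zero_sub, neg_smul, neg_neg]
    exact LinearMap.ext ha
  rw [this, LinearMap.charpoly_sub_smul, LinearMap.charpoly_zero, Polynomial.X_pow_comp,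
    Polynomial.C_neg, sub_eq_add_neg]

lemma charpolyOn_eq_of_smul {x : Irr A} {a : A} {c : F} (ha : ∀ v : x.Mod, a • v = c • v) :
    charpolyOn F x a = (Polynomial.X - Polynomial.C c) ^ Module.finrank F x.Mod := by
  have h : Module.Finite F x.Mod := inferInstance
  rw [charpolyOn, dif_pos h, charpoly_lsmul ha]

lemma Irr.finrank_pos (x : Irr A) : 0 < Module.finrank F x.Mod := by
  have : Nontrivial x.Mod := IsSimpleModule.nontrivial A x.Mod
  exact Module.finrank_pos

/-- Linear independence of characters in characteristic zero. -/
lemma eq_zero_of_sum_character [CharZero F] {Λ : Type*} [Fintype Λ] (E : Λ ≃ Irr A) {c : Λ → F}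
    (h : ∀ a, ∑ l, c l * character F (E l) a = 0) (l : Λ) : c l = 0 := by
  classical
  obtain ⟨a, ha, ha'⟩ := Irr.exists_separating F (Finset.univ.map E.toEmbedding) (E l)
    (Finset.mem_map_of_mem _ (Finset.mem_univ l))
  have h1 := h a
  rw [Finset.sum_eq_single l] at h1
  · rw [character_eq_of_smul (c := 1) (fun v => by rw [ha, one_smul]), one_mul] at h1
    exact (mul_eq_zero.1 h1).resolve_right (Nat.cast_ne_zero.2 (Irr.finrank_pos (E l)).ne')
  · intro j _ hj
    rw [character_eq_of_smul (c := 0) (fun v => ?_), zero_mul, mul_zero]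
    rw [zero_smul]
    exact ha' _ (Finset.mem_map_of_mem _ (Finset.mem_univ j)) (fun h => hj (E.injective h)) v
  · exact fun h => absurd (Finset.mem_univ l) h

/-- The character of a simple module determines it in characteristic zero. -/
lemma Irr.eq_of_character_eq [CharZero F] {x y : Irr A}
    (h : ∀ a, character F x a = character F y a) : x = y := by
  classical
  by_contra hxy
  obtain ⟨a, ha, ha'⟩ := Irr.exists_separating F {x, y} x (by simp)
  have h1 := h a
  rw [character_eq_of_smul (c := 1) (fun v => by rw [ha, one_smul]), one_mul,
    character_eq_of_smul (c := 0) (fun v => by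
      rw [zero_smul]; exact ha' y (by simp) (Ne.symm hxy) v), zero_mul] at h1
  exact Nat.cast_ne_zero.2 (Irr.finrank_pos x).ne' h1

/-- A family of multiplicities of simple modules is determined by characteristic polynomials. -/
lemma eq_of_prod_charpolyOn {d d' : Irr A →₀ ℕ} {S : Set A}
    (hS : ∀ a : A, ∃ c : F, c ≠ 0 ∧ c • a ∈ S)
    (h : ∀ a ∈ S, (d.prod fun M n => charpolyOn F M a ^ n) =
      d'.prod fun M n => charpolyOn F M a ^ n) :
    d = d' := by
  classical
  ext x
  let X := insert x (d.support ∪ d'.support)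
  -- The element `c • a` acts as `c ≠ 0` on `x` and as `0` on the other modules involved. The order
  -- of the root `c` is then `dim x` times the multiplicity of `x`; unlike a trace, it loses nothing
  -- in positive characteristic.
  obtain ⟨a, ha, ha'⟩ := Irr.exists_separating F X x (Finset.mem_insert_self _ _)
  obtain ⟨c, hc, hca⟩ := hS a
  have hx : charpolyOn F x (c • a) =
      (Polynomial.X - Polynomial.C c) ^ Module.finrank F x.Mod :=
    charpolyOn_eq_of_smul fun v => by rw [smul_assoc, ha]
  have hy (y : Irr A) (hy : y ∈ X) (hyx : y ≠ x) : (charpolyOn F y (c • a)).eval c ≠ 0 := by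
    rw [charpolyOn_eq_of_smul (c := 0) (fun v => by
      rw [smul_assoc, ha' y hy hyx, smul_zero, zero_smul])]
    simp [hc]
  have key (e : Irr A →₀ ℕ) (he : e.support ⊆ X) :
      (e.prod fun M n => charpolyOn F M (c • a) ^ n).rootMultiplicity c =
        Module.finrank F x.Mod * e x := by
    rw [Finsupp.prod_of_support_subset e he _ (fun _ _ => pow_zero _),
      ← Finset.mul_prod_erase X _ (Finset.mem_insert_self _ _), hx, ← pow_mul]
    have hne : (∏ y ∈ X.erase x, charpolyOn F y (c • a) ^ e y).eval c ≠ 0 := by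
      rw [Polynomial.eval_prod]
      refine Finset.prod_ne_zero_iff.2 fun y hyX => ?_
      rw [Polynomial.eval_pow]
      exact pow_ne_zero _ (hy y (Finset.mem_of_mem_erase hyX) (Finset.ne_of_mem_erase hyX))
    rw [Polynomial.rootMultiplicity_mul, Polynomial.rootMultiplicity_X_sub_C_pow,
      Polynomial.rootMultiplicity_eq_zero hne, add_zero]
    exact mul_ne_zero (pow_ne_zero _ (Polynomial.X_sub_C_ne_zero c)) fun h0 =>
      hne (by rw [h0, Polynomial.eval_zero])
  have h1 := congrArg (Polynomial.rootMultiplicity c) (h _ hca)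
  rw [key d (fun y hy => Finset.mem_insert_of_mem (Finset.mem_union_left _ hy)),
    key d' (fun y hy => Finset.mem_insert_of_mem (Finset.mem_union_right _ hy))] at h1
  exact Nat.eq_of_mul_eq_mul_left (Irr.finrank_pos x) h1

end Separation

/-! ### Uniqueness of basic sets -/

section Uniqueness

set_option linter.unusedSectionVars false

lemma toRatFunc_injective (K : Type*) [Field K] [NumberField K] :
    Function.Injective (toRatFunc K) := by
  refine (injective_iff_map_eq_zero _).2 fun p hp => ?_
  obtain ⟨n, q, hq⟩ := p.exists_T_pow
  have h1 : toRatFunc K (Polynomial.toLaurent q) = 0 := by rw [hq, map_mul, hp, zero_mul]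
  have h2 : algebraMap (Polynomial K) (RatFunc K) (q.map (algebraMap (𝓞 K) K)) = 0 := by
    refine Eq.trans ?_ h1
    rw [toRatFunc, LaurentPolynomial.eval₂_toLaurent, Units.val_mk0, ← Polynomial.eval₂_map,
      ← RatFunc.algebraMap_X, ← Polynomial.aeval_def, Polynomial.aeval_algebraMap_apply,
      Polynomial.aeval_X_left_apply]
  have h3 : q = 0 := Polynomial.map_injective _ (FaithfulSMul.algebraMap_injective (𝓞 K) K) (by
    rw [Polynomial.map_zero]
    exact (map_eq_zero_iff _ (IsFractionRing.injective (Polynomial K) (RatFunc K))).1 h2)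
  rw [h3, map_zero] at hq
  exact (LaurentPolynomial.isUnit_T (n : ℤ)).mul_left_eq_zero.1 hq.symm

/-- Elements of a specialization to the field of fractions of the image have denominators. -/
lemma exists_smul_mem_range_specialize {S k : Type*} [CommRing S] [Field k] {θ : S →+* k}
    (hk : IsFractionRing θ.range k) {H : Type*} [Ring H] [Algebra S H] (a : Specialization θ H) :
    ∃ c : k, c ≠ 0 ∧ c • a ∈ Set.range (specialize θ : H →+* Specialization θ H) := by
  suffices h : ∃ c : S, θ c ≠ 0 ∧ θ c • a ∈ Set.range (specialize θ : H →+* Specialization θ H) from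
    let ⟨c, hc, hca⟩ := h; ⟨θ c, hc, hca⟩
  induction a using specialization_induction with
  | zero => exact ⟨1, by rw [map_one]; exact one_ne_zero, 0, by rw [map_zero, smul_zero]⟩
  | add a a' h h' =>
    obtain ⟨c, hc, x, hx⟩ := h
    obtain ⟨c', hc', x', hx'⟩ := h'
    refine ⟨c * c', by rw [map_mul]; exact mul_ne_zero hc hc', c' • x + c • x', ?_⟩
    rw [map_add, specialize_smul, specialize_smul, hx, hx', smul_add, smul_smul, smul_smul, map_mul,
      mul_comm (θ c')]
  | smul z x =>
    obtain ⟨⟨_, r, rfl⟩, ⟨_, c, rfl⟩, hc, hz⟩ := IsFractionRing.div_surjective (A := θ.range) z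
    have hc0 : θ c ≠ 0 := fun h0 => nonZeroDivisors.ne_zero hc (Subtype.ext h0)
    refine ⟨c, hc0, r • x, ?_⟩
    rw [specialize_smul, smul_smul, ← hz]
    change θ r • _ = (θ c * (θ r / θ c)) • _
    rw [mul_div_cancel₀ _ hc0]

lemma Irr.eq_of_character_single_eq {K G : Type*} [Field K] [CharZero K] [Group G] [Finite G]
    {x y : Irr (MonoidAlgebra K G)}
    (h : ∀ w, character K x (MonoidAlgebra.single w 1) = character K y (MonoidAlgebra.single w 1)) :
    x = y := by
  have : Module.Finite K (MonoidAlgebra K G) := inferInstance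
  refine Irr.eq_of_character_eq (F := K) fun a => ?_
  induction a using MonoidAlgebra.induction_linear with
  | zero => simp [character]
  | add a b ha hb =>
    have hadd (z : Irr (MonoidAlgebra K G)) :
        character K z (a + b) = character K z a + character K z b := by
      rw [character, map_add, map_add, character, character]
    rw [hadd, hadd, ha, hb]
  | single w c =>
    have : MonoidAlgebra.single w c = c • MonoidAlgebra.single w (1 : K) := by
      rw [MonoidAlgebra.smul_single, smul_eq_mul, mul_one]
    rw [this, character_smul, character_smul, h]

variable {K : Type*} [Field K] {V : Type*} [AddCommGroup V] [Module K V]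
  {W : Subgroup (V ≃ₗ[K] V)} [Algebra K ℂ] [NumberField K] {x₀ : VReg W}
  {ζ : HOrbit W → (𝓞 K)ˣ} {m : Params W}
  {t : GenericHecke x₀ →ₗ[MvLaurent (ParamIndex W)] MvLaurent (ParamIndex W)}
  {Λ : Type*} [Fintype Λ] {irr : Λ ≃ Irr (MonoidAlgebra K W)}
  {k : Type*} [Field k] {θ : (𝓞 K)[T;T⁻¹] →+* k}

/-- Two labels of one module have characters of `W` specialized from the same Laurent polynomials,
because `toRatFunc` is injective; in characteristic zero the character determines the label. -/
lemma IsTitsBijection.unique [Finite W] {E E' : Λ ≃ Irr (KyHecke x₀ ζ m)}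
    (hE : IsTitsBijection irr x₀ ζ m E) (hE' : IsTitsBijection irr x₀ ζ m E') : E = E' := by
  ext l
  suffices h : E.symm (E' l) = l by rw [← h, Equiv.apply_symm_apply, h]
  refine irr.injective (Irr.eq_of_character_single_eq fun w => ?_)
  obtain ⟨b, hb⟩ := Braid.exists_mapsTo_of_mem (x₀ := x₀) w
  obtain ⟨p, hp, hp1⟩ := hE (E.symm (E' l)) b w hb
  obtain ⟨p', hp', hp1'⟩ := hE' l b w hb
  rw [Equiv.apply_symm_apply, ← hp'] at hp
  rw [← hp1, ← hp1', toRatFunc_injective K hp]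

lemma IsSchurFamily.unique [Module.Finite (MvLaurent (ParamIndex W)) (GenericHecke x₀)]
    {E : Λ ≃ Irr (KyHecke x₀ ζ m)} {s s' : Λ → RatFunc K}
    (hs : IsSchurFamily x₀ ζ m t E s) (hs' : IsSchurFamily x₀ ζ m t E s') : s = s' := by
  ext l
  have h : (s l)⁻¹ - (s' l)⁻¹ = 0 :=
    eq_zero_of_sum_character (F := RatFunc K) E (c := fun l => (s l)⁻¹ - (s' l)⁻¹) (fun a => by
      simp only [sub_mul, Finset.sum_sub_distrib]
      rw [← hs.2 a, ← hs'.2 a, sub_self]) l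
  exact inv_injective (sub_eq_zero.1 h)

lemma IsDecompositionMap.unique [Module.Finite (MvLaurent (ParamIndex W)) (GenericHecke x₀)]
    (hk : IsFractionRing θ.range k) {E : Λ ≃ Irr (KyHecke x₀ ζ m)}
    {d d' : Λ → (Irr (kHecke θ x₀ ζ m) →₀ ℕ)} (hd : IsDecompositionMap x₀ ζ m θ E d)
    (hd' : IsDecompositionMap x₀ ζ m θ E d') : d = d' := by
  funext l
  refine eq_of_prod_charpolyOn (F := k) (exists_smul_mem_range_specialize hk) ?_
  rintro _ ⟨h, rfl⟩
  obtain ⟨p, hp, hp1⟩ := hd l h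
  obtain ⟨p', hp', hp1'⟩ := hd' l h
  rw [← hp1, ← hp1', Polynomial.map_injective _ (toRatFunc_injective K) (hp.trans hp'.symm)]

/-- There is at most one basic set. -/
theorem IsBasicSet.unique [Finite W] [Module.Finite (MvLaurent (ParamIndex W)) (GenericHecke x₀)]
    (hk : IsFractionRing θ.range k) {𝓑 𝓑' : Set Λ} (h : IsBasicSet irr x₀ ζ m t θ 𝓑)
    (h' : IsBasicSet irr x₀ ζ m t θ 𝓑') : 𝓑 = 𝓑' := by
  obtain ⟨E, s, d, hE, hs, hd, L, hL, hLd⟩ := h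
  obtain ⟨E', s', d', hE', hs', hd', L', hL', hLd'⟩ := h'
  obtain rfl := hE.unique hE'
  obtain rfl := hs.unique hs'
  obtain rfl := hd.unique hk hd'
  -- If the two labels of `M` differed, each would occur with a nonzero decomposition number at `M`,
  -- and each would have a strictly smaller a-value than the other.
  have hLL : L = L' := funext fun M => by
    by_contra hne
    exact lt_asymm ((hLd M).2 _ (Ne.symm hne) (by rw [(hLd' M).1]; exact one_ne_zero))
      ((hLd' M).2 _ hne (by rw [(hLd M).1]; exact one_ne_zero))
  rw [← hL.image_eq, ← hL'.image_eq, hLL]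

end Uniqueness

end CyclotomicHecke

end

/-! ### The main theorem -/

open CyclotomicHecke in
open scoped NumberField LaurentPolynomial in
theorem mainTheorem3
    {K : Type*} [Field K] [NumberField K] [IsAbelianGalois ℚ K] [Algebra K ℂ]
    {V : Type*} [AddCommGroup V] [Module K V] [FiniteDimensional K V]
    (W : Subgroup (V ≃ₗ[K] V)) [Finite W]
    (hW : IsGeneratedByReflections W) (hirr : (tautRep W).IsIrreducible)
    (x₀ : VReg W)
    (ζ : HOrbit W → (𝓞 K)ˣ) (hζ : IsRootFamily ζ)
    (hfree : Module.Free (MvLaurent (ParamIndex W)) (GenericHecke x₀))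
    (hrank : Module.finrank (MvLaurent (ParamIndex W)) (GenericHecke x₀) = Nat.card W)
    (t : GenericHecke x₀ →ₗ[MvLaurent (ParamIndex W)] MvLaurent (ParamIndex W))
    (ht : IsCanonicalForm ζ t)
    {Λ : Type*} [Fintype Λ] (irr : Λ ≃ Irr (MonoidAlgebra K W))
    {k : Type*} [Field k] (θ : (𝓞 K)[T;T⁻¹] →+* k) (hk : IsFractionRing θ.range k)
    (m n : Params W) (hn : ∀ (C : HOrbit W) (i j : Fin (ordC W C)), n C i = n C j)
    (hsplit : IsSplit k (kHecke θ x₀ ζ m))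
    (𝓑 : Set Λ) (h𝓑 : IsBasicSet irr x₀ ζ m t θ 𝓑) :
    IsBasicSet irr x₀ ζ (m + n) t θ 𝓑 ∧
      ∀ 𝓑' : Set Λ, IsBasicSet irr x₀ ζ (m + n) t θ 𝓑' → 𝓑' = 𝓑 := by
  have : Infinite K := CharZero.infinite K
  have hfin : Module.Finite (MvLaurent (ParamIndex W)) (GenericHecke x₀) :=
    Module.finite_of_finrank_pos (hrank ▸ Nat.card_pos)
  -- `ν C` is the common value of the `n C j`; over an empty index set any integer would do.
  have hν : ∀ C, ∃ r : ℤ, ∀ j, n C j = r := fun C => by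
    rcases isEmpty_or_nonempty (Fin (ordC W C)) with h | ⟨⟨j₀⟩⟩
    · exact ⟨0, fun j => h.elim j⟩
    · exact ⟨n C j₀, fun j => hn C j j₀⟩
  choose ν hν using hν
  have hℓ : IsLength ν (braidLength hW ν x₀) := fun H s hs =>
    braidLength_monodromyGenerator hW ν hs
  have hm : ∀ C j, (m + n) C j = m C j + ν C := fun C j => congrArg (m C j + ·) (hν C j)
  have h : IsBasicSet irr x₀ ζ (m + n) t θ 𝓑 := h𝓑.transport ht hfree hrank hℓ hm
  exact ⟨h, fun 𝓑' h' => h'.unique hk h⟩
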